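/- **Setting.** Let $b(\cos\theta)\ge 0$ be a (measurable) function of $\theta\in[0,\pi]$ that vanishes for $\theta\in(\pi/2,\pi]$ and satisfies, for some $\alpha_0\in(0,2]$, $$\int_0^{\pi/2} b(\cos\theta)\,\sin\theta\,\sin^{\alpha_0}\!\left(\tfrac{\theta}{2}\right)d\theta<\infty .$$ Let $0<p\le 2$, $\delta_p\ge 0$ and $\alpha_0\le\alpha<p$. For $\xi\in\mathbb{R}^3$, $\sigma\in\mathbb{S}^2$ put $\xi^{\pm}=(\xi\pm|\xi|\sigma)/2$ and $$\mathcal{B}(\phi)(\xi)=\int_{\mathbb{S}^2} b\!\left(\tfrac{\xi}{|\xi|}\cdot\sigma\right)\big[\phi(\xi^+)\phi(\xi^-)-\phi(0)\phi(\xi)\big]\,d\sigma ,$$ where the integral is understood as the limit, as $\varepsilon\to0^+$, of the integrals over $\{\sigma:\ \theta\ge\varepsilon\}$, $\cos\theta=\frac{\xi}{|\xi|}\cdot\sigma$ (and $\mathcal{B}(\phi)(0)=0$). For $\phi:\mathbb{R}^3\times[0,\infty)\to\mathbb{C}$ write $\mathcal{B}(\phi)(\xi,\tau)=\mathcal{B}(\phi(\cdot,\tau))(\xi)$.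 The equation (FE) with initial datum $\phi_0$ is, for all $\xi\in\mathbb{R}^3$ and $t\ge0$, $$\phi(\xi,t)=e^{-\delta_p|\xi|^pt}\phi_0(\xi)+\int_0^t e^{-\delta_p|\xi|^p(t-\tau)}\,\mathcal{B}(\phi)(\xi,\tau)\,d\tau .$$ Let $\mathcal{K}$ be the set of all functions $\xi\mapsto\int_{\mathbb{R}^3}e^{-iv\cdot\xi}\,df(v)$, $f$ a Borel probability measure on $\mathbb{R}^3$. Put $$\|g\|_{\mathcal{M}^\alpha}=\int_{\mathbb{R}^3}\frac{|g(\xi)|}{|\xi|^{3+\alpha}}\,d\xi,\qquad \|g\|_\beta=\sup_{\xi\ne0}\frac{|g(\xi)|}{|\xi|^\beta},\qquad \mathcal{M}^\alpha=\{\phi\in\mathcal{K}:\ \|\phi-1\|_{\mathcal{M}^\alpha}<\infty\},$$ and let $\mathcal{M}^\alpha$ carry the metric $\|\phi-\psi\|_{\mathcal{M}^\alpha}+\|\phi-\psi\|_\beta$, where $\beta\in(0,\alpha]$ is fixed but arbitrary. Let $\mathcal{T}^\alpha_p(\mathbb{R}^3\times[0,\infty))$ be the set of all $\phi\in C([0,\infty);\mathcal{M}^\alpha)$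 such that, for every $\xi\in\mathbb{R}^3$, $\phi(\xi,\cdot)\in C([0,\infty))$ and $\partial_t\phi(\xi,\cdot)$ exists and is continuous on $(0,\infty)$, and such that $$\sup_{\xi\in\mathbb{R}^3}e^{\delta_p|\xi|^pt}|\phi(\xi,t)|\le1\qquad\text{for each } t\ge0 .$$ Finally let $$\lambda_\alpha=2\pi\int_0^{\pi/2}b(\cos\theta)\sin\theta\left[\cos^\alpha\!\left(\tfrac\theta2\right)+\sin^\alpha\!\left(\tfrac\theta2\right)-1\right]d\theta .$$ **Theorem 1.2.** Let $\phi,\psi\in\mathcal{T}^\alpha_p(\mathbb{R}^3\times[0,\infty))$ be solutions of (FE) with initial data $\phi_0,\psi_0\in\mathcal{M}^\alpha$, respectively. Then, for every $t\ge0$, $$\left\|e^{\delta_p|\cdot|^pt}\big(\phi(\cdot,t)-\psi(\cdot,t)\big)\right\|_{\mathcal{M}^\alpha}\le e^{\lambda_\alpha t}\,\|\phi_0-\psi_0\|_{\mathcal{M}^\alpha}.$$ In particular, for each $\phi_0\in\mathcal{M}^\alpha$, (FE) has at most one solution with initial datum $\phi_0$ in $\mathcal{T}^\alpha_p(\mathbb{R}^3\times[0,\infty))$.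 -/

import Mathlib

open MeasureTheory Set Filter Topology
open scoped ENNReal

namespace Boltzmann

noncomputable section

/-- The space `ℝ³` with its Euclidean norm. -/
abbrev R3 : Type := EuclideanSpace ℝ (Fin 3)

/-- `‖g‖_{𝓜^α} = ∫_{ℝ³} |g(ξ)| / |ξ|^{3+α} dξ`, as an extended non-negative number. -/
def normM (α : ℝ) (g : R3 → ℂ) : ℝ≥0∞ :=
  ∫⁻ ξ : R3, ‖g ξ‖ₑ / ENNReal.ofReal (‖ξ‖ ^ (3 + α))

/-- `‖g‖_β = sup_{ξ ≠ 0} |g(ξ)| / |ξ|^β`, as an extended non-negative number. -/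
def normK (β : ℝ) (g : R3 → ℂ) : ℝ≥0∞ :=
  ⨆ (ξ : R3) (_ : ξ ≠ 0), ‖g ξ‖ₑ / ENNReal.ofReal (‖ξ‖ ^ β)

/-- `𝓚`: the Fourier transforms `ξ ↦ ∫ e^{-i v·ξ} df(v)` of the Borel probability measures `f`
on `ℝ³`. -/
def spaceK : Set (R3 → ℂ) :=
  {φ | ∃ f : Measure R3, IsProbabilityMeasure f ∧
    ∀ ξ, φ ξ = ∫ v, Complex.exp (-(Complex.I * ((inner ℝ v ξ : ℝ) : ℂ))) ∂f}

/-- `𝓜^α`: the elements `φ` of `𝓚` with `‖φ - 1‖_{𝓜^α} < ∞`. -/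
def spaceM (α : ℝ) : Set (R3 → ℂ) :=
  {φ | φ ∈ spaceK ∧ normM α (fun ξ => φ ξ - 1) < ⊤}

/-- The distance `dis_{α,β}(φ, ψ) = ‖φ - ψ‖_{𝓜^α} + ‖φ - ψ‖_β` on `𝓜^α`. -/
def disM (α β : ℝ) (φ ψ : R3 → ℂ) : ℝ≥0∞ :=
  normM α (fun ξ => φ ξ - ψ ξ) + normK β (fun ξ => φ ξ - ψ ξ)

/-- `ξ⁺ = (ξ + |ξ| σ) / 2`. -/
def xiPlus (ξ σ : R3) : R3 := (2 : ℝ)⁻¹ • (ξ + ‖ξ‖ • σ)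

/-- `ξ⁻ = (ξ - |ξ| σ) / 2`. -/
def xiMinus (ξ σ : R3) : R3 := (2 : ℝ)⁻¹ • (ξ - ‖ξ‖ • σ)

/-- The collision integral over the deviation angles `θ ≥ ε`, where `cos θ = (ξ/|ξ|)·σ`:
`∫_{σ ∈ 𝕊², θ ≥ ε} b((ξ/|ξ|)·σ) [φ(ξ⁺) φ(ξ⁻) - φ(0) φ(ξ)] dσ`, with `dσ` the surface measure. -/
def collisionAway (b : ℝ → ℝ) (φ : R3 → ℂ) (ξ : R3) (ε : ℝ) : ℂ :=
  ∫ σ in {σ : Metric.sphere (0 : R3) 1 | inner ℝ (‖ξ‖⁻¹ • ξ) (σ : R3) ≤ Real.cos ε},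
    (b (inner ℝ (‖ξ‖⁻¹ • ξ) (σ : R3)) : ℂ) *
      (φ (xiPlus ξ σ) * φ (xiMinus ξ σ) - φ 0 * φ ξ) ∂(volume : Measure R3).toSphere

/-- `𝓑(φ)(ξ) = ∫_{𝕊²} b((ξ/|ξ|)·σ) [φ(ξ⁺) φ(ξ⁻) - φ(0) φ(ξ)] dσ`. Because of the singularity of
`b(cos θ)` at `θ = 0` this integral need not converge absolutely (it depends on cancellation over
the circles `θ = const`); it is the limit as `ε → 0+` of the integrals over `θ ≥ ε`. Where the
integral converges absolutely the limit is its value. -/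
def collision (b : ℝ → ℝ) (φ : R3 → ℂ) (ξ : R3) : ℂ :=
  limUnder (𝓝[>] (0 : ℝ)) (collisionAway b φ ξ)

/-- `φ` solves, for all `ξ ∈ ℝ³` and `t ≥ 0`, the integral equation with datum `φ₀`:
`φ(ξ,t) = e^{-δ|ξ|^p t} φ₀(ξ) + ∫_0^t e^{-δ|ξ|^p (t-τ)} 𝓑(φ(·,τ))(ξ) dτ`. -/
def IsSolutionFE (b : ℝ → ℝ) (δ p : ℝ) (φ₀ : R3 → ℂ) (φ : R3 → ℝ → ℂ) : Prop :=
  ∀ ξ : R3, ∀ t : ℝ, 0 ≤ t →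
    φ ξ t = (Real.exp (-(δ * ‖ξ‖ ^ p * t)) : ℂ) * φ₀ ξ +
      ∫ τ in (0 : ℝ)..t, (Real.exp (-(δ * ‖ξ‖ ^ p * (t - τ))) : ℂ) *
        collision b (fun η => φ η τ) ξ

/-- `𝓣^α(ℝ³ × [0,∞))`: the `φ ∈ C([0,∞); 𝓜^α)`, where `𝓜^α` has the distance `dis_{α,β}`, such
that `φ(ξ,·) ∈ C([0,∞))` and `∂_t φ(ξ,·) ∈ C((0,∞))` for every `ξ`. -/
structure MemT (α β : ℝ) (φ : R3 → ℝ → ℂ) : Prop where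
  mem : ∀ t : ℝ, 0 ≤ t → (fun ξ => φ ξ t) ∈ spaceM α
  continuous_dis : ∀ t : ℝ, 0 ≤ t →
    Tendsto (fun s => disM α β (fun ξ => φ ξ s) (fun ξ => φ ξ t)) (𝓝[Ici 0] t) (𝓝 0)
  continuousOn : ∀ ξ : R3, ContinuousOn (φ ξ) (Ici 0)
  differentiableOn : ∀ ξ : R3, DifferentiableOn ℝ (φ ξ) (Ioi 0)
  continuousOn_deriv : ∀ ξ : R3, ContinuousOn (deriv (φ ξ)) (Ioi 0)

/-- `𝓣^α_p(ℝ³ × [0,∞))`: the elements `φ` of `𝓣^α(ℝ³ × [0,∞))` with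
`sup_ξ e^{δ|ξ|^p t} |φ(ξ,t)| ≤ 1` for each `t ≥ 0`. -/
def MemTp (δ p α β : ℝ) (φ : R3 → ℝ → ℂ) : Prop :=
  MemT α β φ ∧ ∀ t : ℝ, 0 ≤ t → ∀ ξ : R3, Real.exp (δ * ‖ξ‖ ^ p * t) * ‖φ ξ t‖ ≤ 1

/-- `λ_α = 2π ∫_0^{π/2} b(cos θ) sin θ [cos^α(θ/2) + sin^α(θ/2) - 1] dθ`. -/
def lambdaConst (b : ℝ → ℝ) (α : ℝ) : ℝ :=
  2 * Real.pi * ∫ θ in (0 : ℝ)..(Real.pi / 2),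
    b (Real.cos θ) * Real.sin θ * (Real.cos (θ / 2) ^ α + Real.sin (θ / 2) ^ α - 1)

/-- A cross section: `b(cos θ)` is measurable, non-negative, and vanishes for
`θ ∈ (π/2, π]`. -/
structure IsCrossSection (b : ℝ → ℝ) : Prop where
  measurable : Measurable b
  nonneg : ∀ x ∈ Icc (-1 : ℝ) 1, 0 ≤ b x
  eq_zero : ∀ x ∈ Ico (-1 : ℝ) 0, b x = 0

/-- The weak integrability condition of order `α₀`:
`∫_0^{π/2} b(cos θ) sin θ sin^{α₀}(θ/2) dθ < ∞`. -/
def WeaklyIntegrable (b : ℝ → ℝ) (α₀ : ℝ) : Prop :=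
  IntegrableOn (fun θ : ℝ => b (Real.cos θ) * Real.sin θ * Real.sin (θ / 2) ^ α₀)
    (Ioc 0 (Real.pi / 2))

end

end Boltzmann

namespace Boltzmann

/-! Put w(ξ,t) = e^{δ|ξ|^p t}(φ − ψ)(ξ,t). The weight absorbs the exponential factors of (FE), so w
is φ₀ − ψ₀ plus the time integral of the weighted difference of the collision terms. Cut the
collision integral at deviation angle ε. The part θ ≥ ε splits into gain minus loss, with a finite
loss rate A_ε = ∫_{θ≥ε} b dσ that does not depend on ξ ≠ 0, and the integrating factor e^{A_ε t}
removes the loss. In the gain, |ξ|^p ≤ |ξ⁺|^p + |ξ⁻|^p (as p ≤ 2) distributes the weight over the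
two factors, and the decay bound on φ and ψ leaves |w(ξ⁺)| + |w(ξ⁻)| (`enorm_product_diff_le`).
Integration against |ξ|^{-3-α} is an exact computation: for fixed σ the map ξ ↦ ξ⁺ is a
diffeomorphism onto a half-space, and the two gain terms produce the factors ∫ b cos^α(θ/2) dσ and ∫
b sin^α(θ/2) dσ over θ ≥ ε (`lintegral_xiPlus`, `lintegral_xiMinus`), whose sum is at most A_ε + λ_α
(`angInt_gain_le`). Gronwall gives growth e^{(A_ε+λ_α)t} for e^{A_ε t}‖w‖, and A_ε, which may blow
up as ε → 0, cancels.

The grazing part θ < ε has to vanish in the limit although b need not be integrable. Averaging over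
the reflection of σ in the axis of ξ turns φ(ξ⁺) − φ(ξ) into a second difference. For characteristic
functions this is controlled by values of |1 − φ| alone (`norm_mean_sub_le`), and after integration
in ξ every term carries sin^α(θ/2) (`lintegral_symBound_le`). The remainder is thus at most a
constant times ∫_{θ<ε} b sin^α(θ/2) dσ, which tends to 0 because α ≥ α₀.

The weight e^{δ|ξ|^p t} is unbounded, so neither ‖w‖ nor the weighted remainder is known to be
finite on the whole space. Everything is therefore done on a ball |ξ| ≤ R, which the gain respects
since |ξ^±| ≤ |ξ|; first ε → 0, then R → ∞. Uniqueness follows because elements of 𝓚 are continuous.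
-/

/-! ### The surface measure and its invariance under isometries. -/

/-- The unit sphere of `ℝ³`. -/
abbrev S2 : Type := Metric.sphere (0 : R3) 1

/-- The surface measure on the unit sphere of `ℝ³`. -/
noncomputable abbrev surf : Measure S2 := (volume : Measure R3).toSphere

theorem measurable_normalize : Measurable (fun x : R3 => ‖x‖⁻¹ • x) := by fun_prop

/-- The surface measure of a set is three times the volume of the cone over it in the unit ball, and
that cone is the preimage of the set under x ↦ x/|x| in the punctured ball. Spherical integrals
thereby become Lebesgue integrals. -/
theorem map_val_surf :
    surf.map (Subtype.val : S2 → R3) =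
      (3 : ℝ≥0∞) • ((volume : Measure R3).restrict (Metric.ball 0 1 \ {0})).map
        (fun x => ‖x‖⁻¹ • x) := by
  ext s hs
  rw [Measure.map_apply measurable_subtype_coe hs,
    Measure.toSphere_apply' _ (measurable_subtype_coe hs), Measure.smul_apply,
    Measure.map_apply measurable_normalize hs,
    Measure.restrict_apply (measurable_normalize hs)]
  simp only [finrank_euclideanSpace, Fintype.card_fin, smul_eq_mul]
  norm_num
  refine congrArg (fun u : Set R3 => (3 : ℝ≥0∞) * volume u) ?_
  ext x
  constructor
  · rintro ⟨r, hr, y, ⟨hy, hys⟩, rfl⟩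
    have hy1 : ‖y‖ = 1 := by simpa using hy
    have hr0 : 0 < r := hr.1
    have hn : ‖r • y‖ = r := by rw [norm_smul, hy1, Real.norm_of_nonneg hr0.le, mul_one]
    refine ⟨?_, ?_, ?_⟩
    · simp only [mem_preimage, hn, smul_smul, inv_mul_cancel₀ hr0.ne', one_smul]
      exact hys
    · simpa [hn] using hr.2
    · simp only [mem_singleton_iff]
      rw [← norm_eq_zero, hn]
      exact hr0.ne'
  · rintro ⟨hxs, hx1, hx0⟩
    have hx0' : ‖x‖ ≠ 0 := by simpa using hx0
    refine ⟨‖x‖, ⟨by positivity, by simpa using hx1⟩, ‖x‖⁻¹ • x, ⟨?_, hxs⟩, ?_⟩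
    · simp [norm_smul, hx0']
    · simp [smul_smul, hx0']

theorem lintegral_surf {G : R3 → ℝ≥0∞} (hG : Measurable G) :
    ∫⁻ σ, G (σ : R3) ∂surf = 3 * ∫⁻ x in Metric.ball (0 : R3) 1, G (‖x‖⁻¹ • x) := by
  rw [← lintegral_map hG measurable_subtype_coe, map_val_surf, lintegral_smul_measure,
    lintegral_map hG measurable_normalize, smul_eq_mul]
  congr 2
  exact Measure.restrict_congr_set (sdiff_null_ae_eq_self (measure_singleton _))

/-- The action of a linear isometry on the unit sphere. -/
noncomputable def sphereMap (L : R3 ≃ₗᵢ[ℝ] R3) (σ : S2) : S2 := ⟨L σ, by simp⟩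

theorem measurable_sphereMap (L : R3 ≃ₗᵢ[ℝ] R3) : Measurable (sphereMap L) :=
  (L.continuous.measurable.comp measurable_subtype_coe).subtype_mk

/-- Inherited from Lebesgue measure on the unit ball, since normalization commutes with linear
isometries. -/
theorem lintegral_surf_isometry (L : R3 ≃ₗᵢ[ℝ] R3) {G : R3 → ℝ≥0∞} (hG : Measurable G) :
    ∫⁻ σ, G (L (σ : R3)) ∂surf = ∫⁻ σ, G (σ : R3) ∂surf := by
  rw [lintegral_surf hG, lintegral_surf (G := fun x => G (L x))
    (hG.comp L.continuous.measurable)]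
  congr 1
  have h := (L.measurePreserving.restrict_preimage
    (measurableSet_ball (x := (0 : R3)) (ε := 1))).lintegral_comp
    (f := fun x => G (‖x‖⁻¹ • x)) (hG.comp measurable_normalize)
  rw [← h]
  have : L ⁻¹' Metric.ball 0 1 = Metric.ball 0 1 := by ext; simp
  rw [this]
  simp

theorem measurePreserving_sphereMap (L : R3 ≃ₗᵢ[ℝ] R3) :
    MeasurePreserving (sphereMap L) surf surf := by
  refine ⟨measurable_sphereMap L, ?_⟩
  ext t ht
  obtain ⟨t', ht', rfl⟩ := ht
  have h := lintegral_surf_isometry L (G := t'.indicator 1) (measurable_one.indicator ht')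
  rw [Measure.map_apply (measurable_sphereMap L) (measurable_subtype_coe ht')]
  rw [← lintegral_indicator_one (measurable_subtype_coe ht'), ← lintegral_indicator_one
    (measurable_sphereMap L (measurable_subtype_coe ht'))]
  exact h

/-! ### Cylindrical coordinates and integrals of zonal functions. -/

/-- Split off the first coordinate and use polar coordinates in the remaining plane; the angle
integrates to 2π. -/
theorem lintegral_cylindrical {H : ℝ → ℝ → ℝ≥0∞} (hH : Measurable (Function.uncurry H)) :
    ∫⁻ x : R3, H (x 0) (Real.sqrt (x 1 ^ 2 + x 2 ^ 2)) =
      ENNReal.ofReal (2 * Real.pi) *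
        ∫⁻ z : ℝ, ∫⁻ r in Ioi (0 : ℝ), ENNReal.ofReal r * H z r := by
  have e2 := volume_preserving_piFinSuccAbove (fun _ : Fin 3 => ℝ) 0
  have e3 := volume_preserving_finTwoArrow ℝ
  have hK : Measurable (fun p : ℝ × (Fin 2 → ℝ) => H p.1 (Real.sqrt (p.2 0 ^ 2 + p.2 1 ^ 2))) := by
    exact hH.comp (f := fun p : ℝ × (Fin 2 → ℝ) => (p.1, Real.sqrt (p.2 0 ^ 2 + p.2 1 ^ 2)))
      (by fun_prop)
  have h1 := (e2.comp (EuclideanSpace.volume_preserving_symm_measurableEquiv_toLp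
    (Fin 3))).lintegral_comp hK
  have h0 : ∫⁻ x : R3, H (x 0) (Real.sqrt (x 1 ^ 2 + x 2 ^ 2)) =
      ∫⁻ p : ℝ × (Fin 2 → ℝ), H p.1 (Real.sqrt (p.2 0 ^ 2 + p.2 1 ^ 2)) := by
    exact h1
  rw [h0, Measure.volume_eq_prod, lintegral_prod _ hK.aemeasurable,
    ← lintegral_const_mul' _ _ ENNReal.ofReal_ne_top]
  refine lintegral_congr fun z => ?_
  have hz : Measurable (H z) := hH.comp measurable_prodMk_left
  have h2 := e3.lintegral_comp (f := fun q : ℝ × ℝ => H z (Real.sqrt (q.1 ^ 2 + q.2 ^ 2)))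
    (hz.comp (by fun_prop))
  have h3 := lintegral_comp_polarCoord_symm (fun q : ℝ × ℝ => H z (Real.sqrt (q.1 ^ 2 + q.2 ^ 2)))
  rw [← h3] at h2
  refine (show _ = _ from h2).trans ?_
  rw [polarCoord_target, Measure.volume_eq_prod, ← Measure.prod_restrict]
  have h4 : ∀ q : ℝ × ℝ, 0 < q.1 → ENNReal.ofReal q.1 • H z (Real.sqrt ((polarCoord.symm q).1 ^ 2 +
      (polarCoord.symm q).2 ^ 2)) = ENNReal.ofReal q.1 * H z q.1 := by
    intro q hq
    simp only [polarCoord_symm_apply, smul_eq_mul]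
    congr 2
    rw [show (q.1 * Real.cos q.2) ^ 2 + (q.1 * Real.sin q.2) ^ 2 = q.1 ^ 2 by
      linear_combination q.1 ^ 2 * Real.sin_sq_add_cos_sq q.2]
    exact Real.sqrt_sq hq.le
  have h5 : ∀ᵐ q : ℝ × ℝ ∂((volume.restrict (Ioi (0 : ℝ))).prod
      (volume.restrict (Ioo (-Real.pi) Real.pi))), 0 < q.1 := by
    rw [Measure.prod_restrict]
    filter_upwards [ae_restrict_mem (measurableSet_Ioi.prod measurableSet_Ioo)] with q hq
    exact hq.1
  rw [lintegral_congr_ae (h5.mono h4), lintegral_prod _ (by fun_prop)]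
  simp only [lintegral_const, Measure.restrict_apply MeasurableSet.univ, univ_inter,
    Real.volume_Ioo]
  rw [lintegral_mul_const' _ _ ENNReal.ofReal_ne_top, mul_comm]
  congr 2
  ring

/-- In cylindrical coordinates around e the ball integral lives on the half-plane (z, r), r > 0.
Polar coordinates z = ρ cos θ, r = ρ sin θ there separate the variables, and the radial factor ∫₀¹
ρ² dρ = 1/3 cancels the 3 of the cone formula. -/
theorem lintegral_surf_inner {e : R3} (he : ‖e‖ = 1) {F : ℝ → ℝ≥0∞} (hF : Measurable F) :
    ∫⁻ σ : S2, F (inner ℝ e (σ : R3)) ∂surf =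
      ENNReal.ofReal (2 * Real.pi) *
        ∫⁻ θ in Ioo (0 : ℝ) Real.pi, F (Real.cos θ) * ENNReal.ofReal (Real.sin θ) := by
  rw [lintegral_surf (G := fun x => F (inner ℝ e x)) (hF.comp (by fun_prop))]
  obtain ⟨B, hB⟩ : ∃ B : OrthonormalBasis (Fin 3) ℝ R3, B 0 = e := by
    have ho : Orthonormal ℝ (({0} : Set (Fin 3)).domRestrict (fun _ : Fin 3 => e)) := by
      constructor
      · intro i; exact he
      · intro i j hij
        exact absurd (Subsingleton.elim i j) hij
    obtain ⟨B, hB⟩ := ho.exists_orthonormalBasis_extension_of_card_eq (by simp)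
    exact ⟨B, hB 0 rfl⟩
  set H : ℝ → ℝ → ℝ≥0∞ := fun z r =>
    (Iio (1 : ℝ)).indicator (fun _ => F (z / Real.sqrt (z ^ 2 + r ^ 2))) (Real.sqrt (z ^ 2 + r ^ 2))
    with hHdef
  have hH : Measurable (Function.uncurry H) := by
    have hs : Measurable (fun q : ℝ × ℝ => Real.sqrt (q.1 ^ 2 + q.2 ^ 2)) := by fun_prop
    have : Function.uncurry H = ((fun q : ℝ × ℝ => Real.sqrt (q.1 ^ 2 + q.2 ^ 2)) ⁻¹'
        (Iio (1 : ℝ))).indicator (fun q => F (q.1 / Real.sqrt (q.1 ^ 2 + q.2 ^ 2))) := by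
      ext q; rfl
    rw [this]
    exact (hF.comp (measurable_fst.div hs)).indicator (hs measurableSet_Iio)
  have h1 : ∫⁻ x in Metric.ball (0 : R3) 1, F (inner ℝ e (‖x‖⁻¹ • x)) =
      ∫⁻ x : R3, H (x 0) (Real.sqrt (x 1 ^ 2 + x 2 ^ 2)) := by
    rw [← lintegral_indicator measurableSet_ball]
    have hm : Measurable (fun x : R3 => H (x 0) (Real.sqrt (x 1 ^ 2 + x 2 ^ 2))) :=
      hH.comp (g := Function.uncurry H)
        (f := fun x : R3 => (x 0, Real.sqrt (x 1 ^ 2 + x 2 ^ 2))) (by fun_prop)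
    rw [← B.repr.measurePreserving.lintegral_comp hm]
    refine lintegral_congr fun x => ?_
    have hn : Real.sqrt (B.repr x 0 ^ 2 + Real.sqrt (B.repr x 1 ^ 2 + B.repr x 2 ^ 2) ^ 2) =
        ‖x‖ := by
      rw [Real.sq_sqrt (by positivity), ← B.repr.norm_map x, EuclideanSpace.norm_eq,
        Fin.sum_univ_three]
      simp [add_assoc]
    simp only [hHdef, hn]
    by_cases hx : ‖x‖ < 1
    · rw [indicator_of_mem (by simpa using hx), indicator_of_mem (by simpa using hx),
        B.repr_apply_apply, hB, inner_smul_right, div_eq_inv_mul]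
    · rw [indicator_of_notMem (by simpa using hx), indicator_of_notMem (by simpa using hx)]
  rw [h1, lintegral_cylindrical hH]
  -- Extension by zero to r ≤ 0, so that polar coordinates of the full plane apply; angles in (-π,
  -- 0] then contribute nothing.
  set K : ℝ × ℝ → ℝ≥0∞ := fun q => (Ioi (0 : ℝ)).indicator
    (fun r => ENNReal.ofReal r * H q.1 r) q.2 with hKdef
  have hK : Measurable K := by
    have : K = (Prod.snd ⁻¹' Ioi (0 : ℝ)).indicator
      (fun q => ENNReal.ofReal q.2 * Function.uncurry H q) := by ext q; rfl
    rw [this]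
    exact ((by fun_prop : Measurable fun q : ℝ × ℝ => ENNReal.ofReal q.2).mul hH).indicator
      (measurable_snd measurableSet_Ioi)
  have h2 : ∫⁻ z : ℝ, ∫⁻ r in Ioi (0 : ℝ), ENNReal.ofReal r * H z r = ∫⁻ q, K q := by
    rw [Measure.volume_eq_prod, lintegral_prod _ hK.aemeasurable]
    refine lintegral_congr fun z => ?_
    rw [← lintegral_indicator measurableSet_Ioi]
  rw [h2, ← lintegral_comp_polarCoord_symm, polarCoord_target]
  have h3 : ∀ q ∈ Ioi (0 : ℝ) ×ˢ Ioo (-Real.pi) Real.pi,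
      ENNReal.ofReal q.1 • K (polarCoord.symm q) =
      (Iio (1 : ℝ)).indicator (fun ρ => ENNReal.ofReal (ρ ^ 2)) q.1 *
       (Ioi (0 : ℝ)).indicator (fun θ => F (Real.cos θ) * ENNReal.ofReal (Real.sin θ)) q.2 := by
    rintro ⟨ρ, θ⟩ ⟨hρ, hθ⟩
    simp only [mem_Ioi, mem_Ioo] at hρ hθ
    have hq : Real.sqrt ((ρ * Real.cos θ) ^ 2 + (ρ * Real.sin θ) ^ 2) = ρ := by
      rw [show (ρ * Real.cos θ) ^ 2 + (ρ * Real.sin θ) ^ 2 = ρ ^ 2 by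
        linear_combination ρ ^ 2 * Real.sin_sq_add_cos_sq θ]
      exact Real.sqrt_sq hρ.le
    simp only [polarCoord_symm_apply, hKdef, hHdef, smul_eq_mul]
    by_cases h0 : 0 < θ
    · have hs : 0 < Real.sin θ := Real.sin_pos_of_pos_of_lt_pi h0 hθ.2
      rw [indicator_of_mem (show ρ * Real.sin θ ∈ Ioi (0 : ℝ) from mul_pos hρ hs),
        indicator_of_mem (show θ ∈ Ioi (0 : ℝ) from h0), hq]
      by_cases h1 : ρ < 1
      · rw [indicator_of_mem (show ρ ∈ Iio (1 : ℝ) from h1),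
          indicator_of_mem (show ρ ∈ Iio (1 : ℝ) from h1), mul_div_cancel_left₀ _ hρ.ne',
          ENNReal.ofReal_mul hρ.le, pow_two, ENNReal.ofReal_mul hρ.le]
        ring
      · rw [indicator_of_notMem (by simpa using h1), indicator_of_notMem (by simpa using h1)]
        simp
    · have hs : Real.sin θ ≤ 0 :=
        Real.sin_nonpos_of_nonpos_of_neg_pi_le (not_lt.1 h0) hθ.1.le
      rw [indicator_of_notMem (s := Ioi (0 : ℝ)) (a := ρ * Real.sin θ)
          (by simpa using mul_nonpos_of_nonneg_of_nonpos hρ.le hs),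
        indicator_of_notMem (s := Ioi (0 : ℝ)) (a := θ) (by simpa using h0)]
      simp
  rw [setLIntegral_congr_fun (measurableSet_Ioi.prod measurableSet_Ioo) h3,
    Measure.volume_eq_prod, ← Measure.prod_restrict, lintegral_prod_mul]
  · rw [lintegral_indicator measurableSet_Iio, lintegral_indicator measurableSet_Ioi,
      Measure.restrict_restrict measurableSet_Iio, Measure.restrict_restrict measurableSet_Ioi,
      inter_comm, Ioi_inter_Iio]
    have e1 : Ioi (0 : ℝ) ∩ Ioo (-Real.pi) Real.pi = Ioo 0 Real.pi := by
      ext θ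
      simp only [mem_inter_iff, mem_Ioi, mem_Ioo]
      have := Real.pi_pos
      constructor
      · rintro ⟨a, b, c⟩; exact ⟨a, c⟩
      · rintro ⟨a, b⟩; exact ⟨a, by linarith, b⟩
    have e2 : ∫⁻ ρ in Ioo (0 : ℝ) 1, ENNReal.ofReal (ρ ^ 2) = 3⁻¹ := by
      rw [Measure.restrict_congr_set Ioo_ae_eq_Ioc,
        ← ofReal_integral_eq_lintegral_ofReal (intervalIntegral.intervalIntegrable_pow _).1
          (ae_of_all _ fun _ => sq_nonneg _), ← intervalIntegral.integral_of_le zero_le_one]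
      rw [integral_pow]
      norm_num [ENNReal.ofReal_div_of_pos]
    rw [e1, e2, mul_left_comm, ← mul_assoc (3 : ℝ≥0∞), ENNReal.mul_inv_cancel (by simp) (by simp),
      one_mul]
  · exact (Measurable.indicator (by fun_prop) measurableSet_Iio).aemeasurable
  · exact (Measurable.indicator (by fun_prop) measurableSet_Ioi).aemeasurable

/-! ### The homogeneous weight and the geometry of ξ⁺ and ξ⁻. -/

/-- The weight `|ξ|^{-(3+α)}`. -/
noncomputable def wt (α : ℝ) (ξ : R3) : ℝ≥0∞ := (ENNReal.ofReal (‖ξ‖ ^ (3 + α)))⁻¹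

/-- The cosine of the deviation angle. -/
noncomputable def cosAng (ξ σ : R3) : ℝ := inner ℝ (‖ξ‖⁻¹ • ξ) σ

/-- The integral over the sphere of a zonal function. -/
noncomputable def angInt (B : ℝ → ℝ≥0∞) : ℝ≥0∞ :=
  ENNReal.ofReal (2 * Real.pi) *
    ∫⁻ θ in Ioo (0 : ℝ) Real.pi, B (Real.cos θ) * ENNReal.ofReal (Real.sin θ)

theorem measurable_wt (α : ℝ) : Measurable (wt α) := by unfold wt; fun_prop

theorem normM_eq (α : ℝ) (g : R3 → ℂ) : normM α g = ∫⁻ ξ, ‖g ξ‖ₑ * wt α ξ := rfl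

theorem wt_eq {α : ℝ} {ξ : R3} (hξ : ξ ≠ 0) :
    wt α ξ = ENNReal.ofReal (‖ξ‖ ^ (-(3 + α))) := by
  have : 0 < ‖ξ‖ := norm_pos_iff.2 hξ
  rw [wt, ← ENNReal.ofReal_inv_of_pos (by positivity), Real.rpow_neg this.le]

theorem measurable_cosAng : Measurable (Function.uncurry cosAng) := by
  unfold cosAng Function.uncurry; fun_prop

theorem measurable_cosAng_right (ξ : R3) : Measurable (cosAng ξ) := by
  unfold cosAng; fun_prop

theorem norm_normalize {ξ : R3} (hξ : ξ ≠ 0) : ‖‖ξ‖⁻¹ • ξ‖ = 1 := norm_smul_inv_norm hξ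

theorem norm_mul_cosAng (ξ σ : R3) : ‖ξ‖ * cosAng ξ σ = inner ℝ ξ σ := by
  rcases eq_or_ne ξ 0 with rfl | h
  · simp
  · have : ‖ξ‖ ≠ 0 := by simpa
    rw [cosAng, real_inner_smul_left]
    field_simp

theorem abs_cosAng_le {ξ σ : R3} (hσ : ‖σ‖ = 1) : |cosAng ξ σ| ≤ 1 := by
  rcases eq_or_ne ξ 0 with rfl | h
  · simp [cosAng]
  · have := abs_real_inner_le_norm (‖ξ‖⁻¹ • ξ) σ
    rwa [norm_normalize h, hσ, one_mul] at this

theorem cosAng_mem {ξ σ : R3} (hσ : ‖σ‖ = 1) : cosAng ξ σ ∈ Icc (-1 : ℝ) 1 :=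
  abs_le.1 (abs_cosAng_le hσ)

theorem lintegral_surf_cosAng {ξ : R3} (hξ : ξ ≠ 0) {B : ℝ → ℝ≥0∞} (hB : Measurable B) :
    ∫⁻ σ : S2, B (cosAng ξ σ) ∂surf = angInt B :=
  lintegral_surf_inner (norm_normalize hξ) hB

theorem xiMinus_eq (ξ σ : R3) : xiMinus ξ σ = xiPlus ξ (-σ) := by
  simp [xiMinus, xiPlus, sub_eq_add_neg]

theorem cosAng_neg (ξ σ : R3) : cosAng ξ (-σ) = -cosAng ξ σ := by simp [cosAng]

theorem inner_xiPlus {ξ σ : R3} (hσ : ‖σ‖ = 1) :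
    inner ℝ (xiPlus ξ σ) σ = (‖ξ‖ + inner ℝ ξ σ) / 2 := by
  simp only [xiPlus, real_inner_smul_left, inner_add_left, real_inner_self_eq_norm_sq, hσ]
  ring

theorem norm_xiPlus_sq {ξ σ : R3} (hσ : ‖σ‖ = 1) :
    ‖xiPlus ξ σ‖ ^ 2 = ‖ξ‖ * (‖ξ‖ + inner ℝ ξ σ) / 2 := by
  rw [xiPlus, norm_smul, mul_pow, norm_add_sq_real, norm_smul, real_inner_smul_right, hσ]
  simp
  ring

theorem norm_xiPlus_sq' {ξ σ : R3} (hσ : ‖σ‖ = 1) :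
    ‖xiPlus ξ σ‖ ^ 2 = ‖ξ‖ ^ 2 * ((1 + cosAng ξ σ) / 2) := by
  rw [norm_xiPlus_sq hσ, ← norm_mul_cosAng]; ring

theorem norm_xiMinus_sq' {ξ σ : R3} (hσ : ‖σ‖ = 1) :
    ‖xiMinus ξ σ‖ ^ 2 = ‖ξ‖ ^ 2 * ((1 - cosAng ξ σ) / 2) := by
  rw [xiMinus_eq, norm_xiPlus_sq' (by simpa), cosAng_neg]; ring

theorem norm_xiPlus_le {ξ σ : R3} (hσ : ‖σ‖ = 1) : ‖xiPlus ξ σ‖ ≤ ‖ξ‖ := by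
  refine (sq_le_sq₀ (norm_nonneg _) (norm_nonneg _)).1 ?_
  rw [norm_xiPlus_sq' hσ]
  have := (cosAng_mem (ξ := ξ) hσ).2
  exact mul_le_of_le_one_right (sq_nonneg _) (by linarith)

theorem norm_xiMinus_le {ξ σ : R3} (hσ : ‖σ‖ = 1) : ‖xiMinus ξ σ‖ ≤ ‖ξ‖ := by
  rw [xiMinus_eq]; exact norm_xiPlus_le (by simpa)

theorem continuous_xiPlus : Continuous (Function.uncurry xiPlus) := by
  unfold xiPlus Function.uncurry; fun_prop

theorem continuous_xiMinus : Continuous (Function.uncurry xiMinus) := by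
  unfold xiMinus Function.uncurry; fun_prop

/-! ### The changes of variables ξ ↦ ξ⁺, ξ ↦ ξ⁻ and ξ ↦ uξ. -/

/-- The derivative of `ξ ↦ ξ⁺`. -/
noncomputable def xiPlusDeriv (σ ξ : R3) : R3 →L[ℝ] R3 :=
  (2 : ℝ)⁻¹ • (ContinuousLinearMap.id ℝ R3 + (innerSL ℝ (‖ξ‖⁻¹ • ξ)).smulRight σ)

theorem hasFDerivAt_norm_ne_zero {ξ : R3} (hξ : ξ ≠ 0) :
    HasFDerivAt (fun x : R3 => ‖x‖) (innerSL ℝ (‖ξ‖⁻¹ • ξ)) ξ := by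
  have h := ((hasStrictFDerivAt_norm_sq ξ).hasFDerivAt).sqrt (by simpa using hξ)
  simp only [Real.sqrt_sq (norm_nonneg _)] at h
  convert! h using 1
  ext v
  have : ‖ξ‖ ≠ 0 := by simpa
  simp
  field_simp

theorem hasFDerivAt_xiPlus (σ : R3) {ξ : R3} (hξ : ξ ≠ 0) :
    HasFDerivAt (fun x => xiPlus x σ) (xiPlusDeriv σ ξ) ξ :=
  ((hasFDerivAt_id ξ).add ((hasFDerivAt_norm_ne_zero hξ).smul_const σ)).const_smul (2 : ℝ)⁻¹

/-- The derivative is half of the transvection I + σ ⊗ ξ/|ξ|, whose determinant is 1 + (ξ/|ξ|)·σ;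
the factor 1/2 contributes 1/8. -/
theorem det_xiPlusDeriv (σ ξ : R3) : (xiPlusDeriv σ ξ).det = (1 + cosAng ξ σ) / 8 := by
  have : ((xiPlusDeriv σ ξ : R3 →L[ℝ] R3) : R3 →ₗ[ℝ] R3) = (2 : ℝ)⁻¹ •
      LinearMap.transvection ((innerSL ℝ (‖ξ‖⁻¹ • ξ) : R3 →L[ℝ] ℝ) : R3 →ₗ[ℝ] ℝ) σ := by
    ext v
    simp [xiPlusDeriv, LinearMap.transvection]
  rw [ContinuousLinearMap.det, this, LinearMap.det_smul, LinearMap.transvection.det]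
  simp only [ContinuousLinearMap.coe_coe, innerSL_apply_apply, finrank_euclideanSpace_fin, cosAng]
  ring

/-- The set on which `ξ ↦ ξ⁺` is a diffeomorphism onto a half-space. -/
def offAxis (σ : R3) : Set R3 := {ξ | 0 < ‖ξ‖ + inner ℝ ξ σ}

theorem measurableSet_offAxis (σ : R3) : MeasurableSet (offAxis σ) :=
  measurableSet_lt (by fun_prop) (by fun_prop)

theorem norm_eq_of_offAxis {ξ σ : R3} (hσ : ‖σ‖ = 1) (h : ξ ∈ offAxis σ) :
    ‖ξ‖ = ‖xiPlus ξ σ‖ ^ 2 / inner ℝ (xiPlus ξ σ) σ := by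
  have h' : 0 < ‖ξ‖ + inner ℝ ξ σ := h
  rw [norm_xiPlus_sq hσ, inner_xiPlus hσ]
  field_simp

/-- |ξ| is recovered from ξ⁺ as |ξ⁺|²/(ξ⁺·σ), and then ξ = 2ξ⁺ − |ξ|σ. -/
theorem xiPlus_injOn {σ : R3} (hσ : ‖σ‖ = 1) : InjOn (fun ξ => xiPlus ξ σ) (offAxis σ) := by
  intro ξ hξ ξ' hξ' h
  simp only at h
  have hn : ‖ξ‖ = ‖ξ'‖ := by rw [norm_eq_of_offAxis hσ hξ, norm_eq_of_offAxis hσ hξ', h]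
  have h2 := smul_right_injective R3 (inv_ne_zero (two_ne_zero' ℝ)) h
  rw [hn] at h2
  exact add_right_cancel h2

theorem xiPlus_image {σ : R3} (hσ : ‖σ‖ = 1) :
    (fun ξ => xiPlus ξ σ) '' offAxis σ = {η | 0 < inner ℝ η σ} := by
  ext η
  constructor
  · rintro ⟨ξ, hξ, rfl⟩
    have h' : 0 < ‖ξ‖ + inner ℝ ξ σ := hξ
    simp only [mem_ofPred_eq, inner_xiPlus hσ]
    positivity
  · intro (hη : 0 < inner ℝ η σ)
    set k : ℝ := ‖η‖ ^ 2 / inner ℝ η σ with hk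
    have hk0 : 0 < k := by
      have : η ≠ 0 := by rintro rfl; simp at hη
      have := norm_pos_iff.2 this
      positivity
    have hkη : k * inner ℝ η σ = ‖η‖ ^ 2 := by rw [hk]; field_simp
    have hn : ‖(2 : ℝ) • η - k • σ‖ = k := by
      rw [← sq_eq_sq₀ (norm_nonneg _) hk0.le, norm_sub_sq_real, norm_smul, norm_smul,
        real_inner_smul_left, real_inner_smul_right, hσ, mul_pow, mul_pow]
      simp
      linarith
    refine ⟨(2 : ℝ) • η - k • σ, ?_, ?_⟩
    · simp only [offAxis, mem_ofPred_eq, hn, inner_sub_left, real_inner_smul_left,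
        real_inner_self_eq_norm_sq, hσ]
      linarith
    · simp only [xiPlus, hn, sub_add_cancel, smul_smul]
      norm_num

/-- Put η = ξ⁺, let x be the cosine of the angle between ξ and σ, and c that between η and σ. Then
c² = (1+x)/2 and |η| = c|ξ|, so the Jacobian is c²/4 and |ξ|^{-3-α} dξ = 4c^{1+α} |η|^{-3-α} dη. The
angle between η and σ is half of the deviation angle, whence the argument 2c² − 1 of B. -/
theorem lintegral_xiPlus_fixed {α : ℝ} {σ : R3} (hσ : ‖σ‖ = 1) (B : ℝ → ℝ≥0∞)
    {F : R3 → ℝ≥0∞} (hF : F 0 = 0) :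
    ∫⁻ ξ, B (cosAng ξ σ) * F (xiPlus ξ σ) * wt α ξ =
      ∫⁻ η in {η : R3 | 0 < inner ℝ η σ}, F η * wt α η *
        (ENNReal.ofReal (4 * cosAng η σ ^ (1 + α)) * B (2 * cosAng η σ ^ 2 - 1)) := by
  rw [← xiPlus_image hσ, lintegral_image_eq_lintegral_abs_det_fderiv_mul volume
    (measurableSet_offAxis σ) (f' := xiPlusDeriv σ) _ (xiPlus_injOn hσ),
    ← lintegral_indicator (measurableSet_offAxis σ)]
  · refine lintegral_congr fun ξ => ?_
    by_cases h : ξ ∈ offAxis σ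
    · have h' : 0 < ‖ξ‖ + inner ℝ ξ σ := h
      have hξ : ξ ≠ 0 := by rintro rfl; simp at h'
      have hn : 0 < ‖ξ‖ := norm_pos_iff.2 hξ
      have hx : 0 < 1 + cosAng ξ σ := by
        rw [← norm_mul_cosAng] at h'
        by_contra hc
        nlinarith
      rw [indicator_of_mem h, det_xiPlusDeriv]
      set η := xiPlus ξ σ with hη
      set x := cosAng ξ σ with hxdef
      have hηn : ‖η‖ ^ 2 = ‖ξ‖ ^ 2 * ((1 + x) / 2) := norm_xiPlus_sq' hσ
      have hη0 : 0 < ‖η‖ := by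
        have : 0 < ‖η‖ ^ 2 := by rw [hηn]; positivity
        exact (norm_nonneg η).lt_of_ne fun h => by simp [← h] at this
      have hin : inner ℝ η σ = ‖ξ‖ * ((1 + x) / 2) := by
        rw [hη, inner_xiPlus hσ, ← norm_mul_cosAng]; ring
      set c := cosAng η σ with hc
      have hcη : ‖η‖ * c = ‖ξ‖ * ((1 + x) / 2) := by rw [hc, norm_mul_cosAng, hin]
      have hc2 : c ^ 2 = (1 + x) / 2 := by
        have h1 : (‖η‖ * c) ^ 2 = (‖ξ‖ * ((1 + x) / 2)) ^ 2 := by rw [hcη]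
        rw [mul_pow, hηn] at h1
        have h2 : ‖ξ‖ ^ 2 * ((1 + x) / 2) * (c ^ 2 - (1 + x) / 2) = 0 := by linarith
        rcases mul_eq_zero.1 h2 with h3 | h3
        · have : 0 < ‖ξ‖ ^ 2 * ((1 + x) / 2) := by positivity
          linarith
        · linarith
      have hc0 : 0 < c := by
        have : 0 < ‖η‖ * c := by rw [hcη]; positivity
        exact pos_of_mul_pos_right this hη0.le
      have hηξ : ‖η‖ = ‖ξ‖ * c := by
        rw [← hc2] at hcη
        have : c * (‖η‖ - ‖ξ‖ * c) = 0 := by linarith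
        rcases mul_eq_zero.1 this with h3 | h3
        · exact absurd h3 hc0.ne'
        · linarith
      have hw : wt α ξ = ENNReal.ofReal |(1 + x) / 8| * wt α η *
          ENNReal.ofReal (4 * c ^ (1 + α)) := by
        rw [wt_eq hξ, wt_eq (norm_pos_iff.1 hη0), abs_of_pos (by positivity),
          ← ENNReal.ofReal_mul (by positivity), ← ENNReal.ofReal_mul (by positivity)]
        congr 1
        rw [show (1 + x) / 8 = c ^ (2 : ℝ) / 4 by rw [Real.rpow_two, hc2]; ring, hηξ,
          Real.mul_rpow hn.le hc0.le]
        rw [show c ^ (2 : ℝ) / 4 * (‖ξ‖ ^ (-(3 + α)) * c ^ (-(3 + α))) * (4 * c ^ (1 + α)) =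
          ‖ξ‖ ^ (-(3 + α)) * (c ^ (2 : ℝ) * c ^ (-(3 + α)) * c ^ (1 + α)) by ring,
          ← Real.rpow_add hc0, ← Real.rpow_add hc0]
        rw [show (2 : ℝ) + -(3 + α) + (1 + α) = 0 by ring, Real.rpow_zero, mul_one]
      rw [hw, show 2 * c ^ 2 - 1 = x by rw [hc2]; ring]
      ring
    -- On the excluded ray ξ⁺ = 0, where F vanishes.
    · rw [indicator_of_notMem h]
      have h0 : xiPlus ξ σ = 0 := by
        have h' : ‖ξ‖ + inner ℝ ξ σ ≤ 0 := not_lt.1 h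
        have h2 := norm_xiPlus_sq (ξ := ξ) hσ
        have h3 := mul_nonpos_of_nonneg_of_nonpos (norm_nonneg ξ) h'
        have h4 : ‖xiPlus ξ σ‖ ^ 2 = 0 := le_antisymm (by linarith) (sq_nonneg _)
        simpa using h4
      rw [h0, hF]
      simp
  · intro ξ h
    have hξ : ξ ≠ 0 := by
      rintro rfl
      simp [offAxis] at h
    exact (hasFDerivAt_xiPlus σ hξ).hasFDerivWithinAt

/-- Substitution θ = 2ψ with c = cos ψ: 4c^{1+α} sin ψ dψ = cos^α(θ/2) sin θ dθ. -/
theorem angInt_half_angle {α : ℝ} (B : ℝ → ℝ≥0∞) :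
    angInt (fun c => (Ioi (0 : ℝ)).indicator
      (fun c => ENNReal.ofReal (4 * c ^ (1 + α)) * B (2 * c ^ 2 - 1)) c) =
    angInt (fun x => B x * ENNReal.ofReal (((1 + x) / 2) ^ (α / 2))) := by
  unfold angInt
  congr 1
  have himg : (fun ψ : ℝ => 2 * ψ) '' Ioo 0 (Real.pi / 2) = Ioo 0 Real.pi := by
    rw [image_mul_left_Ioo (by norm_num)]
    congr 1 <;> ring
  have h := lintegral_image_eq_lintegral_abs_deriv_mul (measurableSet_Ioo (a := (0 : ℝ))
    (b := Real.pi / 2)) (f := fun ψ => 2 * ψ) (f' := fun _ => 2)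
    (fun x _ => by simpa using ((hasDerivAt_id x).const_mul 2).hasDerivWithinAt)
    (fun x _ y _ hxy => by simpa using hxy)
    (fun θ => B (Real.cos θ) * ENNReal.ofReal (((1 + Real.cos θ) / 2) ^ (α / 2)) *
      ENNReal.ofReal (Real.sin θ))
  rw [himg] at h
  rw [h]
  have hpi := Real.pi_pos
  rw [← lintegral_indicator measurableSet_Ioo, ← lintegral_indicator measurableSet_Ioo]
  refine lintegral_congr fun ψ => ?_
  beta_reduce
  by_cases h1 : ψ ∈ Ioo 0 (Real.pi / 2)
  · have hc : 0 < Real.cos ψ := Real.cos_pos_of_mem_Ioo ⟨by linarith [h1.1], h1.2⟩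
    have hs : 0 < Real.sin ψ := Real.sin_pos_of_pos_of_lt_pi h1.1 (by linarith [h1.2])
    rw [indicator_of_mem h1, indicator_of_mem (show ψ ∈ Ioo 0 Real.pi from
      ⟨h1.1, by linarith [h1.2]⟩), indicator_of_mem (show Real.cos ψ ∈ Ioi (0 : ℝ) from hc),
      Real.cos_two_mul, Real.sin_two_mul]
    rw [show (1 + (2 * Real.cos ψ ^ 2 - 1)) / 2 = Real.cos ψ ^ (2 : ℝ) by
      rw [Real.rpow_two]; ring, ← Real.rpow_mul hc.le, mul_div_cancel₀ _ two_ne_zero]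
    have e : ENNReal.ofReal (4 * Real.cos ψ ^ (1 + α)) * ENNReal.ofReal (Real.sin ψ) =
        ENNReal.ofReal |2| * (ENNReal.ofReal (Real.cos ψ ^ α) *
          ENNReal.ofReal (2 * Real.sin ψ * Real.cos ψ)) := by
      rw [← ENNReal.ofReal_mul (by positivity), ← ENNReal.ofReal_mul (by positivity),
        ← ENNReal.ofReal_mul (by positivity)]
      congr 1
      rw [Real.rpow_add hc, Real.rpow_one, abs_two]
      ring
    calc _ = (ENNReal.ofReal (4 * Real.cos ψ ^ (1 + α)) * ENNReal.ofReal (Real.sin ψ)) *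
        B (2 * Real.cos ψ ^ 2 - 1) := by ring
      _ = _ := by rw [e]; ring
  · rw [indicator_of_notMem h1]
    by_cases h2 : ψ ∈ Ioo 0 Real.pi
    · rw [indicator_of_mem h2, indicator_of_notMem, zero_mul]
      have h3 : Real.pi / 2 ≤ ψ := by
        by_contra hlt
        exact h1 ⟨h2.1, not_le.1 hlt⟩
      simpa using Real.cos_nonpos_of_pi_div_two_le_of_le h3 (by linarith [h2.2])
    · rw [indicator_of_notMem h2]

/-- Tonelli twice: with σ fixed, change variables from ξ to η = ξ⁺; with η fixed, the remaining
σ-integrand is zonal about η and gives a constant independent of η. -/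
theorem lintegral_xiPlus {α : ℝ} {B : ℝ → ℝ≥0∞} (hB : Measurable B) {F : R3 → ℝ≥0∞}
    (hFm : Measurable F) (hF : F 0 = 0) :
    ∫⁻ ξ, (∫⁻ σ : S2, B (cosAng ξ σ) * F (xiPlus ξ σ) ∂surf) * wt α ξ =
      angInt (fun x => B x * ENNReal.ofReal (((1 + x) / 2) ^ (α / 2))) *
        ∫⁻ η, F η * wt α η := by
  have hcm : Measurable fun q : R3 × S2 => cosAng q.1 q.2 :=
    measurable_cosAng.comp (f := fun q : R3 × S2 => (q.1, (q.2 : R3))) (by fun_prop)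
  have hxm : Measurable fun q : R3 × S2 => xiPlus q.1 q.2 :=
    continuous_xiPlus.measurable.comp (f := fun q : R3 × S2 => (q.1, (q.2 : R3))) (by fun_prop)
  have hwm := measurable_wt α
  obtain ⟨K, hK⟩ : ∃ K : ℝ → ℝ≥0∞, K = fun c => (Ioi (0 : ℝ)).indicator
      (fun c => ENNReal.ofReal (4 * c ^ (1 + α)) * B (2 * c ^ 2 - 1)) c := ⟨_, rfl⟩
  have hKm : Measurable K := by
    rw [hK]
    exact Measurable.indicator (by fun_prop) measurableSet_Ioi
  have h1 : ∀ ξ, (∫⁻ σ : S2, B (cosAng ξ σ) * F (xiPlus ξ σ) ∂surf) * wt α ξ =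
      ∫⁻ σ : S2, B (cosAng ξ σ) * F (xiPlus ξ σ) * wt α ξ ∂surf := fun ξ => by
    rw [lintegral_mul_const]
    have a := hcm.comp (measurable_prodMk_left (x := ξ))
    have b := hxm.comp (measurable_prodMk_left (x := ξ))
    exact (hB.comp a).mul (hFm.comp b)
  simp_rw [h1]
  rw [lintegral_lintegral_swap]
  swap
  · exact (((hB.comp hcm).mul (hFm.comp hxm)).mul (hwm.comp measurable_fst)).aemeasurable
  have h2 : ∀ σ : S2, ∫⁻ ξ, B (cosAng ξ σ) * F (xiPlus ξ σ) * wt α ξ =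
      ∫⁻ η, F η * wt α η * K (cosAng η σ) := fun σ => by
    have hs : MeasurableSet {η : R3 | 0 < inner ℝ η (σ : R3)} :=
      measurableSet_lt measurable_const (by fun_prop)
    rw [lintegral_xiPlus_fixed (by simp) B hF, ← lintegral_indicator hs]
    congr 1
    funext η
    have hiff : 0 < inner ℝ η (σ : R3) ↔ η ≠ 0 ∧ 0 < cosAng η σ := by
      rw [← norm_mul_cosAng]
      rcases eq_or_ne η 0 with rfl | h
      · simp
      · simp [h, norm_pos_iff.2 h]
    by_cases h : 0 < inner ℝ η (σ : R3)
    · rw [indicator_of_mem (by exact h), hK]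
      simp only
      rw [indicator_of_mem (by exact (hiff.1 h).2)]
    · rw [indicator_of_notMem (by exact h)]
      rcases eq_or_ne η 0 with rfl | h0
      · simp [hF]
      · rw [hK]
        simp only
        rw [indicator_of_notMem (by exact fun hc => h (hiff.2 ⟨h0, hc⟩)), mul_zero]
  simp_rw [h2]
  rw [lintegral_lintegral_swap]
  swap
  · have hm : Measurable fun q : S2 × R3 => F q.2 * wt α q.2 * K (cosAng q.2 q.1) := by
      have hc : Measurable fun q : S2 × R3 => cosAng q.2 q.1 :=
        measurable_cosAng.comp (f := fun q : S2 × R3 => (q.2, (q.1 : R3))) (by fun_prop)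
      fun_prop
    exact hm.aemeasurable
  have hr := angInt_half_angle (α := α) B
  rw [← hK] at hr
  rw [← hr, ← lintegral_const_mul (f := fun η => F η * wt α η) _ (hFm.mul hwm)]
  congr 1
  funext η
  rcases eq_or_ne η 0 with rfl | h0
  · simp [hF]
  have hKη : Measurable fun σ : S2 => K (cosAng η σ) :=
    hKm.comp ((measurable_cosAng_right η).comp measurable_subtype_coe)
  rw [lintegral_const_mul _ hKη, lintegral_surf_cosAng h0 hKm]
  exact mul_comm _ _

theorem angInt_neg (B : ℝ → ℝ≥0∞) : angInt (fun x => B (-x)) = angInt B := by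
  unfold angInt
  congr 1
  have h := lintegral_image_eq_lintegral_abs_deriv_mul (measurableSet_Ioo (a := (0 : ℝ))
    (b := Real.pi)) (f := fun ψ => Real.pi - ψ) (f' := fun _ => -1)
    (fun x _ => by simpa using ((hasDerivAt_id x).const_sub Real.pi).hasDerivWithinAt)
    (fun x _ y _ hxy => by simpa using hxy)
    (fun θ => B (Real.cos θ) * ENNReal.ofReal (Real.sin θ))
  simp only [image_const_sub_Ioo, sub_self, sub_zero, Real.cos_pi_sub, Real.sin_pi_sub] at h
  rw [h]
  simp

/-- The substitution σ ↦ −σ exchanges ξ⁺ and ξ⁻ and reverses the sign of cos θ. -/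
theorem lintegral_xiMinus {α : ℝ} {B : ℝ → ℝ≥0∞} (hB : Measurable B) {F : R3 → ℝ≥0∞}
    (hFm : Measurable F) (hF : F 0 = 0) :
    ∫⁻ ξ, (∫⁻ σ : S2, B (cosAng ξ σ) * F (xiMinus ξ σ) ∂surf) * wt α ξ =
      angInt (fun x => B x * ENNReal.ofReal (((1 - x) / 2) ^ (α / 2))) *
        ∫⁻ η, F η * wt α η := by
  have h := lintegral_xiPlus (α := α) (B := fun x => B (-x)) (hB.comp measurable_neg) hFm hF
  rw [← angInt_neg] at h
  simp only [neg_neg, ← sub_eq_add_neg] at h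
  rw [← h]
  refine lintegral_congr fun ξ => ?_
  congr 1
  have hm : Measurable fun σ : R3 => B (cosAng ξ σ) * F (xiMinus ξ σ) :=
    (hB.comp (measurable_cosAng.comp (measurable_prodMk_left (x := ξ)))).mul
      (hFm.comp (continuous_xiMinus.measurable.comp (measurable_prodMk_left (x := ξ))))
  have := lintegral_surf_isometry (LinearIsometryEquiv.neg ℝ) hm
  rw [← this]
  refine lintegral_congr fun σ => ?_
  simp [cosAng_neg, xiMinus_eq]

theorem lintegral_smul_wt {α u : ℝ} (hu : 0 ≤ u) (hα : 0 < α) {F : R3 → ℝ≥0∞}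
    (hF : F 0 = 0) :
    ∫⁻ ξ, F (u • ξ) * wt α ξ = ENNReal.ofReal (u ^ α) * ∫⁻ η, F η * wt α η := by
  rcases hu.eq_or_lt with rfl | hu
  · simp [hF, Real.zero_rpow hα.ne']
  have h := Measure.map_addHaar_smul (volume : Measure R3) hu.ne'
  have hme : MeasurableEmbedding (fun x : R3 => u • x) :=
    (Homeomorph.smulOfNeZero u hu.ne').measurableEmbedding
  have h2 := hme.lintegral_map (μ := volume) (fun η => F η * wt α η)
  rw [h, lintegral_smul_measure] at h2
  have h3 : ∀ ξ, F (u • ξ) * wt α ξ =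
      ENNReal.ofReal (u ^ (3 + α)) * (F (u • ξ) * wt α (u • ξ)) := fun ξ => by
    rcases eq_or_ne ξ 0 with rfl | h0
    · simp [hF]
    rw [wt_eq h0, wt_eq (smul_ne_zero hu.ne' h0), mul_left_comm, ← ENNReal.ofReal_mul
      (by positivity), norm_smul, Real.norm_of_nonneg hu.le, Real.mul_rpow hu.le (norm_nonneg _),
      ← mul_assoc, ← Real.rpow_add hu]
    simp
  simp_rw [h3]
  rw [lintegral_const_mul' _ _ ENNReal.ofReal_ne_top, ← h2, smul_eq_mul, ← mul_assoc,
    ← ENNReal.ofReal_mul (by positivity)]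
  congr 2
  rw [finrank_euclideanSpace_fin, abs_of_pos (by positivity), Real.rpow_add hu]
  rw [show u ^ (3 : ℝ) = u ^ 3 by exact_mod_cast Real.rpow_natCast u 3]
  field_simp

/-! ### Characteristic functions and their second differences. -/

theorem integrable_exp_inner (f : Measure R3) [IsProbabilityMeasure f] (ξ : R3) :
    Integrable (fun v : R3 => Complex.exp (-(Complex.I * ((inner ℝ v ξ : ℝ) : ℂ)))) f := by
  refine Integrable.of_bound (C := 1) (by fun_prop) (ae_of_all _ fun v => ?_)
  rw [show -(Complex.I * ((inner ℝ v ξ : ℝ) : ℂ)) = ((-inner ℝ v ξ : ℝ) : ℂ) * Complex.I by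
    push_cast; ring, Complex.norm_exp_ofReal_mul_I]

theorem continuous_of_mem_spaceK {φ : R3 → ℂ} (h : φ ∈ spaceK) : Continuous φ := by
  obtain ⟨f, hf, hφ⟩ := h
  rw [show φ = _ from funext hφ]
  refine continuous_of_dominated (bound := fun _ => 1)
    (fun ξ => (integrable_exp_inner f ξ).1) (fun ξ => ae_of_all _ fun v => ?_)
    (integrable_const _) (ae_of_all _ fun v => by fun_prop)
  rw [show -(Complex.I * ((inner ℝ v ξ : ℝ) : ℂ)) = ((-inner ℝ v ξ : ℝ) : ℂ) * Complex.I by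
    push_cast; ring, Complex.norm_exp_ofReal_mul_I]

theorem apply_zero_of_mem_spaceK {φ : R3 → ℂ} (h : φ ∈ spaceK) : φ 0 = 1 := by
  obtain ⟨f, hf, hφ⟩ := h
  simp [hφ]

theorem norm_le_one_of_mem_spaceK {φ : R3 → ℂ} (h : φ ∈ spaceK) (ξ : R3) : ‖φ ξ‖ ≤ 1 := by
  obtain ⟨f, hf, hφ⟩ := h
  rw [hφ]
  refine (norm_integral_le_of_norm_le_const (C := 1) (ae_of_all _ fun v => ?_)).trans (by simp)
  rw [show -(Complex.I * ((inner ℝ v ξ : ℝ) : ℂ)) = ((-inner ℝ v ξ : ℝ) : ℂ) * Complex.I by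
    push_cast; ring, Complex.norm_exp_ofReal_mul_I]

theorem norm_exp_mul_I_sub_one_sq (x : ℝ) :
    ‖Complex.exp (x * Complex.I) - 1‖ ^ 2 = 2 * (1 - Real.cos x) := by
  rw [← Complex.normSq_eq_norm_sq, Complex.normSq_apply]
  simp only [Complex.sub_re, Complex.sub_im, Complex.exp_ofReal_mul_I_re,
    Complex.exp_ofReal_mul_I_im, Complex.one_re, Complex.one_im]
  linear_combination Real.sin_sq_add_cos_sq x

/-- This is |e^{ix} − e^{iy}|² ≤ 2|e^{ix} − 1|² + 2|e^{iy} − 1|², by the parallelogram law. -/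
theorem one_sub_cos_sub_le (x y : ℝ) :
    1 - Real.cos (x - y) ≤ 2 * (1 - Real.cos x) + 2 * (1 - Real.cos y) := by
  rw [Real.cos_sub]
  nlinarith [sq_nonneg (Real.sin x + Real.sin y), sq_nonneg (Real.cos x + Real.cos y - 2),
    Real.sin_sq_add_cos_sq x, Real.sin_sq_add_cos_sq y]

/-- The mean of the two exponentials is e^{-i(x-ux)} cos(ux − y). The left side is therefore the
norm of (e^{-ix} − 1)(e^{iux} − 1) + e^{-i(x-ux)}(cos(ux − y) − 1). The product is split by Young's
inequality with free parameter l, using |e^{is} − 1|² = 2(1 − cos s). -/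
theorem norm_mean_exp_sub_le (x y u l : ℝ) (hl : 0 < l) :
    ‖(1 / 2 : ℂ) * (Complex.exp ((-(x - y) : ℝ) * Complex.I) +
        Complex.exp ((-(x - (2 * u * x - y)) : ℝ) * Complex.I)) -
        Complex.exp ((-x : ℝ) * Complex.I) - (Complex.exp ((u * x : ℝ) * Complex.I) - 1)‖ ≤
      l * (1 - Real.cos x) + l⁻¹ * (1 - Real.cos (u * x)) +
        (2 * (1 - Real.cos (u * x)) + 2 * (1 - Real.cos y)) := by
  have key : (1 / 2 : ℂ) * (Complex.exp ((-(x - y) : ℝ) * Complex.I) +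
        Complex.exp ((-(x - (2 * u * x - y)) : ℝ) * Complex.I)) -
        Complex.exp ((-x : ℝ) * Complex.I) - (Complex.exp ((u * x : ℝ) * Complex.I) - 1) =
      (Complex.exp ((-x : ℝ) * Complex.I) - 1) * (Complex.exp ((u * x : ℝ) * Complex.I) - 1) +
      Complex.exp ((-(x - u * x) : ℝ) * Complex.I) * ((Real.cos (u * x - y) - 1 : ℝ) : ℂ) := by
    have e1 : Complex.exp ((-(x - y) : ℝ) * Complex.I) =
        Complex.exp ((-(x - u * x) : ℝ) * Complex.I) *
          Complex.exp (-((u * x - y : ℝ) : ℂ) * Complex.I) := by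
      rw [← Complex.exp_add]; congr 1; push_cast; ring
    have e2 : Complex.exp ((-(x - (2 * u * x - y)) : ℝ) * Complex.I) =
        Complex.exp ((-(x - u * x) : ℝ) * Complex.I) *
          Complex.exp (((u * x - y : ℝ) : ℂ) * Complex.I) := by
      rw [← Complex.exp_add]; congr 1; push_cast; ring
    have e3 : Complex.exp ((-(x - u * x) : ℝ) * Complex.I) =
        Complex.exp ((-x : ℝ) * Complex.I) * Complex.exp ((u * x : ℝ) * Complex.I) := by
      rw [← Complex.exp_add]; congr 1; push_cast; ring
    have e4 : ((Real.cos (u * x - y) - 1 : ℝ) : ℂ) =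
        (Complex.exp (((u * x - y : ℝ) : ℂ) * Complex.I) +
          Complex.exp (-((u * x - y : ℝ) : ℂ) * Complex.I)) / 2 - 1 := by
      rw [Complex.ofReal_sub, Complex.ofReal_cos, Complex.cos, Complex.ofReal_one]
    rw [e1, e2, e4, e3]
    ring
  rw [key]
  refine (norm_add_le _ _).trans ?_
  rw [norm_mul, norm_mul, Complex.norm_exp_ofReal_mul_I, one_mul, Complex.norm_real]
  have h1 : ‖Real.cos (u * x - y) - 1‖ = 1 - Real.cos (u * x - y) := by
    rw [Real.norm_of_nonpos (by linarith [Real.cos_le_one (u * x - y)])]; ring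
  rw [h1]
  have h2 := norm_exp_mul_I_sub_one_sq (-x)
  have h3 := norm_exp_mul_I_sub_one_sq (u * x)
  rw [Real.cos_neg] at h2
  have h4 := one_sub_cos_sub_le (u * x) y
  set p := ‖Complex.exp ((-x : ℝ) * Complex.I) - 1‖
  set q := ‖Complex.exp ((u * x : ℝ) * Complex.I) - 1‖
  have h5 : p * q ≤ l * (1 - Real.cos x) + l⁻¹ * (1 - Real.cos (u * x)) := by
    have h6 : l * (1 - Real.cos x) + l⁻¹ * (1 - Real.cos (u * x)) - p * q =
        l⁻¹ * (l * p - q) ^ 2 / 2 := by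
      rw [show 1 - Real.cos x = p ^ 2 / 2 by linarith, show 1 - Real.cos (u * x) = q ^ 2 / 2 by
        linarith]
      field_simp
      ring
    have : 0 ≤ l⁻¹ * (l * p - q) ^ 2 / 2 := by positivity
    linarith
  linarith

theorem integral_one_sub_cos {f : Measure R3} [IsProbabilityMeasure f] {φ : R3 → ℂ}
    (hφ : ∀ ξ, φ ξ = ∫ v, Complex.exp (-(Complex.I * ((inner ℝ v ξ : ℝ) : ℂ))) ∂f) (ξ : R3) :
    ∫ v, (1 - Real.cos (inner ℝ v ξ)) ∂f = 1 - (φ ξ).re := by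
  have hi := integrable_exp_inner f ξ
  have h := Complex.reCLM.integral_comp_comm hi
  rw [hφ, ← Complex.reCLM_apply, ← h, integral_sub (integrable_const _)]
  · simp only [integral_const, probReal_univ, one_smul]
    congr 2
    ext v
    rw [Complex.reCLM_apply, show -(Complex.I * ((inner ℝ v ξ : ℝ) : ℂ)) =
      ((-inner ℝ v ξ : ℝ) : ℂ) * Complex.I by push_cast; ring, Complex.exp_ofReal_mul_I_re,
      Real.cos_neg]
  · exact Integrable.of_bound (C := 1) (by fun_prop) (ae_of_all _ fun v => Real.abs_cos_le_one _)

theorem one_sub_re_le (z : ℂ) : 1 - z.re ≤ ‖1 - z‖ := by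
  simpa using Complex.re_le_norm (1 - z)

/-- A second-difference estimate for characteristic functions. -/
theorem norm_mean_sub_le {φ : R3 → ℂ} (h : φ ∈ spaceK) (ξ y : R3) (u : ℝ) {l : ℝ} (hl : 0 < l) :
    ‖(1 / 2 : ℂ) * (φ (ξ - y) + φ (ξ - ((2 * u) • ξ - y))) - φ ξ‖ ≤
      l * ‖1 - φ ξ‖ + (l⁻¹ + 3) * ‖1 - φ (u • ξ)‖ + 2 * ‖1 - φ y‖ := by
  obtain ⟨f, hf, hφ⟩ := h
  have hexp : ∀ (v : R3) (r : ℝ), -(Complex.I * (r : ℂ)) = ((-r : ℝ) : ℂ) * Complex.I := by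
    intro v r; push_cast; ring
  -- With the first-order term e^{iu v·ξ} − 1 removed, the integrand is bounded by quantities 1 −
  -- cos, whose integrals are 1 − Re φ. Adding the term back costs one more |1 − φ(uξ)|, so 2
  -- becomes 3 in the conclusion.
  set A : R3 → ℂ := fun v => (1 / 2 : ℂ) *
    (Complex.exp (-(Complex.I * ((inner ℝ v (ξ - y) : ℝ) : ℂ))) +
      Complex.exp (-(Complex.I * ((inner ℝ v (ξ - ((2 * u) • ξ - y)) : ℝ) : ℂ)))) -
    Complex.exp (-(Complex.I * ((inner ℝ v ξ : ℝ) : ℂ))) -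
    (Complex.exp (-(Complex.I * ((inner ℝ v (-(u • ξ)) : ℝ) : ℂ))) - 1) with hA
  have hAi : ∫ v, A v ∂f = (1 / 2 : ℂ) * (φ (ξ - y) + φ (ξ - ((2 * u) • ξ - y))) - φ ξ -
      (φ (-(u • ξ)) - 1) := by
    simp only [hφ]
    have i1 := integrable_exp_inner f (ξ - y)
    have i2 := integrable_exp_inner f (ξ - ((2 * u) • ξ - y))
    have i3 := integrable_exp_inner f ξ
    have i4 := integrable_exp_inner f (-(u • ξ))
    rw [← integral_add i1 i2, ← integral_const_mul]
    have i5 : Integrable (fun v => (1 / 2 : ℂ) *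
      (Complex.exp (-(Complex.I * ((inner ℝ v (ξ - y) : ℝ) : ℂ))) +
      Complex.exp (-(Complex.I * ((inner ℝ v (ξ - ((2 * u) • ξ - y)) : ℝ) : ℂ))))) f :=
      (i1.add i2).const_mul _
    rw [← integral_sub i5 i3]
    have i6 : ∫ v, (Complex.exp (-(Complex.I * ((inner ℝ v (-(u • ξ)) : ℝ) : ℂ))) - 1) ∂f =
        ∫ v, Complex.exp (-(Complex.I * ((inner ℝ v (-(u • ξ)) : ℝ) : ℂ))) ∂f - 1 := by
      rw [integral_sub i4 (integrable_const _)]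
      simp
    rw [← i6]
    exact integral_sub (i5.sub i3) (i4.sub (integrable_const _))
  have hc : ∀ η : R3, Integrable (fun v : R3 => 1 - Real.cos (inner ℝ v η)) f := fun η =>
    Integrable.of_bound (C := 2) (by fun_prop) (ae_of_all _ fun v => by
      rw [Real.norm_of_nonneg (by linarith [Real.cos_le_one (inner ℝ v η)])]
      linarith [Real.neg_one_le_cos (inner ℝ v η)])
  have hAn : ‖∫ v, A v ∂f‖ ≤ ∫ v, (l * (1 - Real.cos (inner ℝ v ξ)) +
      l⁻¹ * (1 - Real.cos (inner ℝ v (u • ξ))) +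
      (2 * (1 - Real.cos (inner ℝ v (u • ξ))) + 2 * (1 - Real.cos (inner ℝ v y)))) ∂f := by
    refine norm_integral_le_of_norm_le ((((hc ξ).const_mul _).add ((hc _).const_mul _)).add
      (((hc _).const_mul _).add ((hc _).const_mul _))) (ae_of_all _ fun v => ?_)
    have := norm_mean_exp_sub_le (inner ℝ v ξ) (inner ℝ v y) u l hl
    simp only [hA, hexp v, inner_sub_right, inner_neg_right, inner_smul_right, neg_neg] at this ⊢
    exact this
  have j1 : Integrable (fun v : R3 => l * (1 - Real.cos (inner ℝ v ξ)) +
      l⁻¹ * (1 - Real.cos (inner ℝ v (u • ξ)))) f := ((hc ξ).const_mul _).add ((hc _).const_mul _)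
  have j2 : Integrable (fun v : R3 => 2 * (1 - Real.cos (inner ℝ v (u • ξ))) +
      2 * (1 - Real.cos (inner ℝ v y))) f := ((hc _).const_mul _).add ((hc _).const_mul _)
  rw [integral_add j1 j2, integral_add ((hc ξ).const_mul _) ((hc _).const_mul _),
    integral_add ((hc _).const_mul _) ((hc _).const_mul _)] at hAn
  simp only [integral_const_mul, integral_one_sub_cos hφ] at hAn
  have hneg : ‖φ (-(u • ξ)) - 1‖ = ‖1 - φ (u • ξ)‖ := by
    rw [← norm_neg, neg_sub, ← Complex.norm_conj, map_sub, map_one, hφ, hφ (u • ξ),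
      ← integral_conj]
    congr 3
    ext v
    rw [hexp v, hexp v, ← Complex.exp_conj]
    simp
  have h1 := one_sub_re_le (φ ξ)
  have h2 := one_sub_re_le (φ (u • ξ))
  have h3 := one_sub_re_le (φ y)
  have hl' := inv_pos.2 hl
  have h4 := mul_le_mul_of_nonneg_left h1 hl.le
  have h5 := mul_le_mul_of_nonneg_left h2 hl'.le
  have h6 : (1 / 2 : ℂ) * (φ (ξ - y) + φ (ξ - ((2 * u) • ξ - y))) - φ ξ =
      ∫ v, A v ∂f + (φ (-(u • ξ)) - 1) := by rw [hAi]; ring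
  rw [h6]
  refine (norm_add_le _ _).trans ?_
  rw [hneg]
  linarith

/-! ### The symmetrized collision integrand and its integrated bound. -/

/-- The square of the sine of half the deviation angle. -/
noncomputable def halfSinSq (ξ σ : R3) : ℝ := (1 - cosAng ξ σ) / 2

theorem measurable_halfSinSq : Measurable (Function.uncurry halfSinSq) :=
  (measurable_const.sub measurable_cosAng).div_const 2

theorem halfSinSq_mem {ξ σ : R3} (hσ : ‖σ‖ = 1) : halfSinSq ξ σ ∈ Icc (0 : ℝ) 1 := by
  have := cosAng_mem (ξ := ξ) hσ
  exact ⟨by unfold halfSinSq; linarith [this.2], by unfold halfSinSq; linarith [this.1]⟩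

/-- The vector `ξ⁺` for the mirror image of `σ` in the axis spanned by `ξ`. -/
noncomputable def xiMirror (ξ σ : R3) : R3 := ξ - ((2 * halfSinSq ξ σ) • ξ - xiMinus ξ σ)

theorem xiPlus_eq_sub (ξ σ : R3) : xiPlus ξ σ = ξ - xiMinus ξ σ := by
  simp only [xiPlus, xiMinus]
  module

/-- The reflection in the axis spanned by `ξ`. -/
noncomputable def axisRefl (ξ : R3) : R3 ≃ₗᵢ[ℝ] R3 := (Submodule.span ℝ {ξ}).reflection

theorem axisRefl_apply {ξ : R3} (hξ : ξ ≠ 0) (σ : R3) :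
    axisRefl ξ σ = (2 * cosAng ξ σ * ‖ξ‖⁻¹) • ξ - σ := by
  have hn : ‖ξ‖ ≠ 0 := by simpa
  rw [axisRefl, Submodule.reflection_singleton_apply, ← norm_mul_cosAng, two_nsmul, ← two_smul ℝ,
    smul_smul]
  congr 2
  simp
  field_simp

theorem cosAng_axisRefl {ξ : R3} (hξ : ξ ≠ 0) (σ : R3) :
    cosAng ξ (axisRefl ξ σ) = cosAng ξ σ := by
  have hn : ‖ξ‖ ≠ 0 := by simpa
  have : inner ℝ ξ (axisRefl ξ σ) = inner ℝ ξ σ := by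
    rw [axisRefl_apply hξ, inner_sub_right, inner_smul_right, real_inner_self_eq_norm_sq,
      ← norm_mul_cosAng]
    field_simp
    ring
  simp only [cosAng, real_inner_smul_left, this]

theorem xiPlus_axisRefl {ξ : R3} (hξ : ξ ≠ 0) (σ : R3) :
    xiPlus ξ (axisRefl ξ σ) = xiMirror ξ σ := by
  have hn : ‖ξ‖ ≠ 0 := by simpa
  rw [axisRefl_apply hξ]
  simp only [xiPlus, xiMirror, xiMinus, halfSinSq]
  rw [smul_sub ‖ξ‖, smul_smul, show ‖ξ‖ * (2 * cosAng ξ σ * ‖ξ‖⁻¹) = 2 * cosAng ξ σ by field_simp]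
  module

theorem measurable_xiMirror : Measurable (Function.uncurry xiMirror) := by
  have h1 := measurable_halfSinSq
  have h2 := continuous_xiMinus.measurable
  exact measurable_fst.sub (((h1.const_mul 2).smul measurable_fst).sub h2)

/-- The collision integrand, symmetrized about the axis spanned by `ξ`. -/
noncomputable def symKernel (φ : R3 → ℂ) (ξ σ : R3) : ℂ :=
  φ (xiPlus ξ σ) * (φ (xiMinus ξ σ) - 1) +
    ((1 / 2 : ℂ) * (φ (xiPlus ξ σ) + φ (xiMirror ξ σ)) - φ ξ)

/-- A majorant of the symmetrized collision integrand. -/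
noncomputable def symBound (α : ℝ) (g : R3 → ℝ≥0∞) (ξ σ : R3) : ℝ≥0∞ :=
  3 * g (xiMinus ξ σ) + ENNReal.ofReal (halfSinSq ξ σ ^ (α / 2)) * g ξ +
    ENNReal.ofReal (halfSinSq ξ σ ^ (-(α / 2)) + 3) * g (halfSinSq ξ σ • ξ)

theorem symKernel_eq_zero {φ : R3 → ℂ} (h : φ ∈ spaceK) {ξ σ : R3} (hσ : ‖σ‖ = 1)
    (hu : cosAng ξ σ = 1) : symKernel φ ξ σ = 0 := by
  have h0 : xiMinus ξ σ = 0 := by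
    have := norm_xiMinus_sq' (ξ := ξ) hσ
    rw [hu] at this
    simpa using this
  rw [symKernel, xiMirror, xiPlus_eq_sub, h0, apply_zero_of_mem_spaceK h, halfSinSq, hu]
  simp
  ring

/-- The second-difference estimate applies with y = ξ⁻ and u = sin²(θ/2), because ξ⁺ = ξ − ξ⁻ and
the mean of ξ⁻ and its mirror image is uξ. It gives 2|1 − φ(ξ⁻)|; the term φ(ξ⁺)(φ(ξ⁻) − 1) gives
one more. -/
theorem enorm_symKernel_le {φ : R3 → ℂ} (h : φ ∈ spaceK) (α : ℝ) {ξ σ : R3} (hσ : ‖σ‖ = 1) :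
    ‖symKernel φ ξ σ‖ₑ ≤ symBound α (fun η => ‖φ η - 1‖ₑ) ξ σ := by
  rcases (halfSinSq_mem (ξ := ξ) hσ).1.eq_or_lt with hu | hu
  · rw [symKernel_eq_zero h hσ (by unfold halfSinSq at hu; linarith)]
    simp
  set u := halfSinSq ξ σ with hudef
  -- This l balances the terms: integrating |1 − φ(uξ)| against the weight gains u^α, so l and
  -- l⁻¹u^α are both u^{α/2} = sin^α(θ/2).
  have h1 := norm_mean_sub_le h ξ (xiMinus ξ σ) u (l := u ^ (α / 2)) (by positivity)
  have h2 : ‖φ (xiPlus ξ σ) * (φ (xiMinus ξ σ) - 1)‖ ≤ ‖φ (xiMinus ξ σ) - 1‖ := by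
    rw [norm_mul]
    exact mul_le_of_le_one_left (norm_nonneg _) (norm_le_one_of_mem_spaceK h _)
  have h3 : ‖symKernel φ ξ σ‖ ≤ 3 * ‖φ (xiMinus ξ σ) - 1‖ + u ^ (α / 2) * ‖φ ξ - 1‖ +
      (u ^ (-(α / 2)) + 3) * ‖φ (u • ξ) - 1‖ := by
    refine (norm_add_le _ _).trans ?_
    rw [← xiPlus_eq_sub, ← Real.rpow_neg hu.le, norm_sub_rev 1, norm_sub_rev 1,
      norm_sub_rev 1] at h1
    have h4 := add_le_add h2 h1
    refine h4.trans (le_of_eq ?_)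
    ring
  have h5 := ENNReal.ofReal_le_ofReal h3
  rw [ofReal_norm] at h5
  refine h5.trans (le_of_eq ?_)
  rw [ENNReal.ofReal_add (by positivity) (by positivity),
    ENNReal.ofReal_add (by positivity) (by positivity), ENNReal.ofReal_mul (by positivity),
    ENNReal.ofReal_mul (by positivity), ENNReal.ofReal_mul (by positivity), ofReal_norm,
    ofReal_norm, ofReal_norm, symBound, ← hudef]
  simp

theorem angInt_mono {B C : ℝ → ℝ≥0∞} (h : ∀ x ∈ Icc (-1 : ℝ) 1, B x ≤ C x) :
    angInt B ≤ angInt C := by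
  unfold angInt
  gcongr with θ
  exact h _ (Real.cos_mem_Icc θ)

theorem angInt_const_mul {c : ℝ≥0∞} {B : ℝ → ℝ≥0∞} (hB : Measurable B) :
    angInt (fun x => c * B x) = c * angInt B := by
  unfold angInt
  simp_rw [mul_assoc c]
  rw [lintegral_const_mul _ (by fun_prop), mul_left_comm]

theorem angInt_add {B C : ℝ → ℝ≥0∞} (hB : Measurable B) :
    angInt (fun x => B x + C x) = angInt B + angInt C := by
  unfold angInt
  simp_rw [add_mul]
  rw [lintegral_add_left (by fun_prop), mul_add]

/-- Each term of the majorant integrates to a multiple of ∫ B sin^α(θ/2) dσ: the first by the change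
of variables ξ ↦ ξ⁻, the second directly, the third by the dilation ξ ↦ uξ. -/
theorem lintegral_symBound_le {α : ℝ} (hα : 0 < α) {B : ℝ → ℝ≥0∞} (hB : Measurable B)
    {g : R3 → ℝ≥0∞} (hg : Measurable g) (hg0 : g 0 = 0) :
    ∫⁻ ξ, (∫⁻ σ : S2, B (cosAng ξ σ) * symBound α g ξ σ ∂surf) * wt α ξ ≤
      8 * angInt (fun x => B x * ENNReal.ofReal (((1 - x) / 2) ^ (α / 2))) *
        ∫⁻ ξ, g ξ * wt α ξ := by
  have hwm := measurable_wt α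
  set κ := angInt (fun x => B x * ENNReal.ofReal (((1 - x) / 2) ^ (α / 2))) with hκ
  set N := ∫⁻ ξ, g ξ * wt α ξ with hN
  have hBc : ∀ ξ : R3, Measurable fun σ : S2 => B (cosAng ξ σ) := fun ξ =>
    hB.comp ((measurable_cosAng_right ξ).comp measurable_subtype_coe)
  have hxm : ∀ ξ : R3, Measurable fun σ : S2 => g (xiMinus ξ σ) := fun ξ =>
    hg.comp ((continuous_xiMinus.measurable.comp
      (measurable_prodMk_left (x := ξ))).comp measurable_subtype_coe)
  set W : ℝ → ℝ≥0∞ := fun x => B x * ENNReal.ofReal (((1 - x) / 2) ^ (-(α / 2)) + 3) with hW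
  have hWm : Measurable W := by fun_prop
  have h1 : ∀ ξ : R3, ξ ≠ 0 → (∫⁻ σ : S2, B (cosAng ξ σ) * symBound α g ξ σ ∂surf) * wt α ξ =
      3 * ((∫⁻ σ : S2, B (cosAng ξ σ) * g (xiMinus ξ σ) ∂surf) * wt α ξ) +
      κ * (g ξ * wt α ξ) +
      angInt (fun x => W x * g (((1 - x) / 2) • ξ)) * wt α ξ := by
    intro ξ hξ
    obtain ⟨P, hP⟩ : ∃ P : ℝ → ℝ≥0∞,
        P = fun x => B x * ENNReal.ofReal (((1 - x) / 2) ^ (α / 2)) := ⟨_, rfl⟩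
    obtain ⟨R, hR⟩ : ∃ R : ℝ → ℝ≥0∞, R = fun x => W x * g (((1 - x) / 2) • ξ) := ⟨_, rfl⟩
    have e1 : ∀ σ : S2, B (cosAng ξ σ) * symBound α g ξ σ =
        (3 * (B (cosAng ξ σ) * g (xiMinus ξ σ)) + P (cosAng ξ σ) * g ξ) + R (cosAng ξ σ) := by
      intro σ
      simp only [symBound, hW, halfSinSq, hP, hR]
      ring
    simp_rw [e1]
    have hm2 : Measurable P := by rw [hP]; fun_prop
    have hm3 : Measurable R := by rw [hR]; fun_prop
    have hm2' : Measurable fun σ : S2 => P (cosAng ξ σ) :=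
      hm2.comp ((measurable_cosAng_right ξ).comp measurable_subtype_coe)
    have hm1 : Measurable fun σ : S2 => B (cosAng ξ σ) * g (xiMinus ξ σ) := (hBc ξ).mul (hxm ξ)
    have hm4 : Measurable fun σ : S2 =>
        3 * (B (cosAng ξ σ) * g (xiMinus ξ σ)) + P (cosAng ξ σ) * g ξ :=
      (hm1.const_mul 3).add (hm2'.mul_const _)
    rw [lintegral_add_left hm4, lintegral_add_left (hm1.const_mul 3),
      lintegral_const_mul _ hm1, lintegral_mul_const _ hm2',
      lintegral_surf_cosAng hξ hm2, lintegral_surf_cosAng hξ hm3, hκ, ← hP, ← hR]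
    ring
  have h0 : ∀ᵐ ξ : R3, ξ ≠ 0 := by
    simp [ae_iff]
  rw [lintegral_congr_ae (h0.mono h1)]
  have hmA : Measurable fun ξ : R3 =>
      ((∫⁻ σ : S2, B (cosAng ξ σ) * g (xiMinus ξ σ) ∂surf) * wt α ξ) := by
    have hj : Measurable fun q : R3 × S2 => B (cosAng q.1 q.2) * g (xiMinus q.1 q.2) := by
      have hi : Measurable fun q : R3 × S2 => (q.1, (q.2 : R3)) := by fun_prop
      exact (hB.comp (measurable_cosAng.comp hi)).mul
        (hg.comp (continuous_xiMinus.measurable.comp hi))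
    exact (hj.lintegral_prod_right').mul hwm
  rw [lintegral_add_left (by fun_prop), lintegral_add_left (by fun_prop),
    lintegral_const_mul' _ _ (by simp), lintegral_const_mul _ (by fun_prop),
    lintegral_xiMinus hB hg hg0, ← hκ, ← hN]
  have h2 : ∫⁻ ξ, angInt (fun x => W x * g (((1 - x) / 2) • ξ)) * wt α ξ ≤ 4 * κ * N := by
    have e2 : ∀ ξ, angInt (fun x => W x * g (((1 - x) / 2) • ξ)) * wt α ξ =
        ENNReal.ofReal (2 * Real.pi) * ∫⁻ θ in Ioo (0 : ℝ) Real.pi,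
          (W (Real.cos θ) * ENNReal.ofReal (Real.sin θ)) *
          (g (((1 - Real.cos θ) / 2) • ξ) * wt α ξ) := by
      intro ξ
      rw [angInt, mul_assoc, ← lintegral_mul_const _ (by fun_prop)]
      congr 2
      ext θ
      ring
    simp_rw [e2]
    rw [lintegral_const_mul' _ _ ENNReal.ofReal_ne_top, lintegral_lintegral_swap (by
      apply Measurable.aemeasurable
      unfold Function.uncurry
      fun_prop)]
    have e3 : ∀ θ : ℝ, ∫⁻ ξ, (W (Real.cos θ) * ENNReal.ofReal (Real.sin θ)) *
          (g (((1 - Real.cos θ) / 2) • ξ) * wt α ξ) ≤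
        (4 * (B (Real.cos θ) * ENNReal.ofReal (((1 - Real.cos θ) / 2) ^ (α / 2))) *
          ENNReal.ofReal (Real.sin θ)) * N := by
      intro θ
      have hu0 : 0 ≤ (1 - Real.cos θ) / 2 := by linarith [Real.cos_le_one θ]
      have hu1 : (1 - Real.cos θ) / 2 ≤ 1 := by linarith [Real.neg_one_le_cos θ]
      rw [lintegral_const_mul _ (by fun_prop), lintegral_smul_wt hu0 hα hg0, ← hN]
      simp only [hW]
      set u := (1 - Real.cos θ) / 2
      -- Here 4 = 1 + 3, as u^{-α/2}u^α = u^{α/2} and u^α ≤ u^{α/2} for 0 < u ≤ 1.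
      have hpow : ENNReal.ofReal (u ^ (-(α / 2)) + 3) * ENNReal.ofReal (u ^ α) ≤
          4 * ENNReal.ofReal (u ^ (α / 2)) := by
        rw [← ENNReal.ofReal_mul (by positivity), show (4 : ℝ≥0∞) = ENNReal.ofReal 4 by simp,
          ← ENNReal.ofReal_mul (by positivity)]
        apply ENNReal.ofReal_le_ofReal
        rcases hu0.eq_or_lt with hu | hu
        · rw [← hu, Real.zero_rpow hα.ne', Real.zero_rpow (half_pos hα).ne']
          simp
        · have e4 : u ^ (-(α / 2)) * u ^ α = u ^ (α / 2) := by
            rw [← Real.rpow_add hu]; congr 1; ring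
          have e5 : u ^ α ≤ u ^ (α / 2) :=
            Real.rpow_le_rpow_of_exponent_ge hu hu1 (by linarith)
          rw [add_mul, e4]
          linarith
      calc _ = B (Real.cos θ) * ENNReal.ofReal (Real.sin θ) * N *
            (ENNReal.ofReal (u ^ (-(α / 2)) + 3) * ENNReal.ofReal (u ^ α)) := by ring
        _ ≤ B (Real.cos θ) * ENNReal.ofReal (Real.sin θ) * N *
            (4 * ENNReal.ofReal (u ^ (α / 2))) := by gcongr
        _ = _ := by ring
    calc _ ≤ ENNReal.ofReal (2 * Real.pi) * ∫⁻ θ in Ioo (0 : ℝ) Real.pi,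
          (4 * (B (Real.cos θ) * ENNReal.ofReal (((1 - Real.cos θ) / 2) ^ (α / 2))) *
          ENNReal.ofReal (Real.sin θ)) * N := by
            gcongr with θ
            exact e3 θ
      _ = angInt (fun x => 4 * (B x * ENNReal.ofReal (((1 - x) / 2) ^ (α / 2)))) * N := by
        rw [lintegral_mul_const _ (by fun_prop), angInt, mul_assoc]
      _ = 4 * κ * N := by rw [angInt_const_mul (by fun_prop)]
  calc _ ≤ 3 * (κ * N) + κ * N + 4 * κ * N := by gcongr
    _ = 8 * κ * N := by ring

/-! ### Cut-off cross sections, angular moments and λ_α. -/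

/-- The extended-real cross section. -/
noncomputable def bE (b : ℝ → ℝ) (x : ℝ) : ℝ≥0∞ := ENNReal.ofReal (b x)

/-- The cross section restricted to deviation angles at least `ε`. -/
noncomputable def bCut (b : ℝ → ℝ) (ε : ℝ) : ℝ → ℝ := (Iic (Real.cos ε)).indicator b

/-- The extended-real cross section restricted to deviation angles at least `ε`. -/
noncomputable def bFar (b : ℝ → ℝ) (ε : ℝ) : ℝ → ℝ≥0∞ := (Iic (Real.cos ε)).indicator (bE b)

/-- The extended-real cross section restricted to deviation angles less than `ε`. -/
noncomputable def bNear (b : ℝ → ℝ) (ε : ℝ) : ℝ → ℝ≥0∞ := (Ioi (Real.cos ε)).indicator (bE b)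

/-- The angular moment `∫ b sin^α(θ/2) dσ` of an extended-real cross section. -/
noncomputable def angMoment (α : ℝ) (B : ℝ → ℝ≥0∞) : ℝ≥0∞ :=
  angInt (fun x => B x * ENNReal.ofReal (((1 - x) / 2) ^ (α / 2)))

variable {b : ℝ → ℝ}

theorem measurable_bE (hb : IsCrossSection b) : Measurable (bE b) := hb.measurable.ennreal_ofReal

theorem measurable_bFar (hb : IsCrossSection b) (ε : ℝ) : Measurable (bFar b ε) :=
  (measurable_bE hb).indicator measurableSet_Iic

theorem measurable_bNear (hb : IsCrossSection b) (ε : ℝ) : Measurable (bNear b ε) :=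
  (measurable_bE hb).indicator measurableSet_Ioi

theorem measurable_bCut (hb : IsCrossSection b) (ε : ℝ) : Measurable (bCut b ε) :=
  hb.measurable.indicator measurableSet_Iic

theorem half_one_sub_cos (θ : ℝ) : (1 - Real.cos θ) / 2 = Real.sin (θ / 2) ^ 2 := by
  rw [Real.sin_sq_eq_half_sub, mul_div_cancel₀ _ two_ne_zero]; ring

theorem half_one_add_cos (θ : ℝ) : (1 + Real.cos θ) / 2 = Real.cos (θ / 2) ^ 2 := by
  rw [Real.cos_sq, mul_div_cancel₀ _ two_ne_zero]; ring

theorem sq_rpow_half {x : ℝ} (hx : 0 ≤ x) (α : ℝ) : (x ^ 2) ^ (α / 2) = x ^ α := by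
  rw [← Real.rpow_two, ← Real.rpow_mul hx, mul_div_cancel₀ _ two_ne_zero]

theorem sin_half_nonneg {θ : ℝ} (hθ : θ ∈ Icc 0 Real.pi) : 0 ≤ Real.sin (θ / 2) :=
  Real.sin_nonneg_of_nonneg_of_le_pi (by linarith [hθ.1]) (by linarith [hθ.1, hθ.2])

theorem cos_half_nonneg {θ : ℝ} (hθ : θ ∈ Icc 0 Real.pi) : 0 ≤ Real.cos (θ / 2) :=
  Real.cos_nonneg_of_mem_Icc ⟨by linarith [hθ.1, Real.pi_pos], by linarith [hθ.2]⟩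

/-- Integrals against the cross section, as integrals over the deviation angle. -/
theorem angInt_bE_mul (hb : IsCrossSection b) (w : ℝ → ℝ) :
    angInt (fun x => bE b x * ENNReal.ofReal (w x)) =
      ENNReal.ofReal (2 * Real.pi) * ∫⁻ θ in Ioc (0 : ℝ) (Real.pi / 2),
        ENNReal.ofReal (b (Real.cos θ) * Real.sin θ * w (Real.cos θ)) := by
  have hpi := Real.pi_pos
  unfold angInt
  congr 1
  rw [← lintegral_indicator measurableSet_Ioo, ← lintegral_indicator measurableSet_Ioc]
  refine lintegral_congr fun θ => ?_
  by_cases h : θ ∈ Ioc 0 (Real.pi / 2)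
  · rw [indicator_of_mem h, indicator_of_mem (show θ ∈ Ioo 0 Real.pi from
      ⟨h.1, by linarith [h.2]⟩)]
    have hs : 0 ≤ Real.sin θ :=
      Real.sin_nonneg_of_nonneg_of_le_pi h.1.le (by linarith [h.2])
    have hb0 := hb.nonneg _ (Real.cos_mem_Icc θ)
    rw [ENNReal.ofReal_mul (by positivity), ENNReal.ofReal_mul hb0]
    simp only [bE]
    ring
  · rw [indicator_of_notMem h]
    by_cases h2 : θ ∈ Ioo 0 Real.pi
    · have h3 : Real.pi / 2 < θ := by
        by_contra hlt
        exact h ⟨h2.1, not_lt.1 hlt⟩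
      have h4 : Real.cos θ < 0 := Real.cos_neg_of_pi_div_two_lt_of_lt h3 (by linarith [h2.2])
      rw [indicator_of_mem h2]
      simp [bE, hb.eq_zero _ ⟨Real.neg_one_le_cos θ, h4⟩]
    · rw [indicator_of_notMem h2]

theorem integrableOn_rpow_of_le (hb : IsCrossSection b) {α₀ α : ℝ} (hα₀ : 0 < α₀) (h : α₀ ≤ α)
    (hint : WeaklyIntegrable b α₀) :
    IntegrableOn (fun θ : ℝ => b (Real.cos θ) * Real.sin θ * Real.sin (θ / 2) ^ α)
      (Ioc 0 (Real.pi / 2)) := by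
  have hbm := hb.measurable
  refine Integrable.mono' hint (by fun_prop) ?_
  filter_upwards [ae_restrict_mem measurableSet_Ioc] with θ hθ
  have hpi := Real.pi_pos
  have hθ' : θ ∈ Icc 0 Real.pi := ⟨hθ.1.le, by linarith [hθ.2]⟩
  have hs : 0 ≤ Real.sin θ := Real.sin_nonneg_of_nonneg_of_le_pi hθ'.1 hθ'.2
  have hb0 := hb.nonneg _ (Real.cos_mem_Icc θ)
  have hs2 := sin_half_nonneg hθ'
  rw [Real.norm_of_nonneg (by positivity)]
  gcongr _ * ?_
  exact Real.rpow_le_rpow_of_exponent_ge_of_imp hs2 (Real.sin_le_one _) h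
    fun _ h0 => absurd h0 (hα₀.trans_le h).ne'

theorem angMoment_bE_lt_top (hb : IsCrossSection b) {α₀ α : ℝ} (hα₀ : 0 < α₀) (h : α₀ ≤ α)
    (hint : WeaklyIntegrable b α₀) : angMoment α (bE b) < ⊤ := by
  have h1 := integrableOn_rpow_of_le hb hα₀ h hint
  rw [angMoment, angInt_bE_mul hb (fun x => ((1 - x) / 2) ^ (α / 2))]
  refine ENNReal.mul_lt_top ENNReal.ofReal_lt_top ?_
  have h2 := h1.lintegral_lt_top
  refine lt_of_eq_of_lt (setLIntegral_congr_fun measurableSet_Ioc fun θ hθ => ?_) h2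
  have hθ' : θ ∈ Icc 0 Real.pi := ⟨hθ.1.le, by linarith [hθ.2, Real.pi_pos]⟩
  simp only [half_one_sub_cos, sq_rpow_half (sin_half_nonneg hθ')]

theorem tendsto_angMoment_bNear (hb : IsCrossSection b) {α : ℝ}
    (hfin : angMoment α (bE b) < ⊤) :
    Tendsto (fun ε => angMoment α (bNear b ε)) (𝓝[>] 0) (𝓝 0) := by
  have hbm := measurable_bE hb
  unfold angMoment angInt at hfin ⊢
  have hpi := Real.pi_pos
  have hfin' : ∫⁻ θ in Ioo (0 : ℝ) Real.pi, bE b (Real.cos θ) *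
      ENNReal.ofReal (((1 - Real.cos θ) / 2) ^ (α / 2)) * ENNReal.ofReal (Real.sin θ) ≠ ⊤ := by
    intro htop
    rw [htop, ENNReal.mul_top (by simpa using hpi)] at hfin
    exact lt_irrefl _ hfin
  have h := tendsto_lintegral_filter_of_dominated_convergence
    (μ := volume.restrict (Ioo (0 : ℝ) Real.pi)) (l := 𝓝[>] (0 : ℝ))
    (F := fun ε θ => bNear b ε (Real.cos θ) *
      ENNReal.ofReal (((1 - Real.cos θ) / 2) ^ (α / 2)) * ENNReal.ofReal (Real.sin θ))
    (f := fun _ => 0) _ (Eventually.of_forall fun ε => by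
      have := measurable_bNear hb ε
      fun_prop)
    (Eventually.of_forall fun ε => ae_of_all _ fun θ => by
      gcongr
      exact indicator_le_self _ _ _) hfin' (by
      filter_upwards [ae_restrict_mem measurableSet_Ioo] with θ hθ
      refine tendsto_const_nhds.congr' ?_
      filter_upwards [Ioo_mem_nhdsGT hθ.1] with ε hε
      have : Real.cos θ ≤ Real.cos ε :=
        Real.cos_le_cos_of_nonneg_of_le_pi hε.1.le hθ.2.le hε.2.le
      rw [bNear, indicator_of_notMem (by simpa using this)]
      simp)
  simp only [lintegral_zero] at h
  simpa only [mul_zero] using ENNReal.Tendsto.const_mul (a := ENNReal.ofReal (2 * Real.pi)) h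
    (Or.inr ENNReal.ofReal_ne_top)

/-- For θ ≥ ε the factor sin^α(θ/2) is bounded below by sin^α(ε/2), so the finite moment controls
the total mass. -/
theorem angInt_bFar_lt_top (hb : IsCrossSection b) {α : ℝ} (hα : 0 < α)
    (hfin : angMoment α (bE b) < ⊤) {ε : ℝ} (hε : ε ∈ Ioo 0 Real.pi) :
    angInt (bFar b ε) < ⊤ := by
  have hbm := measurable_bE hb
  have hc : Real.cos ε < 1 := by
    have := Real.cos_lt_cos_of_nonneg_of_le_pi le_rfl hε.2.le hε.1
    simpa using this
  set c := ((1 - Real.cos ε) / 2) ^ (α / 2) with hcdef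
  have hc0 : 0 < c := by
    have : 0 < (1 - Real.cos ε) / 2 := by linarith
    positivity
  have h : angInt (bFar b ε) ≤ angInt (fun x => (ENNReal.ofReal c)⁻¹ *
      (bE b x * ENNReal.ofReal (((1 - x) / 2) ^ (α / 2)))) := by
    refine angInt_mono fun x hx => ?_
    by_cases hx' : x ∈ Iic (Real.cos ε)
    · rw [bFar, indicator_of_mem hx', mul_left_comm]
      refine le_mul_of_one_le_right' ?_
      rw [← ENNReal.inv_mul_cancel (a := ENNReal.ofReal c) (by simpa using hc0)
        ENNReal.ofReal_ne_top]
      gcongr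
      rw [hcdef]
      have : x ≤ Real.cos ε := hx'
      exact Real.rpow_le_rpow (by linarith) (by linarith) (by positivity)
    · rw [bFar, indicator_of_notMem hx']
      exact zero_le
  refine h.trans_lt ?_
  rw [angInt_const_mul (by fun_prop)]
  exact ENNReal.mul_lt_top (by simpa using hc0) hfin

/-- The two numbers lie in [0,1] and add up to 1, and an exponent at most 1 can only increase them.
This gives the sign of the integrand of λ_α and also the subadditivity of |·|^p along ξ^±. -/
theorem one_le_rpow_add_rpow {x : ℝ} (hx : x ∈ Icc (-1 : ℝ) 1) {α : ℝ}
    (hα2 : α ≤ 2) : 1 ≤ ((1 + x) / 2) ^ (α / 2) + ((1 - x) / 2) ^ (α / 2) := by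
  have h1 := Real.rpow_le_rpow_of_exponent_ge_of_imp (x := (1 + x) / 2) (y := 1) (z := α / 2)
    (by linarith [hx.1]) (by linarith [hx.2]) (by linarith) (fun _ h0 => absurd h0 (by positivity))
  have h2 := Real.rpow_le_rpow_of_exponent_ge_of_imp (x := (1 - x) / 2) (y := 1) (z := α / 2)
    (by linarith [hx.2]) (by linarith [hx.1]) (by linarith) (fun _ h0 => absurd h0 (by positivity))
  rw [Real.rpow_one] at h1 h2
  linarith

/-- The bracket cos^α(θ/2) + sin^α(θ/2) − 1 lies between 0 and sin^α(θ/2), so its integral against b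
is finite and the real and extended-real integrals agree. -/
theorem lambdaConst_nonneg_and_angInt (hb : IsCrossSection b) {α₀ α : ℝ} (hα₀ : 0 < α₀)
    (h : α₀ ≤ α) (hα2 : α ≤ 2) (hint : WeaklyIntegrable b α₀) :
    0 ≤ lambdaConst b α ∧
    angInt (fun x => bE b x * ENNReal.ofReal
      (((1 + x) / 2) ^ (α / 2) + ((1 - x) / 2) ^ (α / 2) - 1)) =
    ENNReal.ofReal (lambdaConst b α) := by
  have hα : 0 < α := hα₀.trans_le h
  have hbm := hb.measurable
  have hpi := Real.pi_pos
  have hmain : ∀ θ ∈ Ioc 0 (Real.pi / 2),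
      b (Real.cos θ) * Real.sin θ * (((1 + Real.cos θ) / 2) ^ (α / 2) +
        ((1 - Real.cos θ) / 2) ^ (α / 2) - 1) =
      b (Real.cos θ) * Real.sin θ * (Real.cos (θ / 2) ^ α + Real.sin (θ / 2) ^ α - 1) ∧
      0 ≤ b (Real.cos θ) * Real.sin θ * (Real.cos (θ / 2) ^ α + Real.sin (θ / 2) ^ α - 1) ∧
      b (Real.cos θ) * Real.sin θ * (Real.cos (θ / 2) ^ α + Real.sin (θ / 2) ^ α - 1) ≤
      b (Real.cos θ) * Real.sin θ * Real.sin (θ / 2) ^ α := by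
    intro θ hθ
    have hθ' : θ ∈ Icc 0 Real.pi := ⟨hθ.1.le, by linarith [hθ.2]⟩
    have hs : 0 ≤ Real.sin θ := Real.sin_nonneg_of_nonneg_of_le_pi hθ'.1 hθ'.2
    have hb0 := hb.nonneg _ (Real.cos_mem_Icc θ)
    have h1 := one_le_rpow_add_rpow (Real.cos_mem_Icc θ) hα2
    rw [half_one_sub_cos, half_one_add_cos, sq_rpow_half (sin_half_nonneg hθ'),
      sq_rpow_half (cos_half_nonneg hθ')] at h1 ⊢
    refine ⟨rfl, mul_nonneg (by positivity) (by linarith), ?_⟩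
    gcongr
    have := Real.rpow_le_one (cos_half_nonneg hθ') (Real.cos_le_one _) hα.le
    linarith
  have hI : IntegrableOn (fun θ : ℝ => b (Real.cos θ) * Real.sin θ *
      (Real.cos (θ / 2) ^ α + Real.sin (θ / 2) ^ α - 1)) (Ioc 0 (Real.pi / 2)) := by
    refine Integrable.mono' (integrableOn_rpow_of_le hb hα₀ h hint) (by fun_prop) ?_
    filter_upwards [ae_restrict_mem measurableSet_Ioc] with θ hθ
    rw [Real.norm_of_nonneg (hmain θ hθ).2.1]
    exact (hmain θ hθ).2.2
  have hn : 0 ≤ᵐ[volume.restrict (Ioc 0 (Real.pi / 2))] (fun θ : ℝ => b (Real.cos θ) *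
      Real.sin θ * (Real.cos (θ / 2) ^ α + Real.sin (θ / 2) ^ α - 1)) := by
    filter_upwards [ae_restrict_mem measurableSet_Ioc] with θ hθ
    exact (hmain θ hθ).2.1
  have hl : lambdaConst b α = 2 * Real.pi * ∫ θ in Ioc 0 (Real.pi / 2), b (Real.cos θ) *
      Real.sin θ * (Real.cos (θ / 2) ^ α + Real.sin (θ / 2) ^ α - 1) := by
    rw [lambdaConst, intervalIntegral.integral_of_le (by positivity)]
  constructor
  · rw [hl]
    exact mul_nonneg (by positivity) (integral_nonneg_of_ae hn)
  · rw [angInt_bE_mul hb (fun x => ((1 + x) / 2) ^ (α / 2) + ((1 - x) / 2) ^ (α / 2) - 1), hl,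
      ENNReal.ofReal_mul (show 0 ≤ 2 * Real.pi by positivity),
      ofReal_integral_eq_lintegral_ofReal hI hn]
    congr 1
    exact setLIntegral_congr_fun measurableSet_Ioc fun θ hθ => by
      simp only [(hmain θ hθ).1]

/-- Writing cos^α + sin^α = 1 + (cos^α + sin^α − 1), the 1 gives the loss rate A_ε, and the
nonnegative bracket is integrated over all angles instead of θ ≥ ε. -/
theorem angInt_gain_le (hb : IsCrossSection b) {α₀ α : ℝ} (hα₀ : 0 < α₀)
    (h : α₀ ≤ α) (hα2 : α ≤ 2) (hint : WeaklyIntegrable b α₀) (ε : ℝ) :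
    angInt (fun x => bFar b ε x * ENNReal.ofReal (((1 + x) / 2) ^ (α / 2))) +
      angInt (fun x => bFar b ε x * ENNReal.ofReal (((1 - x) / 2) ^ (α / 2))) ≤
    angInt (bFar b ε) + ENNReal.ofReal (lambdaConst b α) := by
  have hm := measurable_bFar hb ε
  rw [← (lambdaConst_nonneg_and_angInt hb hα₀ h hα2 hint).2, ← angInt_add (by fun_prop),
    ← angInt_add hm]
  refine angInt_mono fun x hx => ?_
  have h1 := one_le_rpow_add_rpow hx hα2
  have hx1 : 0 ≤ (1 + x) / 2 := by linarith [hx.1]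
  have hx2 : 0 ≤ (1 - x) / 2 := by linarith [hx.2]
  have h2 : bFar b ε x ≤ bE b x := indicator_le_self _ _ _
  calc _ = bFar b ε x * ENNReal.ofReal (1 +
        (((1 + x) / 2) ^ (α / 2) + ((1 - x) / 2) ^ (α / 2) - 1)) := by
        rw [← mul_add, ← ENNReal.ofReal_add (by positivity) (by positivity)]
        congr 2
        ring
    _ = bFar b ε x + bFar b ε x * ENNReal.ofReal
        (((1 + x) / 2) ^ (α / 2) + ((1 - x) / 2) ^ (α / 2) - 1) := by
        rw [ENNReal.ofReal_add zero_le_one (by linarith), mul_add]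
        simp
    _ ≤ _ := by gcongr

/-! ### The collision operator as a limit of cut-off operators. -/

/-- The collision integral with the symmetrized integrand and angular weight `c`. -/
noncomputable def collisionSym (c : ℝ → ℝ) (φ : R3 → ℂ) (ξ : R3) : ℂ :=
  ∫ σ : S2, (c (cosAng ξ σ) : ℂ) * symKernel φ ξ σ ∂surf

theorem measurable_symKernel {φ : R3 → ℂ} (h : Continuous φ) :
    Measurable (Function.uncurry (symKernel φ)) := by
  have h1 := h.measurable.comp continuous_xiPlus.measurable
  have h2 := h.measurable.comp continuous_xiMinus.measurable
  have h3 := h.measurable.comp measurable_xiMirror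
  exact (h1.mul (h2.sub_const 1)).add
    (((h1.add h3).const_mul (1 / 2 : ℂ)).sub (h.measurable.comp measurable_fst))

theorem enorm_bCut (hb : IsCrossSection b) (ε : ℝ) {x : ℝ} (hx : x ∈ Icc (-1 : ℝ) 1) :
    ‖((bCut b ε x : ℝ) : ℂ)‖ₑ = bFar b ε x := by
  by_cases h : x ∈ Iic (Real.cos ε)
  · rw [bCut, bFar, indicator_of_mem h, indicator_of_mem h, ← ofReal_norm, Complex.norm_real,
      Real.norm_of_nonneg (hb.nonneg x hx), bE]
  · rw [bCut, bFar, indicator_of_notMem h, indicator_of_notMem h]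
    simp

theorem enorm_b (hb : IsCrossSection b) {x : ℝ} (hx : x ∈ Icc (-1 : ℝ) 1) :
    ‖((b x : ℝ) : ℂ)‖ₑ = bE b x := by
  rw [← ofReal_norm, Complex.norm_real, Real.norm_of_nonneg (hb.nonneg x hx), bE]

theorem cosAng_mem_sphere (ξ : R3) (σ : S2) : cosAng ξ σ ∈ Icc (-1 : ℝ) 1 :=
  cosAng_mem (by simp)

theorem measurable_cosAng_sphere (ξ : R3) : Measurable fun σ : S2 => cosAng ξ σ :=
  (measurable_cosAng_right ξ).comp measurable_subtype_coe

theorem integrable_bCut (hb : IsCrossSection b) {ε : ℝ} (hfin : angInt (bFar b ε) < ⊤)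
    {ξ : R3} (hξ : ξ ≠ 0) :
    Integrable (fun σ : S2 => ((bCut b ε (cosAng ξ σ) : ℝ) : ℂ)) surf := by
  refine ⟨?_, ?_⟩
  · have h := (measurable_bCut hb ε).comp (measurable_cosAng_sphere ξ)
    exact (Complex.measurable_ofReal.comp h).aestronglyMeasurable
  · rw [HasFiniteIntegral]
    simp_rw [enorm_bCut hb ε (cosAng_mem_sphere ξ _)]
    rwa [lintegral_surf_cosAng hξ (measurable_bFar hb ε)]

theorem integral_bCut (hb : IsCrossSection b) {ε : ℝ} {ξ : R3} (hξ : ξ ≠ 0) :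
    ∫ σ : S2, ((bCut b ε (cosAng ξ σ) : ℝ) : ℂ) ∂surf = ((angInt (bFar b ε)).toReal : ℂ) := by
  rw [integral_complex_ofReal, integral_eq_lintegral_of_nonneg_ae]
  · congr 3
    rw [← lintegral_surf_cosAng hξ (measurable_bFar hb ε)]
    refine lintegral_congr fun σ => ?_
    by_cases h : cosAng ξ σ ∈ Iic (Real.cos ε)
    · rw [bCut, bFar, indicator_of_mem h, indicator_of_mem h, bE]
    · rw [bCut, bFar, indicator_of_notMem h, indicator_of_notMem h, ENNReal.ofReal_zero]
  · exact ae_of_all _ fun σ =>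
      indicator_apply_nonneg fun _ => hb.nonneg _ (cosAng_mem_sphere ξ σ)
  · exact ((measurable_bCut hb ε).comp
      (measurable_cosAng_sphere ξ)).aestronglyMeasurable

theorem collisionAway_eq_integral {φ : R3 → ℂ} (h : φ ∈ spaceK) (b : ℝ → ℝ) (ξ : R3) (ε : ℝ) :
    collisionAway b φ ξ ε = ∫ σ : S2, ((bCut b ε (cosAng ξ σ) : ℝ) : ℂ) *
      (φ (xiPlus ξ σ) * φ (xiMinus ξ σ) - φ ξ) ∂surf := by
  have hs : MeasurableSet {σ : S2 | inner ℝ (‖ξ‖⁻¹ • ξ) (σ : R3) ≤ Real.cos ε} :=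
    measurableSet_le (measurable_cosAng_sphere ξ) measurable_const
  rw [collisionAway, ← integral_indicator hs]
  congr 1
  ext σ
  by_cases hc : cosAng ξ σ ≤ Real.cos ε
  · rw [indicator_of_mem (by exact hc), bCut, indicator_of_mem (by exact hc),
      apply_zero_of_mem_spaceK h, one_mul]
    rfl
  · rw [indicator_of_notMem (by exact hc), bCut, indicator_of_notMem (by exact hc)]
    simp

theorem integrable_bCut_mul (hb : IsCrossSection b) {ε : ℝ} (hfin : angInt (bFar b ε) < ⊤)
    {ξ : R3} (hξ : ξ ≠ 0) {f : R3 → ℂ} (hf : Measurable f) {C : ℝ} (hC : ∀ x, ‖f x‖ ≤ C) :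
    Integrable (fun σ : S2 => ((bCut b ε (cosAng ξ σ) : ℝ) : ℂ) * f σ) surf :=
  (integrable_bCut hb hfin hξ).mul_bdd (hf.comp measurable_subtype_coe).aestronglyMeasurable
    (ae_of_all _ fun σ => hC σ)

theorem measurable_comp_xiPlus {φ : R3 → ℂ} (h : φ ∈ spaceK) (ξ : R3) :
    Measurable fun σ => φ (xiPlus ξ σ) :=
  (continuous_of_mem_spaceK h).measurable.comp
    (continuous_xiPlus.measurable.comp (measurable_prodMk_left (x := ξ)))

theorem measurable_comp_xiMinus {φ : R3 → ℂ} (h : φ ∈ spaceK) (ξ : R3) :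
    Measurable fun σ => φ (xiMinus ξ σ) :=
  (continuous_of_mem_spaceK h).measurable.comp
    (continuous_xiMinus.measurable.comp (measurable_prodMk_left (x := ξ)))

theorem measurable_comp_xiMirror {φ : R3 → ℂ} (h : φ ∈ spaceK) (ξ : R3) :
    Measurable fun σ => φ (xiMirror ξ σ) :=
  (continuous_of_mem_spaceK h).measurable.comp
    (measurable_xiMirror.comp (measurable_prodMk_left (x := ξ)))

theorem collisionAway_eq_gain_sub (hb : IsCrossSection b) {ε : ℝ} (hfin : angInt (bFar b ε) < ⊤)
    {φ : R3 → ℂ} (h : φ ∈ spaceK) {ξ : R3} (hξ : ξ ≠ 0) :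
    collisionAway b φ ξ ε = ∫ σ : S2, ((bCut b ε (cosAng ξ σ) : ℝ) : ℂ) *
      (φ (xiPlus ξ σ) * φ (xiMinus ξ σ)) ∂surf - ((angInt (bFar b ε)).toReal : ℂ) * φ ξ := by
  rw [collisionAway_eq_integral h]
  simp_rw [mul_sub]
  rw [integral_sub, integral_mul_const, integral_bCut hb hξ]
  · refine integrable_bCut_mul (f := fun σ => φ (xiPlus ξ σ) * φ (xiMinus ξ σ)) (C := 1) hb hfin hξ
      ((measurable_comp_xiPlus h ξ).mul (measurable_comp_xiMinus h ξ)) fun σ => ?_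
    rw [norm_mul]
    exact mul_le_one₀ (norm_le_one_of_mem_spaceK h _) (norm_nonneg _)
      (norm_le_one_of_mem_spaceK h _)
  · exact (integrable_bCut hb hfin hξ).mul_const _

/-- The reflection in the axis of ξ preserves the surface measure and the deviation angle and maps
ξ⁺ to its mirror image. For θ ≥ ε all terms are separately integrable, so averaging changes nothing.
-/
theorem collisionAway_eq_collisionSym (hb : IsCrossSection b) {ε : ℝ}
    (hfin : angInt (bFar b ε) < ⊤) {φ : R3 → ℂ} (h : φ ∈ spaceK) {ξ : R3} (hξ : ξ ≠ 0) :
    collisionAway b φ ξ ε = collisionSym (bCut b ε) φ ξ := by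
  rw [collisionAway_eq_integral h, collisionSym]
  have hn := norm_le_one_of_mem_spaceK h
  have i1 : Integrable (fun σ : S2 => ((bCut b ε (cosAng ξ σ) : ℝ) : ℂ) *
      (φ (xiPlus ξ σ) * φ (xiMinus ξ σ) - φ ξ)) surf :=
    integrable_bCut_mul (f := fun σ => φ (xiPlus ξ σ) * φ (xiMinus ξ σ) - φ ξ) (C := 2) hb hfin hξ
      (((measurable_comp_xiPlus h ξ).mul (measurable_comp_xiMinus h ξ)).sub_const _) fun σ => by
      refine (norm_sub_le _ _).trans ?_
      rw [norm_mul]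
      have := mul_le_one₀ (hn (xiPlus ξ σ)) (norm_nonneg _) (hn (xiMinus ξ σ))
      linarith [hn ξ]
  have i2 : Integrable (fun σ : S2 => ((bCut b ε (cosAng ξ σ) : ℝ) : ℂ) * φ (xiPlus ξ σ)) surf :=
    integrable_bCut_mul (f := fun σ => φ (xiPlus ξ σ)) hb hfin hξ (measurable_comp_xiPlus h ξ)
      fun σ => hn _
  have i3 : Integrable (fun σ : S2 => ((bCut b ε (cosAng ξ σ) : ℝ) : ℂ) * φ (xiMirror ξ σ)) surf :=
    integrable_bCut_mul (f := fun σ => φ (xiMirror ξ σ)) hb hfin hξ (measurable_comp_xiMirror h ξ)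
      fun σ => hn _
  have hsym : ∫ σ : S2, ((bCut b ε (cosAng ξ σ) : ℝ) : ℂ) * φ (xiMirror ξ σ) ∂surf =
      ∫ σ : S2, ((bCut b ε (cosAng ξ σ) : ℝ) : ℂ) * φ (xiPlus ξ σ) ∂surf := by
    have hme : MeasurableEmbedding (sphereMap (axisRefl ξ)) := by
      refine MeasurableEmbedding.of_measurable_inverse (measurable_sphereMap _) ?_
        (measurable_sphereMap (axisRefl ξ).symm) ?_
      · rw [Function.Surjective.range_eq]
        · exact MeasurableSet.univ
        · intro σ
          exact ⟨sphereMap (axisRefl ξ).symm σ, Subtype.ext (by simp [sphereMap])⟩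
      · intro σ
        exact Subtype.ext (by simp [sphereMap])
    rw [← (measurePreserving_sphereMap (axisRefl ξ)).integral_comp hme
      (fun σ : S2 => ((bCut b ε (cosAng ξ σ) : ℝ) : ℂ) * φ (xiPlus ξ σ))]
    congr 1
    ext σ
    simp only [sphereMap, cosAng_axisRefl hξ, xiPlus_axisRefl hξ]
  have key : ∀ σ : S2, ((bCut b ε (cosAng ξ σ) : ℝ) : ℂ) * symKernel φ ξ σ =
      ((bCut b ε (cosAng ξ σ) : ℝ) : ℂ) * (φ (xiPlus ξ σ) * φ (xiMinus ξ σ) - φ ξ) +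
      (1 / 2 : ℂ) * (((bCut b ε (cosAng ξ σ) : ℝ) : ℂ) * φ (xiMirror ξ σ) -
        ((bCut b ε (cosAng ξ σ) : ℝ) : ℂ) * φ (xiPlus ξ σ)) := by
    intro σ
    rw [symKernel]
    ring
  simp_rw [key]
  have i4 : Integrable (fun σ : S2 => (1 / 2 : ℂ) *
      (((bCut b ε (cosAng ξ σ) : ℝ) : ℂ) * φ (xiMirror ξ σ) -
        ((bCut b ε (cosAng ξ σ) : ℝ) : ℂ) * φ (xiPlus ξ σ))) surf := (i3.sub i2).const_mul _
  rw [integral_add i1 i4, integral_const_mul, integral_sub i3 i2, hsym]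
  simp

/-- The total symmetrized collision majorant with angular weight `B`. -/
noncomputable def boundInt (α : ℝ) (B : ℝ → ℝ≥0∞) (φ : R3 → ℂ) (ξ : R3) : ℝ≥0∞ :=
  ∫⁻ σ : S2, B (cosAng ξ σ) * symBound α (fun η => ‖φ η - 1‖ₑ) ξ σ ∂surf

theorem measurable_symKernel_sphere {φ : R3 → ℂ} (h : φ ∈ spaceK) (ξ : R3) :
    Measurable fun σ : S2 => symKernel φ ξ σ :=
  (measurable_symKernel (continuous_of_mem_spaceK h)).comp
    (f := fun σ : S2 => (ξ, (σ : R3))) (by fun_prop)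

theorem integrable_collisionSym (hb : IsCrossSection b) {α : ℝ} {φ : R3 → ℂ} (h : φ ∈ spaceK)
    {ξ : R3} (hfin : boundInt α (bE b) φ ξ < ⊤) :
    Integrable (fun σ : S2 => (b (cosAng ξ σ) : ℂ) * symKernel φ ξ σ) surf := by
  refine ⟨?_, lt_of_le_of_lt (lintegral_mono fun σ => ?_) hfin⟩
  · have h1 := hb.measurable.comp (measurable_cosAng_sphere ξ)
    exact ((Complex.measurable_ofReal.comp h1).mul
      (measurable_symKernel_sphere h ξ)).aestronglyMeasurable
  · rw [enorm_mul, enorm_b hb (cosAng_mem_sphere ξ σ)]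
    gcongr
    exact enorm_symKernel_le h α (by simp)

/-- After symmetrization the integrand is absolutely integrable over the whole sphere, so dominated
convergence identifies the limit. -/
theorem tendsto_collisionAway (hb : IsCrossSection b) {α : ℝ}
    (hfar : ∀ ε ∈ Ioo 0 Real.pi, angInt (bFar b ε) < ⊤) {φ : R3 → ℂ} (h : φ ∈ spaceK)
    {ξ : R3} (hξ : ξ ≠ 0) (hfin : boundInt α (bE b) φ ξ < ⊤) :
    Tendsto (collisionAway b φ ξ) (𝓝[>] 0) (𝓝 (collisionSym b φ ξ)) := by
  have hpi := Real.pi_pos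
  have hev : ∀ᶠ ε in 𝓝[>] (0 : ℝ), collisionSym (bCut b ε) φ ξ = collisionAway b φ ξ ε := by
    filter_upwards [Ioo_mem_nhdsGT hpi] with ε hε
    exact (collisionAway_eq_collisionSym hb (hfar ε hε) h hξ).symm
  refine Tendsto.congr' hev ?_
  unfold collisionSym
  refine tendsto_integral_filter_of_dominated_convergence
    (fun σ : S2 => ‖(b (cosAng ξ σ) : ℂ) * symKernel φ ξ σ‖) (Eventually.of_forall fun ε => ?_)
    (Eventually.of_forall fun ε => ae_of_all _ fun σ => ?_)
    (integrable_collisionSym hb h hfin).norm (ae_of_all _ fun σ => ?_)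
  · have h1 := (measurable_bCut hb ε).comp (measurable_cosAng_sphere ξ)
    exact ((Complex.measurable_ofReal.comp h1).mul
      (measurable_symKernel_sphere h ξ)).aestronglyMeasurable
  · rw [norm_mul, norm_mul, Complex.norm_real, Complex.norm_real]
    gcongr
    exact norm_indicator_le_norm_self _ _
  -- At θ = 0 the cut-offs with small ε > 0 never reach b, but the symmetrized kernel vanishes
  -- there.
  · rcases (cosAng_mem_sphere ξ σ).2.eq_or_lt with h1 | h1
    · simp [symKernel_eq_zero h (by simp) h1]
    · refine tendsto_const_nhds.congr' ?_
      have hc : Tendsto Real.cos (𝓝[>] 0) (𝓝 1) := by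
        have := Real.continuous_cos.tendsto 0
        rw [Real.cos_zero] at this
        exact this.mono_left nhdsWithin_le_nhds
      filter_upwards [hc.eventually (lt_mem_nhds h1)] with ε hε
      rw [bCut, indicator_of_mem (show cosAng ξ σ ∈ Iic (Real.cos ε) from hε.le)]

theorem collision_eq (hb : IsCrossSection b) {α : ℝ}
    (hfar : ∀ ε ∈ Ioo 0 Real.pi, angInt (bFar b ε) < ⊤) {φ : R3 → ℂ} (h : φ ∈ spaceK)
    {ξ : R3} (hξ : ξ ≠ 0) (hfin : boundInt α (bE b) φ ξ < ⊤) :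
    collision b φ ξ = collisionSym b φ ξ :=
  (tendsto_collisionAway hb hfar h hξ hfin).limUnder_eq

theorem enorm_collision_le (hb : IsCrossSection b) {α : ℝ}
    (hfar : ∀ ε ∈ Ioo 0 Real.pi, angInt (bFar b ε) < ⊤) {φ : R3 → ℂ} (h : φ ∈ spaceK)
    {ξ : R3} (hξ : ξ ≠ 0) (hfin : boundInt α (bE b) φ ξ < ⊤) :
    ‖collision b φ ξ‖ₑ ≤ boundInt α (bE b) φ ξ := by
  rw [collision_eq hb hfar h hξ hfin]
  refine (enorm_integral_le_lintegral_enorm _).trans (lintegral_mono fun σ => ?_)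
  rw [enorm_mul, enorm_b hb (cosAng_mem_sphere ξ σ)]
  gcongr
  exact enorm_symKernel_le h α (by simp)

theorem enorm_collision_sub_le (hb : IsCrossSection b) {α : ℝ}
    (hfar : ∀ ε ∈ Ioo 0 Real.pi, angInt (bFar b ε) < ⊤) {φ : R3 → ℂ} (h : φ ∈ spaceK)
    {ξ : R3} (hξ : ξ ≠ 0) (hfin : boundInt α (bE b) φ ξ < ⊤) {ε : ℝ} (hε : ε ∈ Ioo 0 Real.pi) :
    ‖collision b φ ξ - collisionAway b φ ξ ε‖ₑ ≤ boundInt α (bNear b ε) φ ξ := by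
  rw [collision_eq hb hfar h hξ hfin, collisionAway_eq_collisionSym hb (hfar ε hε) h hξ,
    collisionSym, collisionSym, ← integral_sub (integrable_collisionSym hb h hfin)]
  · refine (enorm_integral_le_lintegral_enorm _).trans (lintegral_mono fun σ => ?_)
    rw [← sub_mul, enorm_mul]
    refine mul_le_mul' (le_of_eq ?_) (enorm_symKernel_le h α (by simp))
    by_cases hc : cosAng ξ σ ≤ Real.cos ε
    · rw [bCut, bNear, indicator_of_mem (by exact hc), indicator_of_notMem (by simpa using hc)]
      simp
    · rw [bCut, bNear, indicator_of_notMem (by exact hc), indicator_of_mem (by simpa using hc),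
        Complex.ofReal_zero, sub_zero, enorm_b hb (cosAng_mem_sphere ξ σ)]
  · refine Integrable.mono (integrable_collisionSym hb h hfin) ?_ (ae_of_all _ fun σ => ?_)
    · have h1 := (measurable_bCut hb ε).comp (measurable_cosAng_sphere ξ)
      exact ((Complex.measurable_ofReal.comp h1).mul
        (measurable_symKernel_sphere h ξ)).aestronglyMeasurable
    · rw [norm_mul, norm_mul, Complex.norm_real, Complex.norm_real]
      gcongr
      exact norm_indicator_le_norm_self _ _

/-! ### An integrating factor and a Gronwall inequality. -/

/-- F is only integrable, so w' = F holds merely almost everywhere. The fundamental theorem is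
applied with the true derivative, which exists throughout (0,T), and F replaces it under the
integral. -/
theorem exp_mul_eq_integral {w F : ℝ → ℂ} {w₀ : ℂ} {T : ℝ} (A : ℝ)
    (hF : IntervalIntegrable F volume 0 T) (hc : ContinuousOn w (Icc 0 T))
    (hd : ∀ t ∈ Ioo 0 T, DifferentiableAt ℝ w t)
    (hw : ∀ t ∈ Icc 0 T, w t = w₀ + ∫ τ in (0 : ℝ)..t, F τ) {t : ℝ} (ht : t ∈ Icc 0 T) :
    (Real.exp (A * t) : ℂ) * w t =
      w₀ + ∫ τ in (0 : ℝ)..t, (Real.exp (A * τ) : ℂ) * (F τ + A * w τ) := by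
  have ht0 := ht.1
  have hsub : uIcc 0 t ⊆ uIcc 0 T := by
    rw [uIcc_of_le ht0, uIcc_of_le (ht0.trans ht.2)]
    exact Icc_subset_Icc_right ht.2
  have hFt : IntervalIntegrable F volume 0 t := hF.mono_set hsub
  have hct : ContinuousOn w (Icc 0 t) := hc.mono (Icc_subset_Icc_right ht.2)
  have hexp : ∀ x : ℝ, HasDerivAt (fun s : ℝ => (Real.exp (A * s) : ℂ))
      ((A * Real.exp (A * x) : ℝ) : ℂ) x := fun x => by
    have h1 : HasDerivAt (fun s : ℝ => Real.exp (A * s)) (A * Real.exp (A * x)) x := by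
      simpa [mul_comm] using ((hasDerivAt_id x).const_mul A).exp
    exact h1.ofReal_comp
  have hexpc : Continuous fun s : ℝ => (Real.exp (A * s) : ℂ) := by fun_prop
  have hae : ∀ᵐ x : ℝ, x ∈ uIoc 0 t →
      (Real.exp (A * x) : ℂ) * (F x + A * w x) =
      ((A * Real.exp (A * x) : ℝ) : ℂ) * w x + (Real.exp (A * x) : ℂ) * deriv w x := by
    have hne : ∀ᵐ x : ℝ, x ≠ t := by simp [ae_iff]
    filter_upwards [hFt.ae_hasDerivAt_integral, hne] with x hx hxt hxm
    rw [uIoc_of_le ht0] at hxm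
    have hx' : x ∈ Ioo 0 t := ⟨hxm.1, lt_of_le_of_ne hxm.2 hxt⟩
    have h1 := hx (by rw [uIcc_of_le ht0]; exact Ioo_subset_Icc_self hx') 0
      (by rw [uIcc_of_le ht0]; exact ⟨le_rfl, ht0⟩)
    have h2 : HasDerivAt w (F x) x := by
      refine (h1.const_add w₀).congr_of_eventuallyEq ?_
      filter_upwards [Ioo_mem_nhds hx'.1 hx'.2] with y hy
      exact hw y ⟨hy.1.le, hy.2.le.trans ht.2⟩
    rw [h2.deriv]
    push_cast
    ring
  have hint : IntervalIntegrable (fun x => (Real.exp (A * x) : ℂ) * (F x + A * w x))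
      volume 0 t := by
    refine IntervalIntegrable.continuousOn_mul (hFt.add ?_) hexpc.continuousOn
    exact ((continuousOn_const.mul hct).mono (by rw [uIcc_of_le ht0])).intervalIntegrable
  have hftc := intervalIntegral.integral_eq_sub_of_hasDerivAt_of_le ht0
    (f := fun s => (Real.exp (A * s) : ℂ) * w s)
    (f' := fun x => ((A * Real.exp (A * x) : ℝ) : ℂ) * w x + (Real.exp (A * x) : ℂ) * deriv w x)
    (hexpc.continuousOn.mul hct)
    (fun x hx => (hexp x).mul (hd x ⟨hx.1, hx.2.trans_le ht.2⟩).hasDerivAt)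
    (hint.congr_ae ((ae_restrict_iff' measurableSet_uIoc).2 hae))
  rw [intervalIntegral.integral_congr_ae hae, hftc, hw 0 ⟨le_rfl, ht0.trans ht.2⟩]
  simp

theorem enorm_exp_mul_le {w F : ℝ → ℂ} {w₀ : ℂ} {T : ℝ} (A : ℝ)
    (hF : IntervalIntegrable F volume 0 T) (hc : ContinuousOn w (Icc 0 T))
    (hd : ∀ t ∈ Ioo 0 T, DifferentiableAt ℝ w t)
    (hw : ∀ t ∈ Icc 0 T, w t = w₀ + ∫ τ in (0 : ℝ)..t, F τ) {t : ℝ} (ht : t ∈ Icc 0 T) :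
    ENNReal.ofReal (Real.exp (A * t)) * ‖w t‖ₑ ≤
      ‖w₀‖ₑ + ∫⁻ τ in Ioc 0 t, ENNReal.ofReal (Real.exp (A * τ)) * ‖F τ + A * w τ‖ₑ := by
  have he : ∀ s : ℝ, ENNReal.ofReal (Real.exp (A * s)) = ‖(Real.exp (A * s) : ℂ)‖ₑ := fun s => by
    rw [← ofReal_norm, Complex.norm_real, Real.norm_of_nonneg (Real.exp_pos _).le]
  simp_rw [he, ← enorm_mul]
  rw [exp_mul_eq_integral A hF hc hd hw ht, intervalIntegral.integral_of_le ht.1]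
  exact (enorm_add_le _ _).trans (add_le_add_right (enorm_integral_le_lintegral_enorm _) _)

/-- Iterating the inequality from the crude bound K leaves an error K(lt)^n/n!, which tends to 0; no
regularity of y is needed. The forcing E e^{Aτ} is replaced by E e^{lτ}, so that the claimed bound
plus the error has an explicit derivative. -/
theorem gronwall_lintegral {y : ℝ → ℝ≥0∞} {T A l h₀ E K : ℝ} (hl : 0 ≤ l) (hAl : A ≤ l)
    (hh : 0 ≤ h₀) (hE : 0 ≤ E) (hK : 0 ≤ K) (hyK : ∀ t ∈ Icc 0 T, y t ≤ ENNReal.ofReal K)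
    (hy : ∀ t ∈ Icc 0 T, y t ≤ ENNReal.ofReal h₀ + ∫⁻ τ in Ioc 0 t,
      (ENNReal.ofReal l * y τ + ENNReal.ofReal (E * Real.exp (A * τ)))) {t : ℝ}
    (ht : t ∈ Icc 0 T) :
    y t ≤ ENNReal.ofReal (Real.exp (l * t) * (h₀ + E * t)) := by
  have key : ∀ n : ℕ, ∀ t ∈ Icc 0 T, y t ≤ ENNReal.ofReal
      (Real.exp (l * t) * (h₀ + E * t) + K * ((l * t) ^ n / n.factorial)) := by
    intro n
    induction n with
    | zero =>
      intro t ht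
      refine (hyK t ht).trans (ENNReal.ofReal_le_ofReal ?_)
      have := ht.1
      have : 0 ≤ Real.exp (l * t) * (h₀ + E * t) := by positivity
      simpa using this
    | succ n ih =>
      intro t ht
      have ht0 := ht.1
      set G : ℝ → ℝ := fun τ => Real.exp (l * τ) * (h₀ + E * τ) +
        K * ((l * τ) ^ (n + 1) / (n + 1).factorial) with hG
      set G' : ℝ → ℝ := fun τ => (l * (Real.exp (l * τ) * (h₀ + E * τ) +
        K * ((l * τ) ^ n / n.factorial)) + E * Real.exp (l * τ)) with hG'
      have hd : ∀ τ, HasDerivAt G (G' τ) τ := by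
        intro τ
        have h1 : HasDerivAt (fun τ => Real.exp (l * τ)) (Real.exp (l * τ) * l) τ := by
          simpa using ((hasDerivAt_id τ).const_mul l).exp
        have h2 : HasDerivAt (fun τ => h₀ + E * τ) E τ := by
          simpa using ((hasDerivAt_id τ).const_mul E).const_add h₀
        have h3 : HasDerivAt (fun τ => l * τ) l τ := by
          simpa using (hasDerivAt_id τ).const_mul l
        have h4 := (h1.mul h2).add (((h3.pow (n + 1)).div_const
          ((n + 1).factorial : ℝ)).const_mul K)
        refine h4.congr_deriv ?_
        have : ((n + 1).factorial : ℝ) = (n + 1) * n.factorial := by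
          push_cast [Nat.factorial_succ]; ring
        have h5 : (n.factorial : ℝ) ≠ 0 := by positivity
        simp only [hG', this, Nat.add_sub_cancel]
        field_simp
        push_cast
        ring
      have hcont : Continuous G' := by fun_prop
      have hle : ∀ τ ∈ Ioc 0 t, ENNReal.ofReal l * y τ + ENNReal.ofReal (E * Real.exp (A * τ)) ≤
          ENNReal.ofReal (G' τ) := by
        intro τ hτ
        have hτ0 := hτ.1.le
        have h6 := ih τ ⟨hτ0, hτ.2.trans ht.2⟩
        rw [hG', ENNReal.ofReal_add (by positivity) (by positivity), ENNReal.ofReal_mul hl]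
        gcongr
      calc y t ≤ _ := hy t ht
        _ ≤ ENNReal.ofReal h₀ + ∫⁻ τ in Ioc 0 t, ENNReal.ofReal (G' τ) :=
          add_le_add_right (setLIntegral_mono' measurableSet_Ioc hle) _
        _ = ENNReal.ofReal h₀ + ENNReal.ofReal (G t - G 0) := by
          rw [← intervalIntegral.integral_eq_sub_of_hasDerivAt (fun τ _ => hd τ)
            (hcont.intervalIntegrable _ _), intervalIntegral.integral_of_le ht0,
            ofReal_integral_eq_lintegral_ofReal (hcont.integrableOn_Ioc)]
          filter_upwards [ae_restrict_mem measurableSet_Ioc] with τ hτ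
          have hτ0 := hτ.1.le
          simp only [hG', Pi.zero_apply]
          positivity
        _ = ENNReal.ofReal (G t) := by
          have hG0 : G 0 = h₀ := by simp [hG]
          have hGt : h₀ ≤ G t := by
            have h7 : 1 ≤ Real.exp (l * t) := Real.one_le_exp (by positivity)
            have h8 : h₀ + E * t ≤ Real.exp (l * t) * (h₀ + E * t) :=
              le_mul_of_one_le_left (by positivity) h7
            have h9 : 0 ≤ K * ((l * t) ^ (n + 1) / (n + 1).factorial) := by positivity
            have h10 : 0 ≤ E * t := by positivity
            simp only [hG]
            linarith
          rw [hG0, ← ENNReal.ofReal_add hh (by linarith)]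
          congr 1
          ring
  have hlim : Tendsto (fun n : ℕ => ENNReal.ofReal (Real.exp (l * t) * (h₀ + E * t) +
      K * ((l * t) ^ n / n.factorial))) atTop
      (𝓝 (ENNReal.ofReal (Real.exp (l * t) * (h₀ + E * t)))) := by
    have h1 := ((FloorSemiring.tendsto_pow_div_factorial_atTop (l * t)).const_mul K).const_add
      (Real.exp (l * t) * (h₀ + E * t))
    rw [mul_zero, add_zero] at h1
    exact (ENNReal.continuous_ofReal.tendsto _).comp h1
  exact ge_of_tendsto' hlim fun n => key n t ht

/-! ### Families in time: uniform bounds, measurability and integrability. -/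

theorem normM_sub_le {α : ℝ} {φ ψ χ : R3 → ℂ} (hφ : Measurable φ) (hψ : Measurable ψ) :
    normM α (fun ξ => φ ξ - χ ξ) ≤
      normM α (fun ξ => φ ξ - ψ ξ) + normM α (fun ξ => ψ ξ - χ ξ) := by
  simp only [normM_eq]
  have hw := measurable_wt α
  rw [← lintegral_add_left (by fun_prop)]
  refine lintegral_mono fun ξ => ?_
  rw [← add_mul]
  gcongr
  rw [← sub_add_sub_cancel (φ ξ) (ψ ξ) (χ ξ)]
  exact enorm_add_le _ _

/-- Continuity in the metric bounds the norm near each time, and [0,T] is compact. -/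
theorem exists_normM_bound {α β : ℝ} {φ : R3 → ℝ → ℂ} (h : MemT α β φ) (T : ℝ) :
    ∃ M : ℝ≥0∞, M < ⊤ ∧ ∀ t ∈ Icc 0 T, normM α (fun ξ => φ ξ t - 1) ≤ M := by
  refine isCompact_Icc.induction_on (p := fun s => ∃ M : ℝ≥0∞, M < ⊤ ∧
    ∀ t ∈ s, normM α (fun ξ => φ ξ t - 1) ≤ M) ⟨0, by simp, by simp⟩ ?_ ?_ ?_
  · rintro s t hst ⟨M, hM, h⟩
    exact ⟨M, hM, fun x hx => h x (hst hx)⟩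
  · rintro s t ⟨M, hM, h⟩ ⟨M', hM', h'⟩
    refine ⟨max M M', max_lt hM hM', ?_⟩
    rintro x (hx | hx)
    · exact (h x hx).trans (le_max_left _ _)
    · exact (h' x hx).trans (le_max_right _ _)
  · intro t ht
    have h1 := (h.continuous_dis t ht.1).eventually (gt_mem_nhds zero_lt_one)
    have h2 : ∀ᶠ s in 𝓝[Icc 0 T] t, disM α β (fun ξ => φ ξ s) (fun ξ => φ ξ t) < 1 ∧ 0 ≤ s := by
      refine (Filter.Eventually.filter_mono (nhdsWithin_mono t Icc_subset_Ici_self) h1).and ?_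
      filter_upwards [self_mem_nhdsWithin] with s hs using hs.1
    refine ⟨_, h2, 1 + normM α (fun ξ => φ ξ t - 1), ?_, ?_⟩
    · exact ENNReal.add_lt_top.2 ⟨by simp, (h.mem t ht.1).2⟩
    · rintro s ⟨hs, hs0⟩
      refine (normM_sub_le (continuous_of_mem_spaceK (h.mem s hs0).1).measurable
        (continuous_of_mem_spaceK (h.mem t ht.1).1).measurable).trans ?_
      exact add_le_add_left ((le_self_add).trans hs.le) _

/-- A Carathéodory function: continuous in time, measurable in ξ. Negative times are frozen at 0 to
have a family on all of ℝ. -/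
theorem measurable_uncurry_max {α β : ℝ} {φ : R3 → ℝ → ℂ} (h : MemT α β φ) :
    Measurable (Function.uncurry fun ξ t => φ ξ (max t 0)) := by
  have h1 : Measurable (Function.uncurry fun (t : ℝ) (ξ : R3) => φ ξ (max t 0)) := by
    refine measurable_uncurry_of_continuous_of_measurable
      (u := fun (t : ℝ) (ξ : R3) => φ ξ (max t 0))
      (fun ξ => ?_) (fun t => ?_)
    · exact (h.continuousOn ξ).comp_continuous (by fun_prop) fun t => mem_Ici.2 (le_max_right t 0)
    · exact (continuous_of_mem_spaceK (h.mem _ (le_max_right t 0)).1).measurable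
  exact h1.comp measurable_swap

/-- A jointly measurable family of characteristic functions whose distances to `1` are bounded on
`[0, T]`. -/
structure IsBoundedFamily (α T : ℝ) (M : ℝ≥0∞) (φ : R3 → ℝ → ℂ) : Prop where
  measurable : Measurable (Function.uncurry φ)
  mem : ∀ t, (fun ξ => φ ξ t) ∈ spaceK
  bound : ∀ t ∈ Icc 0 T, normM α (fun ξ => φ ξ t - 1) ≤ M

theorem measurable_boundInt {α T : ℝ} {M : ℝ≥0∞} {φ : R3 → ℝ → ℂ} (h : IsBoundedFamily α T M φ)
    {B : ℝ → ℝ≥0∞} (hB : Measurable B) :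
    Measurable fun q : R3 × ℝ => boundInt α B (fun η => φ η q.2) q.1 := by
  have hg : Measurable fun q : R3 × ℝ => ‖φ q.1 q.2 - 1‖ₑ := (h.measurable.sub_const 1).enorm
  have hi : Measurable fun q : (R3 × ℝ) × S2 => (q.1.1, (q.2 : R3)) := by fun_prop
  have h1 : Measurable fun q : (R3 × ℝ) × S2 => halfSinSq q.1.1 q.2 :=
    (measurable_halfSinSq.comp hi :)
  have h2 : Measurable fun q : (R3 × ℝ) × S2 => xiMinus q.1.1 q.2 :=
    (continuous_xiMinus.measurable.comp hi :)
  have h0 : Measurable fun q : (R3 × ℝ) × S2 => cosAng q.1.1 q.2 := (measurable_cosAng.comp hi :)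
  have ht : Measurable fun q : (R3 × ℝ) × S2 => q.1.2 := by fun_prop
  have hx : Measurable fun q : (R3 × ℝ) × S2 => q.1.1 := by fun_prop
  have h3 : Measurable fun q : (R3 × ℝ) × S2 => ‖φ (xiMinus q.1.1 q.2) q.1.2 - 1‖ₑ :=
    (hg.comp (h2.prodMk ht) :)
  have h4 : Measurable fun q : (R3 × ℝ) × S2 => ‖φ (halfSinSq q.1.1 q.2 • q.1.1) q.1.2 - 1‖ₑ :=
    (hg.comp ((h1.smul hx).prodMk ht) :)
  have h5 : Measurable fun q : (R3 × ℝ) × S2 => ‖φ q.1.1 q.1.2 - 1‖ₑ := (hg.comp measurable_fst :)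
  have h6 := (hB.comp h0).mul (((h3.const_mul 3).add
    ((h1.pow_const (α / 2)).ennreal_ofReal.mul h5)).add
    (((h1.pow_const (-(α / 2))).add_const 3).ennreal_ofReal.mul h4))
  have h7 := h6.lintegral_prod_right' (ν := surf)
  simp only [boundInt, symBound]
  simpa only [Pi.mul_apply, Pi.add_apply, Function.comp_apply] using h7

theorem lintegral_boundInt_le {α T : ℝ} (hα : 0 < α) {M : ℝ≥0∞} {φ : R3 → ℝ → ℂ}
    (h : IsBoundedFamily α T M φ) {B : ℝ → ℝ≥0∞} (hB : Measurable B) {t : ℝ} (ht : t ∈ Icc 0 T) :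
    ∫⁻ ξ, boundInt α B (fun η => φ η t) ξ * wt α ξ ≤ 8 * angMoment α B * M := by
  have hm := (continuous_of_mem_spaceK (h.mem t)).measurable
  refine (lintegral_symBound_le hα hB (g := fun η => ‖φ η t - 1‖ₑ) (by fun_prop)
    (by simp [apply_zero_of_mem_spaceK (h.mem t)])).trans ?_
  exact mul_le_mul' le_rfl (h.bound t ht)

theorem wt_ne_zero (α : ℝ) (ξ : R3) : wt α ξ ≠ 0 := by simp [wt]

/-- By Tonelli the weighted space-time integral of the majorant is finite, so for almost every ξ the
collision term is controlled in L¹ in time. -/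
theorem ae_lintegral_boundInt_lt_top {α T : ℝ} (hα : 0 < α) {M : ℝ≥0∞} (hM : M < ⊤)
    {φ : R3 → ℝ → ℂ} (h : IsBoundedFamily α T M φ) {B : ℝ → ℝ≥0∞} (hB : Measurable B)
    (hfin : angMoment α B < ⊤) :
    ∀ᵐ ξ : R3, ∫⁻ t in Ioc 0 T, boundInt α B (fun η => φ η t) ξ < ⊤ := by
  have hm := measurable_boundInt h hB
  have hw := measurable_wt α
  have h1 : ∫⁻ ξ, (∫⁻ t in Ioc 0 T, boundInt α B (fun η => φ η t) ξ * wt α ξ) < ⊤ := by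
    rw [lintegral_lintegral_swap ((hm.mul (hw.comp measurable_fst)).aemeasurable)]
    calc _ ≤ ∫⁻ t in Ioc 0 T, 8 * angMoment α B * M :=
          setLIntegral_mono' measurableSet_Ioc fun t ht =>
            lintegral_boundInt_le hα h hB (Ioc_subset_Icc_self ht)
      _ < ⊤ := by
        rw [lintegral_const, Measure.restrict_apply MeasurableSet.univ, univ_inter,
          Real.volume_Ioc]
        exact ENNReal.mul_lt_top (ENNReal.mul_lt_top (ENNReal.mul_lt_top (by simp) hfin) hM)
          ENNReal.ofReal_lt_top
  have h2 := ae_lt_top ((hm.mul (hw.comp measurable_fst)).lintegral_prod_right') h1.ne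
  filter_upwards [h2] with ξ hξ
  have hmξ : Measurable fun t => boundInt α B (fun η => φ η t) ξ :=
    (hm.comp (measurable_prodMk_left (x := ξ)) :)
  change ∫⁻ t in Ioc 0 T, boundInt α B (fun η => φ η t) ξ * wt α ξ < ⊤ at hξ
  rw [lintegral_mul_const _ hmξ] at hξ
  by_contra htop
  rw [not_lt, top_le_iff] at htop
  rw [htop, ENNReal.top_mul (wt_ne_zero α ξ)] at hξ
  exact lt_irrefl _ hξ

theorem stronglyMeasurable_collisionSym (hb : IsCrossSection b) {α T : ℝ} {M : ℝ≥0∞}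
    {φ : R3 → ℝ → ℂ} (h : IsBoundedFamily α T M φ) (ξ : R3) :
    StronglyMeasurable fun t => collisionSym b (fun η => φ η t) ξ := by
  have ht : Measurable fun q : ℝ × S2 => q.1 := by fun_prop
  have hi : Measurable fun q : ℝ × S2 => (ξ, (q.2 : R3)) := by fun_prop
  have h0 : Measurable fun q : ℝ × S2 => (b (cosAng ξ q.2) : ℂ) :=
    (Complex.measurable_ofReal.comp (hb.measurable.comp (measurable_cosAng.comp hi)) :)
  have h1 : Measurable fun q : ℝ × S2 => φ (xiPlus ξ q.2) q.1 :=
    (h.measurable.comp ((continuous_xiPlus.measurable.comp hi).prodMk ht) :)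
  have h2 : Measurable fun q : ℝ × S2 => φ (xiMinus ξ q.2) q.1 :=
    (h.measurable.comp ((continuous_xiMinus.measurable.comp hi).prodMk ht) :)
  have h3 : Measurable fun q : ℝ × S2 => φ (xiMirror ξ q.2) q.1 :=
    (h.measurable.comp ((measurable_xiMirror.comp hi).prodMk ht) :)
  have h4 : Measurable fun q : ℝ × S2 => φ ξ q.1 :=
    (h.measurable.comp (measurable_const.prodMk ht) :)
  have h5 := h0.mul ((h1.mul (h2.sub_const 1)).add (((h1.add h3).const_mul (1 / 2 : ℂ)).sub h4))
  have h6 := h5.stronglyMeasurable.integral_prod_right' (ν := surf)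
  simp only [collisionSym, symKernel]
  simpa only [Pi.mul_apply, Pi.add_apply, Pi.sub_apply] using h6

theorem ae_boundInt_lt_top {α T : ℝ} {M : ℝ≥0∞} {φ : R3 → ℝ → ℂ} (h : IsBoundedFamily α T M φ)
    {B : ℝ → ℝ≥0∞} (hB : Measurable B) {ξ : R3}
    (hfin : ∫⁻ t in Ioc 0 T, boundInt α B (fun η => φ η t) ξ < ⊤) :
    ∀ᵐ t ∂(volume.restrict (Ioc 0 T)), boundInt α B (fun η => φ η t) ξ < ⊤ := by
  have hm := (measurable_boundInt h hB).comp (measurable_prodMk_left (x := ξ))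
  exact ae_lt_top hm hfin.ne

/-- The limit defining the collision operator inherits measurability in time from the symmetrized
integral, with which it agrees at almost every time. -/
theorem intervalIntegrable_collision (hb : IsCrossSection b) {α T : ℝ} (hT : 0 ≤ T) {M : ℝ≥0∞}
    (hfar : ∀ ε ∈ Ioo 0 Real.pi, angInt (bFar b ε) < ⊤) {φ : R3 → ℝ → ℂ}
    (h : IsBoundedFamily α T M φ) {ξ : R3} (hξ : ξ ≠ 0)
    (hfin : ∫⁻ t in Ioc 0 T, boundInt α (bE b) (fun η => φ η t) ξ < ⊤) :
    IntervalIntegrable (fun t => collision b (fun η => φ η t) ξ) volume 0 T := by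
  rw [intervalIntegrable_iff_integrableOn_Ioc_of_le hT]
  have hae := ae_boundInt_lt_top h (measurable_bE hb) hfin
  refine ⟨?_, lt_of_le_of_lt (lintegral_mono_ae ?_) hfin⟩
  · refine (stronglyMeasurable_collisionSym hb h ξ).aestronglyMeasurable.congr ?_
    filter_upwards [hae] with t ht
    exact (collision_eq hb hfar (h.mem t) hξ ht).symm
  · filter_upwards [hae] with t ht
    exact enorm_collision_le hb hfar (h.mem t) hξ ht

/-! ### The weighted difference and the gain term. -/

theorem rpow_norm_le {p : ℝ} (hp2 : p ≤ 2) {ξ σ : R3} (hσ : ‖σ‖ = 1) :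
    ‖ξ‖ ^ p ≤ ‖xiPlus ξ σ‖ ^ p + ‖xiMinus ξ σ‖ ^ p := by
  have hx := cosAng_mem (ξ := ξ) hσ
  have h0 : ∀ r : R3, ‖r‖ ^ p = (‖r‖ ^ 2) ^ (p / 2) := fun r =>
    (sq_rpow_half (norm_nonneg r) p).symm
  have hx1 : 0 ≤ (1 + cosAng ξ σ) / 2 := by linarith [hx.1]
  have hx2 : 0 ≤ (1 - cosAng ξ σ) / 2 := by linarith [hx.2]
  rw [h0, h0, h0, norm_xiPlus_sq' hσ, norm_xiMinus_sq' hσ, Real.mul_rpow (by positivity) hx1,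
    Real.mul_rpow (by positivity) hx2, ← mul_add]
  exact le_mul_of_one_le_right (by positivity) (one_le_rpow_add_rpow hx hp2)

/-- The exponentially weighted difference of two families. -/
noncomputable def wDiff (δ p : ℝ) (φ ψ : R3 → ℝ → ℂ) (ξ : R3) (t : ℝ) : ℂ :=
  (Real.exp (δ * ‖ξ‖ ^ p * t) : ℂ) * (φ ξ t - ψ ξ t)

theorem enorm_ofReal_exp (x : ℝ) : ‖(Real.exp x : ℂ)‖ₑ = ENNReal.ofReal (Real.exp x) := by
  rw [← ofReal_norm, Complex.norm_real, Real.norm_of_nonneg (Real.exp_pos _).le]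

/-- The weight at ξ is at most the product of those at ξ⁺ and ξ⁻. In φφ − ψψ = (φ − ψ)φ + ψ(φ − ψ)
one weight goes to the difference, the other is absorbed by the decay bound. -/
theorem enorm_product_diff_le {δ p : ℝ} (hδ : 0 ≤ δ) (hp2 : p ≤ 2)
    {φ ψ : R3 → ℝ → ℂ} {t : ℝ} (ht : 0 ≤ t)
    (hφ : ∀ ξ, Real.exp (δ * ‖ξ‖ ^ p * t) * ‖φ ξ t‖ ≤ 1)
    (hψ : ∀ ξ, Real.exp (δ * ‖ξ‖ ^ p * t) * ‖ψ ξ t‖ ≤ 1) {ξ σ : R3} (hσ : ‖σ‖ = 1) :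
    ENNReal.ofReal (Real.exp (δ * ‖ξ‖ ^ p * t)) *
      ‖φ (xiPlus ξ σ) t * φ (xiMinus ξ σ) t - ψ (xiPlus ξ σ) t * ψ (xiMinus ξ σ) t‖ₑ ≤
    ‖wDiff δ p φ ψ (xiPlus ξ σ) t‖ₑ + ‖wDiff δ p φ ψ (xiMinus ξ σ) t‖ₑ := by
  set a := xiPlus ξ σ
  set c := xiMinus ξ σ
  have hexp : Real.exp (δ * ‖ξ‖ ^ p * t) ≤
      Real.exp (δ * ‖a‖ ^ p * t) * Real.exp (δ * ‖c‖ ^ p * t) := by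
    rw [← Real.exp_add]
    apply Real.exp_le_exp.2
    rw [← add_mul, ← mul_add]
    gcongr
    exact rpow_norm_le hp2 hσ
  have h1 : ‖φ a t * φ c t - ψ a t * ψ c t‖ ≤ ‖φ a t - ψ a t‖ * ‖φ c t‖ +
      ‖ψ a t‖ * ‖φ c t - ψ c t‖ := by
    rw [← norm_mul, ← norm_mul]
    refine le_trans (le_of_eq ?_) (norm_add_le _ _)
    congr 1
    ring
  have hreal : Real.exp (δ * ‖ξ‖ ^ p * t) * ‖φ a t * φ c t - ψ a t * ψ c t‖ ≤
      Real.exp (δ * ‖a‖ ^ p * t) * ‖φ a t - ψ a t‖ +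
      Real.exp (δ * ‖c‖ ^ p * t) * ‖φ c t - ψ c t‖ := by
    have ea := Real.exp_pos (δ * ‖a‖ ^ p * t)
    have ec := Real.exp_pos (δ * ‖c‖ ^ p * t)
    calc _ ≤ (Real.exp (δ * ‖a‖ ^ p * t) * Real.exp (δ * ‖c‖ ^ p * t)) *
          (‖φ a t - ψ a t‖ * ‖φ c t‖ + ‖ψ a t‖ * ‖φ c t - ψ c t‖) := by gcongr
      _ = (Real.exp (δ * ‖a‖ ^ p * t) * ‖φ a t - ψ a t‖) *
            (Real.exp (δ * ‖c‖ ^ p * t) * ‖φ c t‖) +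
          (Real.exp (δ * ‖a‖ ^ p * t) * ‖ψ a t‖) *
            (Real.exp (δ * ‖c‖ ^ p * t) * ‖φ c t - ψ c t‖) := by ring
      _ ≤ _ := by
        refine add_le_add (mul_le_of_le_one_right (by positivity) (hφ c))
          (mul_le_of_le_one_left (by positivity) (hψ a))
  have h2 := ENNReal.ofReal_le_ofReal hreal
  rw [ENNReal.ofReal_mul (Real.exp_pos _).le, ENNReal.ofReal_add (by positivity) (by positivity),
    ENNReal.ofReal_mul (Real.exp_pos _).le, ENNReal.ofReal_mul (Real.exp_pos _).le, ofReal_norm,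
    ofReal_norm, ofReal_norm] at h2
  simpa only [wDiff, enorm_mul, enorm_ofReal_exp] using h2

/-- The loss-compensated evolution of the weighted difference is controlled by the gain of the
cut-off operator and by the grazing remainders. -/
theorem enorm_evolution_le (hb : IsCrossSection b) {α : ℝ}
    (hfar : ∀ ε ∈ Ioo 0 Real.pi, angInt (bFar b ε) < ⊤) {δ p : ℝ} (hδ : 0 ≤ δ)
    (hp2 : p ≤ 2) {φ ψ : R3 → ℝ → ℂ} {t : ℝ} (ht : 0 ≤ t)
    (hφK : (fun ξ => φ ξ t) ∈ spaceK) (hψK : (fun ξ => ψ ξ t) ∈ spaceK)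
    (hφ : ∀ ξ, Real.exp (δ * ‖ξ‖ ^ p * t) * ‖φ ξ t‖ ≤ 1)
    (hψ : ∀ ξ, Real.exp (δ * ‖ξ‖ ^ p * t) * ‖ψ ξ t‖ ≤ 1) {ξ : R3} (hξ : ξ ≠ 0)
    (hφf : boundInt α (bE b) (fun η => φ η t) ξ < ⊤)
    (hψf : boundInt α (bE b) (fun η => ψ η t) ξ < ⊤) {ε : ℝ} (hε : ε ∈ Ioo 0 Real.pi) :
    ‖(Real.exp (δ * ‖ξ‖ ^ p * t) : ℂ) *
        (collision b (fun η => φ η t) ξ - collision b (fun η => ψ η t) ξ) +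
      ((angInt (bFar b ε)).toReal : ℂ) * wDiff δ p φ ψ ξ t‖ₑ ≤
    ∫⁻ σ : S2, bFar b ε (cosAng ξ σ) * (‖wDiff δ p φ ψ (xiPlus ξ σ) t‖ₑ +
        ‖wDiff δ p φ ψ (xiMinus ξ σ) t‖ₑ) ∂surf +
      ENNReal.ofReal (Real.exp (δ * ‖ξ‖ ^ p * t)) *
        (boundInt α (bNear b ε) (fun η => φ η t) ξ +
          boundInt α (bNear b ε) (fun η => ψ η t) ξ) := by
  have hfin := hfar ε hε
  set e : ℂ := (Real.exp (δ * ‖ξ‖ ^ p * t) : ℂ) with he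
  have hee : ‖e‖ₑ = ENNReal.ofReal (Real.exp (δ * ‖ξ‖ ^ p * t)) := enorm_ofReal_exp _
  set A : ℂ := ((angInt (bFar b ε)).toReal : ℂ) with hA
  set Cφ := collision b (fun η => φ η t) ξ
  set Cψ := collision b (fun η => ψ η t) ξ
  have g1 := collisionAway_eq_gain_sub hb hfin hφK hξ
  have g2 := collisionAway_eq_gain_sub hb hfin hψK hξ
  have r1 := enorm_collision_sub_le hb hfar hφK hξ hφf hε
  have r2 := enorm_collision_sub_le hb hfar hψK hξ hψf hε
  set Kφ := collisionAway b (fun η => φ η t) ξ ε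
  set Kψ := collisionAway b (fun η => ψ η t) ξ ε
  have hprod : ∀ {χ : R3 → ℂ}, χ ∈ spaceK → Integrable (fun σ : S2 =>
      ((bCut b ε (cosAng ξ σ) : ℝ) : ℂ) * (χ (xiPlus ξ σ) * χ (xiMinus ξ σ))) surf := by
    intro χ hχ
    refine integrable_bCut_mul (f := fun σ => χ (xiPlus ξ σ) * χ (xiMinus ξ σ)) (C := 1) hb hfin hξ
      ((measurable_comp_xiPlus hχ ξ).mul (measurable_comp_xiMinus hχ ξ)) fun σ => ?_
    rw [norm_mul]
    exact mul_le_one₀ (norm_le_one_of_mem_spaceK hχ _) (norm_nonneg _)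
      (norm_le_one_of_mem_spaceK hχ _)
  -- Insert the cut-off operators: their loss terms −A φ and −A ψ cancel A w, leaving the gain
  -- difference and the grazing remainders.
  have hid : e * (Cφ - Cψ) + A * wDiff δ p φ ψ ξ t =
      e * (∫ σ : S2, ((bCut b ε (cosAng ξ σ) : ℝ) : ℂ) *
          (φ (xiPlus ξ σ) t * φ (xiMinus ξ σ) t) ∂surf -
        ∫ σ : S2, ((bCut b ε (cosAng ξ σ) : ℝ) : ℂ) *
          (ψ (xiPlus ξ σ) t * ψ (xiMinus ξ σ) t) ∂surf) +
      e * ((Cφ - Kφ) - (Cψ - Kψ)) := by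
    rw [g1, g2, wDiff, ← he]
    ring
  rw [hid]
  refine (enorm_add_le _ _).trans (add_le_add ?_ ?_)
  · rw [← integral_sub (hprod hφK) (hprod hψK), enorm_mul, hee]
    refine (mul_le_mul_right (enorm_integral_le_lintegral_enorm _) _).trans ?_
    rw [← lintegral_const_mul' _ _ ENNReal.ofReal_ne_top]
    refine lintegral_mono fun σ => ?_
    rw [← mul_sub, enorm_mul, enorm_bCut hb ε (cosAng_mem_sphere ξ σ), mul_left_comm]
    gcongr
    exact enorm_product_diff_le hδ hp2 ht hφ hψ (by simp)
  · rw [enorm_mul, hee]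
    gcongr
    exact enorm_sub_le.trans (add_le_add r1 r2)

theorem measurable_wDiff {δ p : ℝ} {φ ψ : R3 → ℝ → ℂ} (hφ : Measurable (Function.uncurry φ))
    (hψ : Measurable (Function.uncurry ψ)) :
    Measurable fun q : R3 × ℝ => wDiff δ p φ ψ q.1 q.2 := by
  have h1 : Measurable fun q : R3 × ℝ => (Real.exp (δ * ‖q.1‖ ^ p * q.2) : ℂ) := by fun_prop
  exact (h1.mul (hφ.sub hψ) :)

/-- The gain term of the cut-off operator, acting on the weighted difference. -/
noncomputable def gainInt (B : ℝ → ℝ≥0∞) (g : R3 → ℝ≥0∞) (ξ : R3) : ℝ≥0∞ :=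
  ∫⁻ σ : S2, B (cosAng ξ σ) * (g (xiPlus ξ σ) + g (xiMinus ξ σ)) ∂surf

theorem measurable_gainInt {B : ℝ → ℝ≥0∞} (hB : Measurable B) {g : R3 → ℝ → ℝ≥0∞}
    (hg : Measurable (Function.uncurry g)) :
    Measurable fun q : R3 × ℝ => gainInt B (fun η => g η q.2) q.1 := by
  have hi : Measurable fun q : (R3 × ℝ) × S2 => (q.1.1, (q.2 : R3)) := by fun_prop
  have ht : Measurable fun q : (R3 × ℝ) × S2 => q.1.2 := by fun_prop
  have h0 : Measurable fun q : (R3 × ℝ) × S2 => B (cosAng q.1.1 q.2) :=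
    (hB.comp (measurable_cosAng.comp hi) :)
  have h1 : Measurable fun q : (R3 × ℝ) × S2 => g (xiPlus q.1.1 q.2) q.1.2 :=
    (hg.comp ((continuous_xiPlus.measurable.comp hi).prodMk ht) :)
  have h2 : Measurable fun q : (R3 × ℝ) × S2 => g (xiMinus q.1.1 q.2) q.1.2 :=
    (hg.comp ((continuous_xiMinus.measurable.comp hi).prodMk ht) :)
  exact ((h0.mul (h1.add h2)).lintegral_prod_right' (ν := surf) :)

theorem lintegral_gainInt {α : ℝ} {B : ℝ → ℝ≥0∞} (hB : Measurable B) {g : R3 → ℝ≥0∞}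
    (hg : Measurable g) (hg0 : g 0 = 0) :
    ∫⁻ ξ, gainInt B g ξ * wt α ξ =
      (angInt (fun x => B x * ENNReal.ofReal (((1 + x) / 2) ^ (α / 2))) +
        angInt (fun x => B x * ENNReal.ofReal (((1 - x) / 2) ^ (α / 2)))) *
        ∫⁻ ξ, g ξ * wt α ξ := by
  have hw := measurable_wt α
  have hi : Measurable fun q : R3 × S2 => (q.1, (q.2 : R3)) := by fun_prop
  have h0 : Measurable fun q : R3 × S2 => B (cosAng q.1 q.2) :=
    (hB.comp (measurable_cosAng.comp hi) :)
  have h1 : Measurable fun q : R3 × S2 => g (xiPlus q.1 q.2) :=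
    (hg.comp (continuous_xiPlus.measurable.comp hi) :)
  have h2 : Measurable fun q : R3 × S2 => B (cosAng q.1 q.2) * g (xiPlus q.1 q.2) := h0.mul h1
  have h3 : Measurable fun ξ : R3 =>
      (∫⁻ σ : S2, B (cosAng ξ σ) * g (xiPlus ξ σ) ∂surf) * wt α ξ :=
    (h2.lintegral_prod_right').mul hw
  rw [add_mul, ← lintegral_xiPlus hB hg hg0, ← lintegral_xiMinus hB hg hg0,
    ← lintegral_add_left h3]
  refine lintegral_congr fun ξ => ?_
  have h4 : Measurable fun σ : S2 => B (cosAng ξ σ) * g (xiPlus ξ σ) :=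
    (h2.comp (measurable_prodMk_left (x := ξ)) :)
  rw [gainInt, ← add_mul, ← lintegral_add_left h4]
  simp_rw [mul_add]

/-- Since |ξ^±| ≤ |ξ|, the gain on the ball only sees g on the ball, so the global identity applies
to g truncated to it. -/
theorem setLIntegral_gainInt_le {α R : ℝ} {B : ℝ → ℝ≥0∞} (hB : Measurable B) {g : R3 → ℝ≥0∞}
    (hg : Measurable g) (hg0 : g 0 = 0) :
    ∫⁻ ξ in Metric.closedBall 0 R, gainInt B g ξ * wt α ξ ≤
      (angInt (fun x => B x * ENNReal.ofReal (((1 + x) / 2) ^ (α / 2))) +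
        angInt (fun x => B x * ENNReal.ofReal (((1 - x) / 2) ^ (α / 2)))) *
        ∫⁻ ξ in Metric.closedBall 0 R, g ξ * wt α ξ := by
  have hs : MeasurableSet (Metric.closedBall (0 : R3) R) := measurableSet_closedBall
  set gR : R3 → ℝ≥0∞ := (Metric.closedBall (0 : R3) R).indicator g with hgR
  have h1 : ∫⁻ ξ in Metric.closedBall 0 R, g ξ * wt α ξ = ∫⁻ ξ, gR ξ * wt α ξ := by
    rw [← lintegral_indicator hs]
    simp_rw [hgR, indicator_mul_left]
  rw [h1, ← lintegral_gainInt hB (hg.indicator hs) (by simp [hg0])]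
  refine le_trans (setLIntegral_mono' hs fun ξ hξ => ?_) (setLIntegral_le_lintegral _ _)
  have hξ' : ‖ξ‖ ≤ R := by simpa using hξ
  refine mul_le_mul_left (lintegral_mono fun σ => ?_) _
  have hp : xiPlus ξ σ ∈ Metric.closedBall (0 : R3) R := by
    simpa using (norm_xiPlus_le (by simp)).trans hξ'
  have hm : xiMinus ξ σ ∈ Metric.closedBall (0 : R3) R := by
    simpa using (norm_xiMinus_le (by simp)).trans hξ'
  rw [indicator_of_mem hp, indicator_of_mem hm]

/-! ### The stability estimate on balls. -/

/-- The data of a solution on `[0, T]` used in the stability estimate. -/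
structure IsSolutionFamily (b : ℝ → ℝ) (δ p α T : ℝ) (M : ℝ≥0∞) (φ₀ : R3 → ℂ)
    (φ : R3 → ℝ → ℂ) : Prop extends IsBoundedFamily α T M φ where
  decay : ∀ t : ℝ, 0 ≤ t → ∀ ξ, Real.exp (δ * ‖ξ‖ ^ p * t) * ‖φ ξ t‖ ≤ 1
  continuousOn : ∀ ξ, ContinuousOn (φ ξ) (Icc 0 T)
  differentiableAt : ∀ ξ, ∀ t ∈ Ioo 0 T, DifferentiableAt ℝ (φ ξ) t
  equation : ∀ ξ, ∀ t ∈ Icc 0 T, φ ξ t = (Real.exp (-(δ * ‖ξ‖ ^ p * t)) : ℂ) * φ₀ ξ +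
      ∫ τ in (0 : ℝ)..t, (Real.exp (-(δ * ‖ξ‖ ^ p * (t - τ))) : ℂ) *
        collision b (fun η => φ η τ) ξ

theorem IsSolutionFamily.exp_mul_eq {δ p α T : ℝ} {M : ℝ≥0∞} {φ₀ : R3 → ℂ} {φ : R3 → ℝ → ℂ}
    (h : IsSolutionFamily b δ p α T M φ₀ φ) (ξ : R3) {t : ℝ} (ht : t ∈ Icc 0 T) :
    (Real.exp (δ * ‖ξ‖ ^ p * t) : ℂ) * φ ξ t = φ₀ ξ + ∫ τ in (0 : ℝ)..t,
      (Real.exp (δ * ‖ξ‖ ^ p * τ) : ℂ) * collision b (fun η => φ η τ) ξ := by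
  have he : ∀ x y : ℝ, (Real.exp x : ℂ) * (Real.exp y : ℂ) = (Real.exp (x + y) : ℂ) := by
    intro x y; rw [Real.exp_add]; push_cast; rfl
  rw [h.equation ξ t ht, mul_add, ← mul_assoc, he, ← intervalIntegral.integral_const_mul]
  congr 1
  · simp
  · congr 1
    ext τ
    rw [← mul_assoc, he]
    congr 4
    ring

theorem wDiff_eq_integral (hb : IsCrossSection b)
    (hfar : ∀ ε ∈ Ioo 0 Real.pi, angInt (bFar b ε) < ⊤) {δ p α T : ℝ} (hT : 0 ≤ T) {M : ℝ≥0∞}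
    {φ₀ ψ₀ : R3 → ℂ} {φ ψ : R3 → ℝ → ℂ} (hφ : IsSolutionFamily b δ p α T M φ₀ φ)
    (hψ : IsSolutionFamily b δ p α T M ψ₀ ψ) {ξ : R3} (hξ : ξ ≠ 0)
    (hφf : ∫⁻ t in Ioc 0 T, boundInt α (bE b) (fun η => φ η t) ξ < ⊤)
    (hψf : ∫⁻ t in Ioc 0 T, boundInt α (bE b) (fun η => ψ η t) ξ < ⊤) :
    IntervalIntegrable (fun τ => (Real.exp (δ * ‖ξ‖ ^ p * τ) : ℂ) *
      (collision b (fun η => φ η τ) ξ - collision b (fun η => ψ η τ) ξ)) volume 0 T ∧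
    ∀ t ∈ Icc 0 T, wDiff δ p φ ψ ξ t = (φ₀ ξ - ψ₀ ξ) + ∫ τ in (0 : ℝ)..t,
      (Real.exp (δ * ‖ξ‖ ^ p * τ) : ℂ) *
        (collision b (fun η => φ η τ) ξ - collision b (fun η => ψ η τ) ξ) := by
  have hec : Continuous fun τ : ℝ => (Real.exp (δ * ‖ξ‖ ^ p * τ) : ℂ) := by fun_prop
  have i1 := (intervalIntegrable_collision hb hT hfar hφ.toIsBoundedFamily hξ
    hφf).continuousOn_mul hec.continuousOn
  have i2 := (intervalIntegrable_collision hb hT hfar hψ.toIsBoundedFamily hξ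
    hψf).continuousOn_mul hec.continuousOn
  constructor
  · simpa only [mul_sub] using i1.sub i2
  · intro t ht
    have hsub : uIcc 0 t ⊆ uIcc 0 T := by
      rw [uIcc_of_le ht.1, uIcc_of_le hT]
      exact Icc_subset_Icc_right ht.2
    simp only [mul_sub, wDiff]
    rw [intervalIntegral.integral_sub (i1.mono_set hsub) (i2.mono_set hsub), hφ.exp_mul_eq ξ ht,
      hψ.exp_mul_eq ξ ht]
    ring

theorem enorm_wDiff_le (hb : IsCrossSection b)
    (hfar : ∀ ε ∈ Ioo 0 Real.pi, angInt (bFar b ε) < ⊤) {δ p α T R : ℝ} (hδ : 0 ≤ δ)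
    (hp : 0 < p) (hp2 : p ≤ 2) {M : ℝ≥0∞} {φ₀ ψ₀ : R3 → ℂ} {φ ψ : R3 → ℝ → ℂ}
    (hφ : IsSolutionFamily b δ p α T M φ₀ φ) (hψ : IsSolutionFamily b δ p α T M ψ₀ ψ)
    {ξ : R3} (hξ : ξ ≠ 0) (hξR : ‖ξ‖ ≤ R)
    (hφf : ∫⁻ t in Ioc 0 T, boundInt α (bE b) (fun η => φ η t) ξ < ⊤)
    (hψf : ∫⁻ t in Ioc 0 T, boundInt α (bE b) (fun η => ψ η t) ξ < ⊤)
    {ε : ℝ} (hε : ε ∈ Ioo 0 Real.pi) {t : ℝ} (ht : t ∈ Icc 0 T) :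
    ENNReal.ofReal (Real.exp ((angInt (bFar b ε)).toReal * t)) * ‖wDiff δ p φ ψ ξ t‖ₑ ≤
      ‖φ₀ ξ - ψ₀ ξ‖ₑ + ∫⁻ τ in Ioc 0 t,
        ENNReal.ofReal (Real.exp ((angInt (bFar b ε)).toReal * τ)) *
          (gainInt (bFar b ε) (fun η => ‖wDiff δ p φ ψ η τ‖ₑ) ξ +
          ENNReal.ofReal (Real.exp (δ * R ^ p * T)) *
            (boundInt α (bNear b ε) (fun η => φ η τ) ξ +
              boundInt α (bNear b ε) (fun η => ψ η τ) ξ)) := by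
  have hT : 0 ≤ T := ht.1.trans ht.2
  obtain ⟨hi, heq⟩ := wDiff_eq_integral hb hfar hT hφ hψ hξ hφf hψf
  have hec : Continuous fun τ : ℝ => (Real.exp (δ * ‖ξ‖ ^ p * τ) : ℂ) := by fun_prop
  have hed : ∀ τ, DifferentiableAt ℝ (fun τ : ℝ => (Real.exp (δ * ‖ξ‖ ^ p * τ) : ℂ)) τ := by
    intro τ
    have h1 : DifferentiableAt ℝ (fun τ : ℝ => Real.exp (δ * ‖ξ‖ ^ p * τ)) τ := by fun_prop
    exact h1.hasDerivAt.ofReal_comp.differentiableAt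
  refine (enorm_exp_mul_le (w := wDiff δ p φ ψ ξ) (angInt (bFar b ε)).toReal hi
    (hec.continuousOn.mul ((hφ.continuousOn ξ).sub (hψ.continuousOn ξ)))
    (fun τ hτ => (hed τ).mul ((hφ.differentiableAt ξ τ hτ).sub (hψ.differentiableAt ξ τ hτ)))
    heq ht).trans ?_
  refine add_le_add_right (lintegral_mono_ae ?_) _
  have hsub : Ioc 0 t ⊆ Ioc 0 T := Ioc_subset_Ioc_right ht.2
  have a1 := ae_restrict_of_ae_restrict_of_subset hsub
    (ae_boundInt_lt_top hφ.toIsBoundedFamily (measurable_bE hb) hφf)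
  have a2 := ae_restrict_of_ae_restrict_of_subset hsub
    (ae_boundInt_lt_top hψ.toIsBoundedFamily (measurable_bE hb) hψf)
  filter_upwards [a1, a2, ae_restrict_mem measurableSet_Ioc] with τ h1 h2 hτ
  have hτ0 := hτ.1.le
  have hmain := enorm_evolution_le hb hfar hδ hp2 hτ0 (hφ.mem τ) (hψ.mem τ) (hφ.decay τ hτ0)
    (hψ.decay τ hτ0) hξ h1 h2 hε
  refine mul_le_mul_right (hmain.trans ?_) _
  refine add_le_add_right (mul_le_mul_left (ENNReal.ofReal_le_ofReal (Real.exp_le_exp.2 ?_)) _) _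
  have hτT : τ ≤ T := hτ.2.trans ht.2
  have hR : 0 ≤ R := (norm_nonneg _).trans hξR
  gcongr

/-- The a priori finiteness that Gronwall needs; this is where a bounded ball is indispensable, as
the weight is bounded only there. -/
theorem setLIntegral_enorm_wDiff_le {δ p α T R : ℝ} (hδ : 0 ≤ δ) (hp : 0 < p) {M : ℝ≥0∞}
    {φ ψ : R3 → ℝ → ℂ} (hφ : IsBoundedFamily α T M φ) (hψ : IsBoundedFamily α T M ψ) {t : ℝ}
    (ht : t ∈ Icc 0 T) :
    ∫⁻ ξ in Metric.closedBall 0 R, ‖wDiff δ p φ ψ ξ t‖ₑ * wt α ξ ≤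
      ENNReal.ofReal (Real.exp (δ * R ^ p * T)) * (M + M) := by
  have hw := measurable_wt α
  have hm := (continuous_of_mem_spaceK (hφ.mem t)).measurable
  calc _ ≤ ∫⁻ ξ in Metric.closedBall 0 R, ENNReal.ofReal (Real.exp (δ * R ^ p * T)) *
        (‖φ ξ t - 1‖ₑ * wt α ξ + ‖ψ ξ t - 1‖ₑ * wt α ξ) := by
        refine setLIntegral_mono' measurableSet_closedBall fun ξ hξ => ?_
        have hξ' : ‖ξ‖ ≤ R := by simpa using hξ
        rw [wDiff, enorm_mul, enorm_ofReal_exp, mul_assoc, ← add_mul]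
        refine mul_le_mul' (ENNReal.ofReal_le_ofReal (Real.exp_le_exp.2 ?_))
          (mul_le_mul_left ?_ _)
        · have := ht.1
          have := ht.2
          have hR : 0 ≤ R := (norm_nonneg _).trans hξ'
          gcongr
        · rw [← sub_sub_sub_cancel_right _ _ (1 : ℂ)]
          exact enorm_sub_le
    _ ≤ ∫⁻ ξ, ENNReal.ofReal (Real.exp (δ * R ^ p * T)) *
        (‖φ ξ t - 1‖ₑ * wt α ξ + ‖ψ ξ t - 1‖ₑ * wt α ξ) := setLIntegral_le_lintegral _ _
    _ ≤ _ := by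
        rw [lintegral_const_mul' _ _ ENNReal.ofReal_ne_top, lintegral_add_left (by fun_prop)]
        gcongr
        · exact hφ.bound t ht
        · exact hψ.bound t ht

theorem ball_estimate_cutoff (hb : IsCrossSection b) {α₀ α : ℝ} (hα₀ : 0 < α₀) (h : α₀ ≤ α)
    (hα2 : α ≤ 2) (hint : WeaklyIntegrable b α₀) {δ p T R : ℝ} (hδ : 0 ≤ δ) (hp : 0 < p)
    (hp2 : p ≤ 2) (hT : 0 ≤ T) {M : ℝ≥0∞} (hM : M < ⊤) {φ₀ ψ₀ : R3 → ℂ} {φ ψ : R3 → ℝ → ℂ}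
    (hφ : IsSolutionFamily b δ p α T M φ₀ φ) (hψ : IsSolutionFamily b δ p α T M ψ₀ ψ)
    {ε : ℝ} (hε : ε ∈ Ioo 0 Real.pi) :
    ∫⁻ ξ in Metric.closedBall 0 R, ‖wDiff δ p φ ψ ξ T‖ₑ * wt α ξ ≤
      ENNReal.ofReal (Real.exp (lambdaConst b α * T)) *
        ((∫⁻ ξ in Metric.closedBall 0 R, ‖φ₀ ξ - ψ₀ ξ‖ₑ * wt α ξ) +
          (ENNReal.ofReal (Real.exp (δ * R ^ p * T)) *
            (16 * M * angMoment α (bNear b ε))) * ENNReal.ofReal T) := by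
  have hα : 0 < α := hα₀.trans_le h
  have hfin := angMoment_bE_lt_top hb hα₀ h hint
  have hfar : ∀ ε ∈ Ioo 0 Real.pi, angInt (bFar b ε) < ⊤ := fun ε hε =>
    angInt_bFar_lt_top hb hα hfin hε
  have hlam := (lambdaConst_nonneg_and_angInt hb hα₀ h hα2 hint).1
  set lam := lambdaConst b α
  set A := (angInt (bFar b ε)).toReal with hA
  have hA0 : 0 ≤ A := ENNReal.toReal_nonneg
  set G := ENNReal.ofReal (Real.exp (δ * R ^ p * T)) with hG
  set ball : Set R3 := Metric.closedBall 0 R with hball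
  set H : ℝ → ℝ≥0∞ := fun t => ∫⁻ ξ in ball, ‖wDiff δ p φ ψ ξ t‖ₑ * wt α ξ with hH
  set h0 : ℝ≥0∞ := ∫⁻ ξ in ball, ‖φ₀ ξ - ψ₀ ξ‖ₑ * wt α ξ with hh0
  set E : ℝ≥0∞ := G * (16 * M * angMoment α (bNear b ε)) with hE
  have hGtop : G < ⊤ := ENNReal.ofReal_lt_top
  have hHle : ∀ t ∈ Icc 0 T, H t ≤ G * (M + M) := fun t ht =>
    setLIntegral_enorm_wDiff_le hδ hp hφ.toIsBoundedFamily hψ.toIsBoundedFamily ht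
  have hGM : G * (M + M) < ⊤ := ENNReal.mul_lt_top hGtop (ENNReal.add_lt_top.2 ⟨hM, hM⟩)
  have hw0 : ∀ ξ, wDiff δ p φ ψ ξ 0 = φ₀ ξ - ψ₀ ξ := fun ξ => by
    have h1 := hφ.equation ξ 0 ⟨le_rfl, hT⟩
    have h2 := hψ.equation ξ 0 ⟨le_rfl, hT⟩
    rw [wDiff, h1, h2]
    simp
  have hH0 : H 0 = h0 := by simp only [hH, hh0, hw0]
  have hh0top : h0 < ⊤ := by
    rw [← hH0]
    exact (hHle 0 ⟨le_rfl, hT⟩).trans_lt hGM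
  have hnear : angMoment α (bNear b ε) < ⊤ :=
    (angInt_mono fun x _ => mul_le_mul_left (indicator_le_self _ _ _) _).trans_lt hfin
  have hEtop : E < ⊤ := ENNReal.mul_lt_top hGtop
    (ENNReal.mul_lt_top (ENNReal.mul_lt_top (by simp) hM) hnear)
  have hwt := measurable_wt α
  have hmw := measurable_wDiff (δ := δ) (p := p) hφ.measurable hψ.measurable
  have hgm : Measurable (Function.uncurry fun (ξ : R3) (t : ℝ) => ‖wDiff δ p φ ψ ξ t‖ₑ) :=
    (hmw.enorm :)
  have hmg := measurable_gainInt (measurable_bFar hb ε) hgm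
  have hmb := (measurable_boundInt hφ.toIsBoundedFamily (measurable_bNear hb ε)).add
    (measurable_boundInt hψ.toIsBoundedFamily (measurable_bNear hb ε))
  obtain ⟨P, hP⟩ : ∃ P : R3 → ℝ → ℝ≥0∞, P = fun ξ τ =>
    gainInt (bFar b ε) (fun η => ‖wDiff δ p φ ψ η τ‖ₑ) ξ := ⟨_, rfl⟩
  obtain ⟨N, hN⟩ : ∃ N : R3 → ℝ → ℝ≥0∞, N = fun ξ τ =>
    boundInt α (bNear b ε) (fun η => φ η τ) ξ +
      boundInt α (bNear b ε) (fun η => ψ η τ) ξ := ⟨_, rfl⟩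
  have hPm : Measurable (Function.uncurry P) := by rw [hP]; exact hmg
  have hNm : Measurable (Function.uncurry N) := by rw [hN]; exact hmb
  -- The exceptional set of ξ is the same for all t, and the bound can be integrated over the ball
  -- at each time.
  have hae : ∀ᵐ ξ ∂(volume.restrict ball), ∀ t ∈ Icc 0 T,
      ENNReal.ofReal (Real.exp (A * t)) * ‖wDiff δ p φ ψ ξ t‖ₑ ≤
      ‖φ₀ ξ - ψ₀ ξ‖ₑ + ∫⁻ τ in Ioc 0 t, ENNReal.ofReal (Real.exp (A * τ)) *
        (P ξ τ + G * N ξ τ) := by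
    have hne : ∀ᵐ ξ : R3, ξ ≠ 0 := by simp [ae_iff]
    have f1 := ae_lintegral_boundInt_lt_top hα hM hφ.toIsBoundedFamily (measurable_bE hb) hfin
    have f2 := ae_lintegral_boundInt_lt_top hα hM hψ.toIsBoundedFamily (measurable_bE hb) hfin
    filter_upwards [ae_restrict_of_ae hne, ae_restrict_of_ae f1, ae_restrict_of_ae f2,
      ae_restrict_mem measurableSet_closedBall] with ξ h1 h2 h3 h4 t ht
    rw [hP, hN]
    exact enorm_wDiff_le hb hfar hδ hp hp2 hφ hψ h1 (mem_closedBall_zero_iff.1 h4) h2 h3 hε ht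
  have hPint : ∀ τ ∈ Icc 0 T, ∫⁻ ξ in ball, P ξ τ * wt α ξ ≤ ENNReal.ofReal (A + lam) * H τ := by
    intro τ _
    have hm : Measurable fun ξ => ‖wDiff δ p φ ψ ξ τ‖ₑ :=
      (hgm.comp (measurable_prodMk_right (y := τ)) :)
    rw [hP]
    refine (setLIntegral_gainInt_le (measurable_bFar hb ε) hm ?_).trans (mul_le_mul_left ?_ _)
    · have e1 := apply_zero_of_mem_spaceK (hφ.mem τ)
      have e2 := apply_zero_of_mem_spaceK (hψ.mem τ)
      simp [wDiff, e1, e2]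
    · refine (angInt_gain_le hb hα₀ h hα2 hint ε).trans (le_of_eq ?_)
      rw [ENNReal.ofReal_add hA0 hlam, hA, ENNReal.ofReal_toReal (hfar ε hε).ne]
  have hNint : ∀ τ ∈ Icc 0 T, ∫⁻ ξ in ball, N ξ τ * wt α ξ ≤
      16 * M * angMoment α (bNear b ε) := by
    intro τ hτ
    have hm : Measurable fun ξ => boundInt α (bNear b ε) (fun η => φ η τ) ξ :=
      ((measurable_boundInt hφ.toIsBoundedFamily (measurable_bNear hb ε)).comp
        (measurable_prodMk_right (y := τ)) :)
    have l1 := lintegral_boundInt_le hα hφ.toIsBoundedFamily (measurable_bNear hb ε) hτ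
    have l2 := lintegral_boundInt_le hα hψ.toIsBoundedFamily (measurable_bNear hb ε) hτ
    refine (setLIntegral_le_lintegral _ _).trans ?_
    simp only [hN, add_mul]
    have hm' : Measurable fun ξ => boundInt α (bNear b ε) (fun η => φ η τ) ξ * wt α ξ := hm.mul hwt
    rw [lintegral_add_left hm']
    refine (add_le_add l1 l2).trans (le_of_eq ?_)
    ring
  have hineq : ∀ t ∈ Icc 0 T, ENNReal.ofReal (Real.exp (A * t)) * H t ≤
      ENNReal.ofReal h0.toReal + ∫⁻ τ in Ioc 0 t,
        (ENNReal.ofReal (A + lam) * (ENNReal.ofReal (Real.exp (A * τ)) * H τ) +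
          ENNReal.ofReal (E.toReal * Real.exp (A * τ))) := by
    intro t ht
    rw [ENNReal.ofReal_toReal hh0top.ne]
    have hJm : Measurable (Function.uncurry fun (ξ : R3) (τ : ℝ) =>
        ENNReal.ofReal (Real.exp (A * τ)) * (P ξ τ + G * N ξ τ) * wt α ξ) := by
      have e1 : Measurable fun q : R3 × ℝ => ENNReal.ofReal (Real.exp (A * q.2)) := by fun_prop
      exact ((e1.mul (hPm.add (hNm.const_mul G))).mul (hwt.comp measurable_fst) :)
    have hJξ : ∀ ξ, Measurable fun τ : ℝ =>
        ENNReal.ofReal (Real.exp (A * τ)) * (P ξ τ + G * N ξ τ) := by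
      intro ξ
      have e1 : Measurable fun τ : ℝ => ENNReal.ofReal (Real.exp (A * τ)) := by fun_prop
      have e2 : Measurable fun τ : ℝ => P ξ τ := (hPm.comp (measurable_prodMk_left (x := ξ)) :)
      have e3 : Measurable fun τ : ℝ => N ξ τ := (hNm.comp (measurable_prodMk_left (x := ξ)) :)
      fun_prop
    calc ENNReal.ofReal (Real.exp (A * t)) * H t
        = ∫⁻ ξ in ball, (ENNReal.ofReal (Real.exp (A * t)) * ‖wDiff δ p φ ψ ξ t‖ₑ) * wt α ξ := by
          simp only [hH]
          rw [← lintegral_const_mul' _ _ ENNReal.ofReal_ne_top]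
          simp_rw [mul_assoc]
      _ ≤ ∫⁻ ξ in ball, (‖φ₀ ξ - ψ₀ ξ‖ₑ * wt α ξ + ∫⁻ τ in Ioc 0 t,
            ENNReal.ofReal (Real.exp (A * τ)) * (P ξ τ + G * N ξ τ) * wt α ξ) := by
          refine lintegral_mono_ae ?_
          filter_upwards [hae] with ξ hξ
          rw [lintegral_mul_const _ (hJξ ξ), ← add_mul]
          exact mul_le_mul_left (hξ t ht) _
      _ = h0 + ∫⁻ ξ in ball, ∫⁻ τ in Ioc 0 t,
            ENNReal.ofReal (Real.exp (A * τ)) * (P ξ τ + G * N ξ τ) * wt α ξ :=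
          lintegral_add_right _ hJm.lintegral_prod_right'
      _ = h0 + ∫⁻ τ in Ioc 0 t, ∫⁻ ξ in ball,
            ENNReal.ofReal (Real.exp (A * τ)) * (P ξ τ + G * N ξ τ) * wt α ξ := by
          rw [lintegral_lintegral_swap hJm.aemeasurable]
      _ ≤ _ := by
          refine add_le_add_right (setLIntegral_mono' measurableSet_Ioc fun τ hτ => ?_) _
          have hτ' : τ ∈ Icc 0 T := ⟨hτ.1.le, hτ.2.trans ht.2⟩
          have hPτ : Measurable fun ξ => P ξ τ := (hPm.comp (measurable_prodMk_right (y := τ)) :)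
          have hPτ' : Measurable fun ξ => P ξ τ * wt α ξ := hPτ.mul hwt
          have e1 : ∀ ξ, ENNReal.ofReal (Real.exp (A * τ)) * (P ξ τ + G * N ξ τ) * wt α ξ =
              ENNReal.ofReal (Real.exp (A * τ)) * (P ξ τ * wt α ξ + G * (N ξ τ * wt α ξ)) := by
            intro ξ; ring
          simp_rw [e1]
          rw [lintegral_const_mul' _ _ ENNReal.ofReal_ne_top, lintegral_add_left hPτ',
            lintegral_const_mul' _ _ hGtop.ne, ENNReal.ofReal_mul ENNReal.toReal_nonneg,
            ENNReal.ofReal_toReal hEtop.ne]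
          calc _ ≤ ENNReal.ofReal (Real.exp (A * τ)) * (ENNReal.ofReal (A + lam) * H τ + E) := by
                gcongr
                · exact hPint τ hτ'
                · exact mul_le_mul_right (hNint τ hτ') _
            _ = _ := by ring
  -- Only the finiteness of this bound matters: the constant disappears from the conclusion of
  -- Gronwall.
  have hbd : ∀ t ∈ Icc 0 T, ENNReal.ofReal (Real.exp (A * t)) * H t ≤
      ENNReal.ofReal (Real.exp (A * T) * (G * (M + M)).toReal) := by
    intro t ht
    rw [ENNReal.ofReal_mul (Real.exp_pos _).le, ENNReal.ofReal_toReal hGM.ne]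
    refine mul_le_mul' (ENNReal.ofReal_le_ofReal (Real.exp_le_exp.2 ?_)) (hHle t ht)
    have := ht.2
    gcongr
  have hgr := gronwall_lintegral (y := fun t => ENNReal.ofReal (Real.exp (A * t)) * H t)
    (l := A + lam) (by positivity) (le_add_of_nonneg_right hlam) ENNReal.toReal_nonneg
    ENNReal.toReal_nonneg (by positivity) hbd hineq (t := T) ⟨hT, le_rfl⟩
  -- Both sides carry e^{AT}; cancelling it removes all dependence on the loss rate, and only the
  -- remainder still involves ε.
  rw [add_mul, Real.exp_add, mul_assoc, ENNReal.ofReal_mul (Real.exp_pos _).le] at hgr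
  have hcancel := (ENNReal.mul_le_mul_iff_right (by simpa using Real.exp_pos (A * T))
    ENNReal.ofReal_ne_top).1 hgr
  refine hcancel.trans (le_of_eq ?_)
  rw [ENNReal.ofReal_mul (Real.exp_pos _).le, ENNReal.ofReal_add ENNReal.toReal_nonneg
    (by positivity), ENNReal.ofReal_toReal hh0top.ne, ENNReal.ofReal_mul ENNReal.toReal_nonneg,
    ENNReal.ofReal_toReal hEtop.ne]

theorem ball_estimate (hb : IsCrossSection b) {α₀ α : ℝ} (hα₀ : 0 < α₀) (h : α₀ ≤ α)
    (hα2 : α ≤ 2) (hint : WeaklyIntegrable b α₀) {δ p T R : ℝ} (hδ : 0 ≤ δ) (hp : 0 < p)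
    (hp2 : p ≤ 2) (hT : 0 ≤ T) {M : ℝ≥0∞} (hM : M < ⊤) {φ₀ ψ₀ : R3 → ℂ} {φ ψ : R3 → ℝ → ℂ}
    (hφ : IsSolutionFamily b δ p α T M φ₀ φ) (hψ : IsSolutionFamily b δ p α T M ψ₀ ψ) :
    ∫⁻ ξ in Metric.closedBall 0 R, ‖wDiff δ p φ ψ ξ T‖ₑ * wt α ξ ≤
      ENNReal.ofReal (Real.exp (lambdaConst b α * T)) *
        ∫⁻ ξ in Metric.closedBall 0 R, ‖φ₀ ξ - ψ₀ ξ‖ₑ * wt α ξ := by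
  have hlim := tendsto_angMoment_bNear hb (angMoment_bE_lt_top hb hα₀ h hint)
  have hMtop : 16 * M ≠ ⊤ := (ENNReal.mul_lt_top (by simp) hM).ne
  have h1 := ENNReal.Tendsto.const_mul (a := 16 * M) hlim (Or.inr hMtop)
  have h2 := ENNReal.Tendsto.const_mul (a := ENNReal.ofReal (Real.exp (δ * R ^ p * T))) h1
    (Or.inr ENNReal.ofReal_ne_top)
  have h3 := ENNReal.Tendsto.mul_const (b := ENNReal.ofReal T) h2 (Or.inr ENNReal.ofReal_ne_top)
  have h4 := h3.const_add (∫⁻ ξ in Metric.closedBall 0 R, ‖φ₀ ξ - ψ₀ ξ‖ₑ * wt α ξ)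
  have h5 := ENNReal.Tendsto.const_mul (a := ENNReal.ofReal (Real.exp (lambdaConst b α * T))) h4
    (Or.inr ENNReal.ofReal_ne_top)
  simp only [mul_zero, zero_mul, add_zero] at h5
  refine ge_of_tendsto h5 ?_
  filter_upwards [Ioo_mem_nhdsGT Real.pi_pos] with ε hε
  exact ball_estimate_cutoff hb hα₀ h hα2 hint hδ hp hp2 hT hM hφ hψ hε

/-! ### Exhaustion by balls, and uniqueness. -/

theorem MemTp.isSolutionFamily {δ p α β : ℝ} {φ₀ : R3 → ℂ} {φ : R3 → ℝ → ℂ}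
    (h : MemTp δ p α β φ) (hs : IsSolutionFE b δ p φ₀ φ) {T : ℝ} {M : ℝ≥0∞}
    (hM : ∀ t ∈ Icc 0 T, normM α (fun ξ => φ ξ t - 1) ≤ M) :
    IsSolutionFamily b δ p α T M φ₀ (fun ξ t => φ ξ (max t 0)) where
  measurable := measurable_uncurry_max h.1
  mem t := (h.1.mem _ (le_max_right t 0)).1
  bound t ht := by simpa only [max_eq_left ht.1] using hM t ht
  decay t ht ξ := by simpa only [max_eq_left ht] using h.2 t ht ξ
  continuousOn ξ := (h.1.continuousOn ξ).comp (by fun_prop) fun t _ => mem_Ici.2 (le_max_right t 0)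
  differentiableAt ξ t ht := by
    refine ((h.1.differentiableOn ξ).differentiableAt
      (Ioi_mem_nhds ht.1)).congr_of_eventuallyEq ?_
    filter_upwards [Ioi_mem_nhds ht.1] with s hs
    rw [max_eq_left (le_of_lt hs)]
  equation ξ t ht := by
    rw [max_eq_left ht.1, hs ξ t ht.1]
    congr 1
    refine intervalIntegral.integral_congr fun τ hτ => ?_
    rw [uIcc_of_le ht.1] at hτ
    simp only [max_eq_left hτ.1]

/-- Exponential stability of solutions in the weighted `𝓜^α` distance. -/
theorem normM_exp_mul_sub_le (hb : IsCrossSection b) {α₀ α : ℝ} (hα₀ : 0 < α₀) (h : α₀ ≤ α)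
    (hα2 : α ≤ 2) (hint : WeaklyIntegrable b α₀) {δ p β : ℝ} (hδ : 0 ≤ δ) (hp : 0 < p)
    (hp2 : p ≤ 2) {φ₀ ψ₀ : R3 → ℂ} {φ ψ : R3 → ℝ → ℂ} (hφ : MemTp δ p α β φ)
    (hψ : MemTp δ p α β ψ) (hφs : IsSolutionFE b δ p φ₀ φ) (hψs : IsSolutionFE b δ p ψ₀ ψ)
    {t : ℝ} (ht : 0 ≤ t) :
    normM α (fun ξ => (Real.exp (δ * ‖ξ‖ ^ p * t) : ℂ) * (φ ξ t - ψ ξ t)) ≤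
      ENNReal.ofReal (Real.exp (lambdaConst b α * t)) * normM α (fun ξ => φ₀ ξ - ψ₀ ξ) := by
  obtain ⟨M₁, hM₁, h₁⟩ := exists_normM_bound hφ.1 t
  obtain ⟨M₂, hM₂, h₂⟩ := exists_normM_bound hψ.1 t
  have f1 := hφ.isSolutionFamily hφs fun s hs => (h₁ s hs).trans (le_max_left M₁ M₂)
  have f2 := hψ.isSolutionFamily hψs fun s hs => (h₂ s hs).trans (le_max_right M₁ M₂)
  have hball : ∀ n : ℕ, ∫⁻ ξ in Metric.closedBall 0 (n : ℝ),
      ‖wDiff δ p φ ψ ξ t‖ₑ * wt α ξ ≤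
      ENNReal.ofReal (Real.exp (lambdaConst b α * t)) * normM α (fun ξ => φ₀ ξ - ψ₀ ξ) := by
    intro n
    have := ball_estimate (R := n) hb hα₀ h hα2 hint hδ hp hp2 ht (max_lt hM₁ hM₂) f1 f2
    simp only [wDiff, max_eq_left ht] at this ⊢
    exact this.trans (mul_le_mul_right (setLIntegral_le_lintegral _ _) _)
  have hw := measurable_wt α
  have m1 := (continuous_of_mem_spaceK (hφ.1.mem t ht).1).measurable
  have m2 := (continuous_of_mem_spaceK (hψ.1.mem t ht).1).measurable
  have hm : Measurable fun ξ => ‖wDiff δ p φ ψ ξ t‖ₑ * wt α ξ := by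
    unfold wDiff
    fun_prop
  -- The bound no longer depends on the radius, so the balls can exhaust the space.
  have hcov : AECover (volume : Measure R3) atTop fun n : ℕ => Metric.closedBall (0 : R3) (n : ℝ) :=
    aecover_closedBall tendsto_natCast_atTop_atTop
  exact le_of_tendsto' (hcov.lintegral_tendsto_of_countably_generated hm.aemeasurable) hball

/-- The weights are nowhere zero, so a vanishing norm means equality almost everywhere, hence
everywhere by continuity. -/
theorem eq_of_normM_exp_mul_sub_eq_zero {δ p α t : ℝ} {φ ψ : R3 → ℂ} (hφ : φ ∈ spaceK)
    (hψ : ψ ∈ spaceK)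
    (h : normM α (fun ξ => (Real.exp (δ * ‖ξ‖ ^ p * t) : ℂ) * (φ ξ - ψ ξ)) = 0) : φ = ψ := by
  have hw := measurable_wt α
  have c1 := continuous_of_mem_spaceK hφ
  have c2 := continuous_of_mem_spaceK hψ
  have m1 := c1.measurable
  have m2 := c2.measurable
  rw [normM_eq, lintegral_eq_zero_iff (by fun_prop)] at h
  refine (c1.ae_eq_iff_eq volume c2).1 ?_
  filter_upwards [h] with ξ hξ
  have h1 := (mul_eq_zero.1 hξ).resolve_right (wt_ne_zero α ξ)
  have h2 := (mul_eq_zero.1 (enorm_eq_zero.1 h1)).resolve_left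
    (by exact_mod_cast (Real.exp_pos _).ne')
  exact sub_eq_zero.1 h2

end Boltzmann

theorem theorem1p2
    (b : ℝ → ℝ) (hb : Boltzmann.IsCrossSection b)
    (α₀ : ℝ) (hα₀ : 0 < α₀) (hα₀2 : α₀ ≤ 2) (hint : Boltzmann.WeaklyIntegrable b α₀)
    (p : ℝ) (hp : 0 < p) (hp2 : p ≤ 2) (δ : ℝ) (hδ : 0 ≤ δ)
    (α : ℝ) (hα₀α : α₀ ≤ α) (hαp : α < p)
    (β : ℝ) (hβ : 0 < β) (hβα : β ≤ α) :
    (∀ φ₀ ∈ Boltzmann.spaceM α, ∀ ψ₀ ∈ Boltzmann.spaceM α,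
      ∀ φ ψ : Boltzmann.R3 → ℝ → ℂ,
        Boltzmann.MemTp δ p α β φ → Boltzmann.MemTp δ p α β ψ →
        Boltzmann.IsSolutionFE b δ p φ₀ φ → Boltzmann.IsSolutionFE b δ p ψ₀ ψ →
        ∀ t : ℝ, 0 ≤ t →
          Boltzmann.normM α
              (fun ξ => (Real.exp (δ * ‖ξ‖ ^ p * t) : ℂ) * (φ ξ t - ψ ξ t)) ≤
            ENNReal.ofReal (Real.exp (Boltzmann.lambdaConst b α * t)) *
              Boltzmann.normM α (fun ξ => φ₀ ξ - ψ₀ ξ)) ∧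
    (∀ φ₀ ∈ Boltzmann.spaceM α, ∀ φ ψ : Boltzmann.R3 → ℝ → ℂ,
        Boltzmann.MemTp δ p α β φ → Boltzmann.MemTp δ p α β ψ →
        Boltzmann.IsSolutionFE b δ p φ₀ φ → Boltzmann.IsSolutionFE b δ p φ₀ ψ →
        ∀ ξ : Boltzmann.R3, ∀ t : ℝ, 0 ≤ t → φ ξ t = ψ ξ t) := by
  have hα2 : α ≤ 2 := (hαp.trans_le hp2).le
  refine ⟨fun φ₀ _ ψ₀ _ φ ψ hφ hψ hφs hψs t ht =>
    Boltzmann.normM_exp_mul_sub_le hb hα₀ hα₀α hα2 hint hδ hp hp2 hφ hψ hφs hψs ht,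
    fun φ₀ _ φ ψ hφ hψ hφs hψs ξ t ht => ?_⟩
  have h := Boltzmann.normM_exp_mul_sub_le hb hα₀ hα₀α hα2 hint hδ hp hp2 hφ hψ hφs hψs ht
  have h0 : Boltzmann.normM α (fun ξ => φ₀ ξ - φ₀ ξ) = 0 := by simp [Boltzmann.normM]
  rw [h0, mul_zero] at h
  exact congrFun (Boltzmann.eq_of_normM_exp_mul_sub_eq_zero (hφ.1.mem t ht).1 (hψ.1.mem t ht).1
    (le_antisymm h zero_le)) ξ
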